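/- All functions are on $\mathbb{R}^3$. For a symmetric-matrix-valued function $S$, write $u=-2\,\mathrm{div}(-\Delta)^{-1}S$, understood in the sense of distributions: $\langle u_j,\varphi\rangle=2\sum_i\int S_{ij}\,(-\Delta)^{-1}\partial_i\varphi$, where $(-\Delta)^{-1}$ acts on test functions by convolution with $\frac{1}{4\pi|x|}$ (for $S\in L^3$ this defines $u$ modulo additive constants, so its derivatives are well-defined distributions). For $1<q<\infty$ let $$L^q_{st}=\{S\in L^q(\mathbb{R}^3;\mathbb{R}^{3\times3}_{sym}):\ \mathrm{tr}\,S=0,\ S=\nabla_{sym}(-\Delta)^{-1}(-2\,\mathrm{div}\,S)\},\qquad (\nabla_{sym}u)_{ij}=\tfrac12(\partial_iu_j+\partial_ju_i),$$ let $H^1_{st}\subset H^1$ be the set of all $S=\nabla_{sym}(-\Delta)^{-1/2}v$ with $v\in H^1(\mathbb{R}^3;\mathbb{R}^3)$ and $\nabla\cdot v=0$, and let $P_{st}$ be the orthogonal projection of $L^2(\mathbb{R}^3;\mathbb{R}^{3\times3})$ onto $L^2_{st}$. Write $\langle A,B\rangle=\int\sum_{i,j}A_{ij}B_{ij}$. (i)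 Let $S\in L^3_{st}$, $u=-2\,\mathrm{div}(-\Delta)^{-1}S$ and $\omega=\nabla\times u$. Then $\omega$ is (represented by) a function in $L^3$, all integrals below converge absolutely, and $$-4\int\det S=\langle S,\omega\otimes\omega\rangle,\qquad\text{hence}\qquad \Big\langle S,\tfrac13S^2+\tfrac14\,\omega\otimes\omega\Big\rangle=0.$$ (ii) Let $S\in H^1_{st}$. Then $u=-2\,\mathrm{div}(-\Delta)^{-1}S$ and $\omega=\nabla\times u$ are (represented by) locally integrable functions, $S=\nabla_{sym}u$, the matrix field $(u\cdot\nabla)S+\tfrac13S^2+\tfrac14\,\omega\otimes\omega$ lies in $L^2$, and its projection onto $L^2_{st}$ exists and is $L^2$-orthogonal to $S$: $$\Big\langle P_{st}\Big((u\cdot\nabla)S+\tfrac13S^2+\tfrac14\,\omega\otimes\omega\Big),S\Big\rangle=0.$$ -/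

import Mathlib

open MeasureTheory
open scoped ENNReal

noncomputable section

/-- Three-dimensional Euclidean space. -/
abbrev R3 : Type := EuclideanSpace ℝ (Fin 3)

/-- `3 × 3` real matrices. -/
abbrev Mat3 : Type := Matrix (Fin 3) (Fin 3) ℝ

/-! ### Test functions and distributions -/

/-- Test functions: the elements of `C_c^∞(ℝ³)`. -/
def IsTest (φ : R3 → ℝ) : Prop := ContDiff ℝ ((⊤ : ℕ∞) : WithTop ℕ∞) φ ∧ HasCompactSupport φ

/-- The classical partial derivative `∂_i φ`. -/
def pd (i : Fin 3) (φ : R3 → ℝ) : R3 → ℝ :=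
  fun x => fderiv ℝ φ x (EuclideanSpace.single i 1)

/-- A functional on test functions. -/
abbrev Functional3 : Type := (R3 → ℝ) → ℝ

/-- The (vector-valued) distribution given by a vector field: `φ ↦ ∫ u_j φ`. -/
def regular (u : R3 → R3) (j : Fin 3) : Functional3 := fun φ => ∫ x, u x j * φ x

/-- The locally integrable function `f` represents the distribution `T`. -/
def Represents (f : R3 → ℝ) (T : Functional3) : Prop :=
  LocallyIntegrable f ∧ ∀ φ, IsTest φ → ∫ x, f x * φ x = T φ

/-- The distributional derivative `∂_i T`. -/
def distDeriv (i : Fin 3) (T : Functional3) : Functional3 := fun φ => -T (pd i φ)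

/-- The `(i,j)` entry `(∂_i T_j + ∂_j T_i) / 2` of the distributional symmetric gradient. -/
def distSymGrad (T : Fin 3 → Functional3) (i j : Fin 3) : Functional3 :=
  fun φ => (distDeriv i (T j) φ + distDeriv j (T i) φ) / 2

/-- The `k`-th component `∂_{k+1} T_{k+2} - ∂_{k+2} T_{k+1}` (indices modulo 3) of the
distributional curl. -/
def distCurl (T : Fin 3 → Functional3) (k : Fin 3) : Functional3 :=
  fun φ => distDeriv (k + 1) (T (k + 2)) φ - distDeriv (k + 2) (T (k + 1)) φ

/-- The distributional divergence. -/
def distDiv (T : Fin 3 → Functional3) : Functional3 :=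
  fun φ => ∑ i, distDeriv i (T i) φ

/-! ### Inverse powers of the Laplacian -/

/-- `(-Δ)⁻¹ φ` for a function `φ`: the Newtonian potential `∫ φ(y) / (4π|x - y|) dy`. -/
def invLaplacian (φ : R3 → ℝ) : R3 → ℝ :=
  fun x => ∫ y, φ y / (4 * Real.pi * ‖x - y‖)

/-- `(-Δ)^{-1/2} v`: the Riesz potential `(2π²)⁻¹ ∫ v(y) / |x - y|² dy` of order one, which
converges absolutely for almost every `x` when `v` is square integrable. -/
def invSqrtLaplacian (v : R3 → R3) : R3 → R3 :=
  fun x => WithLp.toLp 2 fun j => ∫ y, v y j / (2 * Real.pi ^ 2 * ‖x - y‖ ^ 2)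

/-- The velocity `u = -2 div (-Δ)⁻¹ S`, as a distribution: moving the operator to the test function,
`⟨u_j, φ⟩ = 2 ∑_i ∫ S_{ij} (-Δ)⁻¹ ∂_i φ`.

Since `(-Δ)⁻¹ ∂_i φ` is bounded and `O(|x|⁻²)`, and `O(|x|⁻³)` if `∫ φ = 0`, this converges
absolutely for all test functions if `S ∈ L^q` with `1 < q < 3`, and for all test functions of mean
zero if `S ∈ L^q` with `1 < q < ∞`. For `q ≥ 3` the velocity is defined up to an additive constant,
that is, as a functional on test functions of mean zero; its derivatives, which evaluate it
only at derivatives of test functions, are distributions. -/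
def velocity (S : R3 → Mat3) (j : Fin 3) : Functional3 :=
  fun φ => 2 * ∑ i, ∫ x, S x i j * invLaplacian (pd i φ) x

/-- The vector field `u` is (a representative of) `-2 div (-Δ)⁻¹ S`. -/
def IsVelocity (S : R3 → Mat3) (u : R3 → R3) : Prop :=
  ∀ j, Represents (fun x => u x j) (velocity S j)

/-- The vector field `ω` is (a representative of) the vorticity: `ω = curl u`, where
`u = -2 div (-Δ)⁻¹ S`. -/
def IsVorticity (S : R3 → Mat3) (ω : R3 → R3) : Prop :=
  ∀ k, Represents (fun x => ω x k) (distCurl (velocity S) k)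

/-! ### Function spaces -/

/-- The matrix field belongs to `L^q(ℝ³)`. -/
def MemLqMat (q : ℝ≥0∞) (S : R3 → Mat3) : Prop := ∀ i j, MemLp (fun x => S x i j) q

/-- The vector field belongs to `L^q(ℝ³)`. -/
def MemLqVec (q : ℝ≥0∞) (u : R3 → R3) : Prop := ∀ i, MemLp (fun x => u x i) q

/-- The scalar Sobolev space `H¹(ℝ³)`. -/
def MemH1 (f : R3 → ℝ) : Prop :=
  MemLp f 2 ∧ ∀ k, ∃ g : R3 → ℝ, MemLp g 2 ∧
    Represents g (distDeriv k fun φ => ∫ x, f x * φ x)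

/-- `H¹_df`: divergence free vector fields with components in `H¹`. -/
def MemH1Df (v : R3 → R3) : Prop :=
  (∀ i, MemH1 fun x => v x i) ∧ ∀ φ, IsTest φ → distDiv (regular v) φ = 0

/-- `S = ∇_sym u` in the sense of distributions. -/
def IsSymGrad (u : R3 → R3) (S : R3 → Mat3) : Prop :=
  ∀ i j, Represents (fun x => S x i j) (distSymGrad (regular u) i j)

/-- `L^q_st`: symmetric, trace free `S ∈ L^q` with `S = ∇_sym (-Δ)⁻¹ (-2 div S)`. -/
def MemLqSt (q : ℝ≥0∞) (S : R3 → Mat3) : Prop :=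
  MemLqMat q S ∧ (∀ᵐ x, (S x).IsSymm) ∧ (∀ᵐ x, (S x).trace = 0) ∧
    ∀ i j, Represents (fun x => S x i j) (distSymGrad (velocity S) i j)

/-- `H¹_st`: the `S ∈ H¹` of the form `∇_sym (-Δ)^{-1/2} v` with `v ∈ H¹_df`. -/
def MemH1St (S : R3 → Mat3) : Prop :=
  (∀ i j, MemH1 fun x => S x i j) ∧ ∃ v, MemH1Df v ∧ IsSymGrad (invSqrtLaplacian v) S

/-- `DS k` is the weak partial derivative `∂_k S`. -/
def IsWeakGradient (S : R3 → Mat3) (DS : Fin 3 → R3 → Mat3) : Prop :=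
  ∀ k i j, Represents (fun x => DS k x i j) (distDeriv k fun φ => ∫ x, S x i j * φ x)

/-! ### Pairings, the projection and the dropped term -/

/-- The Frobenius product `A : B`. -/
def frob (A B : Mat3) : ℝ := ∑ i, ∑ j, A i j * B i j

/-- The tensor square `w ⊗ w`. -/
def tensorSq (w : R3) : Mat3 := Matrix.of fun i j => w i * w j

/-- `P = P_st F` almost everywhere: `P` is the orthogonal projection of `F ∈ L²` onto `L²_st`. -/
def IsStrainProjection (F P : R3 → Mat3) : Prop :=
  MemLqSt 2 P ∧ ∀ M, MemLqSt 2 M → ∫ x, frob (F x - P x) (M x) = 0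

/-- `(u·∇)S + S²/3 + (ω ⊗ ω)/4`, where `DS k` stands for `∂_k S`. -/
def droppedTerm (u ω : R3 → R3) (S : R3 → Mat3) (DS : Fin 3 → R3 → Mat3) : R3 → Mat3 :=
  fun x => (∑ k, u x k • DS k x) + (1 / 3 : ℝ) • (S x * S x) + (1 / 4 : ℝ) • tensorSq (ω x)

end

/-! Write U_ij = ∂_i u_j. The symmetric part of U is S and its antisymmetric part is encoded by ω.
In det U, expanded in these two parts, the terms of odd degree in ω cancel, and det U = det S + ¼ S
: (ω ⊗ ω) remains (`frob_tensorSq_eq`). On the other hand det ∇w is a null Lagrangian: it equals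
∇w_0 · (∇w_1 × ∇w_2), and the cross product is divergence free, so its integral vanishes
(`integral_det_grad_eq_zero`). Together these give -4 ∫ det S = ⟨S, ω ⊗ ω⟩; the second form follows
from tr S³ = 3 det S for symmetric trace free S (`frob_mul_self_eq`).

For S merely in L³ the null Lagrangian is applied to velocities of approximating test functions, and
the limit is taken in L³, where the determinant is continuous into L¹
(`exists_velocity_gradient_three`). This needs ∂_i ∂_k (-Δ)⁻¹ to be bounded on L³. The bound comes
from a Bellman function `bell` of size |z|³ + |y|^{3/2} that exceeds its supporting planes by
|Δz||Δy| (`bell_first_order`). Along a random walk whose steps have mean zero, the integral of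
`bell` of the averaged functions decreases, and the total drop dominates the sum over time of the
paired increments (`sum_range_integral_incr_le`). Summing the geometric series in Fourier variables
and letting the step length tend to zero produces the multipliers (w_i · ξ)² / ∑_j (w_j · ξ)²
(`tendsto_fullSym`). With steps ±e_a ± e_b the denominator is a multiple of |ξ|², and polarisation
gives ξ_i ξ_k / |ξ|² (`abs_integral_riesz_le_bell`). Testing with regularised powers of the
transform itself turns this into L³ and L^{3/2} integrability.

In part (ii), S in H¹ makes |ξ|⁻¹ times its Fourier transform integrable, so the velocity is bounded
and continuous (`exists_bounded_velocity`). The Sobolev embedding puts S and ω in L⁴, so the dropped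
term is square integrable. Transport by a bounded divergence free field is skew
(`sum_integral_transport_eq_zero`), and the remaining terms are orthogonal to S by part (i), since S
also lies in L³. The projection does not change the pairing with S because H¹_st is contained in
L²_st (`MemH1St.memLqSt_two`); it exists because L²_st is an orthogonal complement
(`memLqSt_two_iff`).

The Fourier symbols of the two potentials come from writing their kernels as superpositions of
Gaussians (`integral_schwartz_mul_kernel`). -/

noncomputable section

open Filter Topology
open scoped ContDiff FourierTransform SchwartzMap ComplexConjugate

/-! ### Test functions -/

namespace IsTest

variable {φ ψ : R3 → ℝ}

theorem continuous (h : IsTest φ) : Continuous φ := h.1.continuous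

theorem differentiable (h : IsTest φ) : Differentiable ℝ φ := h.1.differentiable (by simp)

theorem add (h : IsTest φ) (k : IsTest ψ) : IsTest (fun x => φ x + ψ x) :=
  ⟨h.1.add k.1, h.2.add k.2⟩

theorem const_mul (c : ℝ) (h : IsTest φ) : IsTest (fun x => c * φ x) :=
  ⟨contDiff_const.mul h.1, h.2.mul_left⟩

theorem sub (h : IsTest φ) (k : IsTest ψ) : IsTest (fun x => φ x - ψ x) := by
  simpa [sub_eq_add_neg] using h.add (k.const_mul (-1))

theorem mul_smooth (h : IsTest φ) (k : ContDiff ℝ ∞ ψ) : IsTest (fun x => φ x * ψ x) :=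
  ⟨h.1.mul k, h.2.mul_right⟩

theorem zero : IsTest (fun _ => 0) := ⟨contDiff_const, HasCompactSupport.zero⟩

theorem sum {ι : Type*} {s : Finset ι} {f : ι → R3 → ℝ} (h : ∀ i ∈ s, IsTest (f i)) :
    IsTest (fun x => ∑ i ∈ s, f i x) := by
  classical
  induction s using Finset.induction_on with
  | empty => simpa using zero
  | insert a s ha ih =>
    simp only [Finset.sum_insert ha]
    exact (h a (by simp)).add (ih fun i hi => h i (by simp [hi]))

theorem comp_add (h : IsTest φ) (w : R3) : IsTest (fun x => φ (x + w)) :=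
  ⟨h.1.comp (contDiff_id.add contDiff_const), h.2.comp_homeomorph (Homeomorph.addRight w)⟩

theorem memLp (h : IsTest φ) (p : ℝ≥0∞) : MemLp φ p :=
  h.continuous.memLp_of_hasCompactSupport h.2

theorem integrable (h : IsTest φ) : Integrable φ :=
  h.continuous.integrable_of_hasCompactSupport h.2

end IsTest

theorem ContDiff.pd {φ : R3 → ℝ} (h : ContDiff ℝ ∞ φ) (i : Fin 3) : ContDiff ℝ ∞ (pd i φ) :=
  (h.fderiv_right (m := ∞) (by simp)).clm_apply contDiff_const

theorem IsTest.pd {φ : R3 → ℝ} (h : IsTest φ) (i : Fin 3) : IsTest (pd i φ) :=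
  ⟨h.1.pd i, h.2.fderiv_apply ℝ _⟩

theorem pd_add {φ ψ : R3 → ℝ} (hφ : Differentiable ℝ φ) (hψ : Differentiable ℝ ψ) (i : Fin 3) :
    pd i (fun x => φ x + ψ x) = fun x => pd i φ x + pd i ψ x := by
  ext x; simp [pd, fderiv_fun_add (hφ x) (hψ x)]

theorem pd_sub {φ ψ : R3 → ℝ} (hφ : Differentiable ℝ φ) (hψ : Differentiable ℝ ψ) (i : Fin 3) :
    pd i (fun x => φ x - ψ x) = fun x => pd i φ x - pd i ψ x := by
  ext x; simp [pd, fderiv_fun_sub (hφ x) (hψ x)]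

theorem pd_const_mul {φ : R3 → ℝ} (hφ : Differentiable ℝ φ) (c : ℝ) (i : Fin 3) :
    pd i (fun x => c * φ x) = fun x => c * pd i φ x := by
  ext x; simp [pd, fderiv_const_mul (hφ x)]

theorem pd_mul {φ ψ : R3 → ℝ} (hφ : Differentiable ℝ φ) (hψ : Differentiable ℝ ψ) (i : Fin 3) :
    pd i (fun x => φ x * ψ x) = fun x => φ x * pd i ψ x + ψ x * pd i φ x := by
  ext x; simp [pd, fderiv_fun_mul (hφ x) (hψ x)]

theorem pd_comm {φ : R3 → ℝ} (hφ : ContDiff ℝ ∞ φ) (i j : Fin 3) :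
    pd i (pd j φ) = pd j (pd i φ) := by
  ext x
  have hd : DifferentiableAt ℝ (fderiv ℝ φ) x :=
    ((hφ.fderiv_right (m := ∞) (by simp)).differentiable (by simp)) x
  have key : ∀ a b : Fin 3, pd a (pd b φ) x =
      fderiv ℝ (fderiv ℝ φ) x (EuclideanSpace.single a 1) (EuclideanSpace.single b 1) := by
    intro a b
    unfold pd
    rw [fderiv_clm_apply hd (differentiableAt_const _)]
    simp
  rw [key, key]
  exact (hφ.contDiffAt.isSymmSndFDerivAt (by simp; exact WithTop.coe_le_coe.2 le_top)).eq _ _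

/-- Functions representing the same distribution agree almost everywhere. -/
theorem ae_eq_of_forall_test {f g : R3 → ℝ} (hf : LocallyIntegrable f) (hg : LocallyIntegrable g)
    (h : ∀ φ, IsTest φ → ∫ x, f x * φ x = ∫ x, g x * φ x) : f =ᵐ[volume] g := by
  refine ae_eq_of_integral_contDiff_smul_eq hf hg fun φ h1 h2 => ?_
  simpa [smul_eq_mul, mul_comm] using h φ ⟨h1, h2⟩

theorem Represents.ae_eq {f g : R3 → ℝ} {T : Functional3} (hf : Represents f T)
    (hg : Represents g T) : f =ᵐ[volume] g :=
  ae_eq_of_forall_test hf.1 hg.1 fun φ hφ => (hf.2 φ hφ).trans (hg.2 φ hφ).symm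

theorem MeasureTheory.MemLp.integrable_mul_two {f g : R3 → ℝ} (hf : MemLp f 2) (hg : MemLp g 2) :
    Integrable (fun x => f x * g x) :=
  hf.integrable_mul hg

theorem exists_test_tendsto {p : ℝ≥0∞} (hp : p ≠ ⊤) (hp1 : 1 ≤ p) {s : R3 → ℝ} (hs : MemLp s p) :
    ∃ f : ℕ → R3 → ℝ, (∀ n, IsTest (f n)) ∧
      Tendsto (fun n => eLpNorm (fun x => f n x - s x) p volume) atTop (𝓝 0) := by
  have h : ∀ n : ℕ, ∃ g, HasCompactSupport g ∧ ContDiff ℝ ∞ g ∧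
      eLpNorm (s - g) p volume ≤ ENNReal.ofReal (1 / ((n : ℝ) + 1)) :=
    fun n => hs.exist_eLpNorm_sub_le hp hp1 (by positivity)
  choose f h1 h2 h3 using h
  refine ⟨f, fun n => ⟨h2 n, h1 n⟩, ?_⟩
  have h0 : Tendsto (fun n : ℕ => ENNReal.ofReal (1 / ((n : ℝ) + 1))) atTop (𝓝 0) := by
    rw [← ENNReal.ofReal_zero]
    exact (ENNReal.continuous_ofReal.tendsto 0).comp tendsto_one_div_add_atTop_nhds_zero_nat
  refine tendsto_of_tendsto_of_tendsto_of_le_of_le tendsto_const_nhds h0 (fun _ => zero_le) ?_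
  intro n
  refine le_trans (le_of_eq ?_) (h3 n)
  exact eLpNorm_sub_comm (f n) s p volume

/-! ### Cutoff functions -/

/-- A sequence of test functions tending to one. -/
def cutoff (n : ℕ) (x : R3) : ℝ :=
  (⟨1, 2, one_pos, one_lt_two⟩ : ContDiffBump (0 : R3)) ((1 / ((n : ℝ) + 1)) • x)

theorem cutoff_isTest (n : ℕ) : IsTest (cutoff n) := by
  have hc : (1 / ((n : ℝ) + 1)) ≠ 0 := by positivity
  refine ⟨(ContDiffBump.contDiff _).comp (contDiff_id.const_smul (1 / ((n : ℝ) + 1))), ?_⟩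
  exact (ContDiffBump.hasCompactSupport _).comp_homeomorph (Homeomorph.smulOfNeZero _ hc)

theorem cutoff_nonneg (n : ℕ) (x : R3) : 0 ≤ cutoff n x := ContDiffBump.nonneg _

theorem cutoff_le_one (n : ℕ) (x : R3) : cutoff n x ≤ 1 := ContDiffBump.le_one _

theorem cutoff_tendsto (x : R3) : Tendsto (fun n => cutoff n x) atTop (𝓝 1) := by
  refine tendsto_const_nhds.congr' ?_
  filter_upwards [eventually_ge_atTop ⌈‖x‖⌉₊] with n hn
  refine (ContDiffBump.one_of_mem_closedBall _ ?_).symm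
  have : ‖x‖ ≤ n := (Nat.le_ceil _).trans (by exact_mod_cast hn)
  simp only [mem_closedBall_zero_iff, norm_smul]
  rw [Real.norm_of_nonneg (by positivity), one_div, inv_mul_le_iff₀ (by positivity)]
  linarith

/-- The cutoffs are dilates of one fixed bump, so each derivative carries the scaling factor. -/
theorem exists_bound_pd_cutoff (k : Fin 3) :
    ∃ C, 0 ≤ C ∧ ∀ n x, |pd k (cutoff n) x| ≤ C * (1 / ((n : ℝ) + 1)) := by
  set b : ContDiffBump (0 : R3) := ⟨1, 2, one_pos, one_lt_two⟩ with hb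
  have ht : IsTest b := ⟨b.contDiff, b.hasCompactSupport⟩
  obtain ⟨C, hC⟩ := (ht.pd k).continuous.bounded_above_of_compact_support (ht.pd k).2
  refine ⟨C, (norm_nonneg _).trans (hC 0), fun n x => ?_⟩
  have e : pd k (cutoff n) x = (1 / ((n : ℝ) + 1)) * pd k b ((1 / ((n : ℝ) + 1)) • x) := by
    have : cutoff n = fun x => b ((1 / ((n : ℝ) + 1)) • x) := rfl
    rw [this]
    simp only [pd]
    rw [fderiv_comp_smul]
    simp
  rw [e, abs_mul, abs_of_nonneg (by positivity), mul_comm]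
  exact mul_le_mul_of_nonneg_right (hC _) (by positivity)

/-- A distributional first order identity between square integrable functions may be tested
against smooth functions that are square integrable with their gradient. -/
theorem weak_identity_smooth {f₀ : R3 → ℝ} {f : Fin 3 → R3 → ℝ} (h₀ : MemLp f₀ 2)
    (hf : ∀ k, MemLp (f k) 2)
    (h : ∀ φ, IsTest φ → (∫ x, f₀ x * φ x) + ∑ k, ∫ x, f k x * pd k φ x = 0)
    {ψ : R3 → ℝ} (hψ : ContDiff ℝ ∞ ψ) (hψ2 : MemLp ψ 2) (hdψ : ∀ k, MemLp (pd k ψ) 2) :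
    (∫ x, f₀ x * ψ x) + ∑ k, ∫ x, f k x * pd k ψ x = 0 := by
  have lim0 : Tendsto (fun n => ∫ x, f₀ x * (cutoff n x * ψ x)) atTop (𝓝 (∫ x, f₀ x * ψ x)) := by
    refine tendsto_integral_of_dominated_convergence (fun x => ‖f₀ x * ψ x‖) ?_
      (h₀.integrable_mul_two hψ2).norm ?_ ?_
    · intro n
      exact h₀.aestronglyMeasurable.mul
        (((cutoff_isTest n).continuous.mul hψ.continuous).aestronglyMeasurable)
    · intro n
      filter_upwards with x
      rw [norm_mul, norm_mul, norm_mul]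
      have : ‖cutoff n x‖ ≤ 1 := by
        rw [Real.norm_of_nonneg (cutoff_nonneg n x)]; exact cutoff_le_one n x
      have := mul_le_of_le_one_left (norm_nonneg (ψ x)) this
      gcongr
    · filter_upwards with x
      simpa using ((cutoff_tendsto x).mul_const (ψ x)).const_mul (f₀ x)
  have lim1 : ∀ k, Tendsto (fun n => ∫ x, f k x * pd k (fun x => cutoff n x * ψ x) x) atTop
      (𝓝 (∫ x, f k x * pd k ψ x)) := by
    intro k
    -- The product rule leaves one term with the derivative on the cutoff. It is O(1/(n+1))
    -- pointwise, so it is dominated with the constant `C` and vanishes in the limit.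
    obtain ⟨C, hC0, hC⟩ := exists_bound_pd_cutoff k
    have e : ∀ n, pd k (fun x => cutoff n x * ψ x) =
        fun x => cutoff n x * pd k ψ x + ψ x * pd k (cutoff n) x :=
      fun n => pd_mul (cutoff_isTest n).differentiable (hψ.differentiable (by simp)) k
    refine tendsto_integral_of_dominated_convergence
      (fun x => ‖f k x * pd k ψ x‖ + C * ‖f k x * ψ x‖) ?_
      (((hf k).integrable_mul_two (hdψ k)).norm.add
        (((hf k).integrable_mul_two hψ2).norm.const_mul C)) ?_ ?_
    · intro n
      exact (hf k).aestronglyMeasurable.mul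
        ((((cutoff_isTest n).mul_smooth hψ).pd k).continuous.aestronglyMeasurable)
    · intro n
      filter_upwards with x
      rw [e n, mul_add]
      refine (norm_add_le _ _).trans (add_le_add ?_ ?_)
      · rw [norm_mul, norm_mul, norm_mul]
        have : ‖cutoff n x‖ ≤ 1 := by
          rw [Real.norm_of_nonneg (cutoff_nonneg n x)]; exact cutoff_le_one n x
        have := mul_le_of_le_one_left (norm_nonneg (pd k ψ x)) this
        gcongr
      · rw [← mul_assoc, norm_mul, mul_comm]
        refine mul_le_mul_of_nonneg_right ((hC n x).trans ?_) (norm_nonneg _)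
        refine mul_le_of_le_one_right hC0 ?_
        rw [div_le_one (by positivity)]
        linarith [(Nat.cast_nonneg n : (0 : ℝ) ≤ n)]
    · filter_upwards with x
      simp only [e]
      have h1 : Tendsto (fun n => pd k (cutoff n) x) atTop (𝓝 0) := by
        refine squeeze_zero_norm (fun n => hC n x) ?_
        simpa using tendsto_one_div_add_atTop_nhds_zero_nat.const_mul C
      simpa using ((((cutoff_tendsto x).mul_const (pd k ψ x)).add
        (h1.const_mul (ψ x))).const_mul (f k x))
  have lim := lim0.add (tendsto_finsetSum Finset.univ fun k _ => lim1 k)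
  refine tendsto_nhds_unique lim (tendsto_const_nhds.congr fun n => ?_)
  exact (h _ ((cutoff_isTest n).mul_smooth hψ)).symm

/-! ### The Fourier transform of real square integrable functions -/

/-- A test function as a complex Schwartz function. -/
def IsTest.toSchwartz {φ : R3 → ℝ} (h : IsTest φ) : 𝓢(R3, ℂ) :=
  HasCompactSupport.toSchwartzMap (f := fun x => (φ x : ℂ))
    (h.2.comp_left (g := ((↑) : ℝ → ℂ)) (by simp)) (Complex.ofRealCLM.contDiff.comp h.1)

theorem IsTest.toSchwartz_apply {φ : R3 → ℝ} (h : IsTest φ) (x : R3) :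
    h.toSchwartz x = (φ x : ℂ) := rfl

/-- The `L²` Fourier transform of a real function. -/
def L2F (f : R3 → ℝ) : R3 → ℂ :=
  open Classical in
  if h : MemLp (fun x => (f x : ℂ)) 2 volume then (𝓕 (h.toLp _ : Lp ℂ 2 (volume : Measure R3)) :) else 0

theorem MeasureTheory.MemLp.cx {f : R3 → ℝ} {p : ℝ≥0∞} (hf : MemLp f p volume) :
    MemLp (fun x => (f x : ℂ)) p volume := hf.ofReal

theorem L2F_eq {f : R3 → ℝ} (hf : MemLp f 2 volume) :
    L2F f = (𝓕 (hf.cx.toLp _ : Lp ℂ 2 (volume : Measure R3)) :) := by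
  unfold L2F; rw [dif_pos hf.cx]

theorem memLp_L2F (f : R3 → ℝ) : MemLp (L2F f) 2 := by
  unfold L2F
  split_ifs with h
  · exact Lp.memLp _
  · exact MemLp.zero

theorem parseval {f g : R3 → ℝ} (hf : MemLp f 2 volume) (hg : MemLp g 2 volume) :
    ∫ x, f x * g x = (∫ ξ, conj (L2F f ξ) * L2F g ξ).re := by
  have h := Lp.inner_fourier_eq (hf.cx.toLp _ : Lp ℂ 2 (volume : Measure R3)) (hg.cx.toLp _)
  rw [L2.inner_def, L2.inner_def, ← L2F_eq hf, ← L2F_eq hg] at h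
  have e1 : ∫ ξ, conj (L2F f ξ) * L2F g ξ = ∫ ξ, inner ℂ (L2F f ξ) (L2F g ξ) := by
    simp only [RCLike.inner_apply, mul_comm]
  rw [e1, h]
  have e2 : ∫ x, inner ℂ ((hf.cx.toLp _ : Lp ℂ 2 (volume : Measure R3)) x)
      ((hg.cx.toLp _ : Lp ℂ 2 (volume : Measure R3)) x) = ∫ x, ((f x * g x : ℝ) : ℂ) := by
    refine integral_congr_ae ?_
    filter_upwards [hf.cx.coeFn_toLp, hg.cx.coeFn_toLp] with x h1 h2
    rw [h1, h2]
    simp [mul_comm]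
  rw [e2, integral_complex_ofReal, Complex.ofReal_re]

theorem integral_L2F_mul {f : R3 → ℝ} (hf : MemLp f 2 volume) (η : 𝓢(R3, ℂ)) :
    ∫ ξ, η ξ * L2F f ξ = ∫ x, 𝓕 η x * (f x : ℂ) := by
  have h := Lp.fourier_toTemperedDistribution_eq (hf.cx.toLp _ : Lp ℂ 2 (volume : Measure R3))
  have h2 := DFunLike.congr_fun h η
  rw [TemperedDistribution.fourier_apply, Lp.toTemperedDistribution_apply,
    Lp.toTemperedDistribution_apply, ← L2F_eq hf] at h2
  simp only [smul_eq_mul] at h2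
  rw [← h2]
  refine integral_congr_ae ?_
  filter_upwards [hf.cx.coeFn_toLp] with x h1
  rw [h1]

/-- Locally integrable functions agreeing against Schwartz functions agree almost everywhere. -/
theorem ae_eq_of_forall_schwartz {f g : R3 → ℂ} (hf : LocallyIntegrable f)
    (hg : LocallyIntegrable g) (h : ∀ η : 𝓢(R3, ℂ), ∫ x, η x * f x = ∫ x, η x * g x) :
    f =ᵐ[volume] g := by
  refine ae_eq_of_integral_contDiff_smul_eq hf hg fun φ h1 h2 => ?_
  exact h (IsTest.toSchwartz ⟨h1, h2⟩)

theorem locallyIntegrable_of_memLp_two {E : Type*} [NormedAddCommGroup E] {f : R3 → E}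
    (hf : MemLp f 2) : LocallyIntegrable f :=
  hf.locallyIntegrable (by norm_num)

theorem L2F_congr {f g : R3 → ℝ} (hf : MemLp f 2 volume) (h : f =ᵐ[volume] g) :
    L2F f = L2F g := by
  rw [L2F_eq hf, L2F_eq (hf.ae_eq h)]
  have e : (hf.cx.toLp _ : Lp ℂ 2 (volume : Measure R3)) = (hf.ae_eq h).cx.toLp _ := by
    refine MemLp.toLp_congr _ _ ?_
    filter_upwards [h] with x hx using by rw [hx]
  rw [e]

theorem L2F_test {φ : R3 → ℝ} (h : IsTest φ) :
    L2F φ =ᵐ[volume] 𝓕 (fun x => (φ x : ℂ)) := by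
  rw [L2F_eq (h.memLp 2)]
  have e : ((h.memLp 2).cx.toLp _ : Lp ℂ 2 (volume : Measure R3)) = h.toSchwartz.toLp 2 := by
    refine Lp.ext ?_
    filter_upwards [(h.memLp 2).cx.coeFn_toLp, h.toSchwartz.coeFn_toLp 2 volume] with x h1 h2
    rw [h1, h2, h.toSchwartz_apply]
  rw [e, SchwartzMap.toLp_fourier_eq]
  filter_upwards [(𝓕 h.toSchwartz).coeFn_toLp 2 volume] with x h1
  rw [h1]
  rfl

/-- The Fourier symbol `2πi ξ_k` of `∂_k`. -/
def sym (k : Fin 3) (ξ : R3) : ℂ := 2 * Real.pi * Complex.I * (ξ k : ℂ)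

theorem continuous_sym (k : Fin 3) : Continuous (sym k) := by
  unfold sym; fun_prop

theorem sym_hasTemperateGrowth (k : Fin 3) :
    (fun ξ : R3 => inner ℝ ξ (EuclideanSpace.single k (1 : ℝ))).HasTemperateGrowth := by
  fun_prop

theorem smul_smulLeftCLM_apply (k : Fin 3) (χ : 𝓢(R3, ℂ)) (ξ : R3) :
    ((2 * Real.pi * Complex.I) • SchwartzMap.smulLeftCLM ℂ
      (fun ξ : R3 => inner ℝ ξ (EuclideanSpace.single k (1 : ℝ))) χ) ξ = sym k ξ * χ ξ := by
  rw [_root_.smul_apply, SchwartzMap.smulLeftCLM_apply_apply (sym_hasTemperateGrowth k)]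
  simp only [EuclideanSpace.inner_single_right, sym, smul_eq_mul, Complex.real_smul]
  simp
  ring

theorem fourier_pd {φ : R3 → ℝ} (h : IsTest φ) (k : Fin 3) (ξ : R3) :
    𝓕 (fun x => (pd k φ x : ℂ)) ξ = sym k ξ * 𝓕 (fun x => (φ x : ℂ)) ξ := by
  have e : (h.pd k).toSchwartz =
      LineDeriv.lineDerivOp (EuclideanSpace.single k (1 : ℝ)) h.toSchwartz := by
    ext x
    rw [SchwartzMap.lineDerivOp_apply_eq_fderiv, IsTest.toSchwartz_apply]
    have : (h.toSchwartz : R3 → ℂ) = Complex.ofRealCLM ∘ φ := rfl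
    rw [this, fderiv_comp x Complex.ofRealCLM.differentiableAt (h.differentiable x)]
    simp [pd]
  have h1 := DFunLike.congr_fun (congrArg (fun F : 𝓢(R3, ℂ) => 𝓕 F) e) ξ
  simp only [SchwartzMap.fourier_lineDerivOp_eq] at h1
  have h2 : 𝓕 (fun x => (pd k φ x : ℂ)) ξ = 𝓕 (h.pd k).toSchwartz ξ := rfl
  rw [h2, h1, smul_smulLeftCLM_apply]
  rfl

theorem schwartz_re_im (η : 𝓢(R3, ℂ)) (L : ℂ →L[ℝ] ℝ) :
    ContDiff ℝ ∞ (fun x => L (η x)) ∧ MemLp (fun x => L (η x)) 2 ∧ ∀ k,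
      (pd k (fun x => L (η x)) = fun x =>
        L ((LineDeriv.lineDerivOp (EuclideanSpace.single k (1 : ℝ)) η) x)) ∧
      MemLp (pd k (fun x => L (η x))) 2 := by
  have hL : ∀ θ : 𝓢(R3, ℂ), MemLp (fun x => L (θ x)) 2 := fun θ =>
    L.comp_memLp' (θ.memLp 2 volume)
  refine ⟨L.contDiff.comp (η.smooth ⊤), hL η, fun k => ?_⟩
  have e : (pd k (fun x => L (η x)) = fun x =>
        L ((LineDeriv.lineDerivOp (EuclideanSpace.single k (1 : ℝ)) η) x)) := by
    ext x
    rw [SchwartzMap.lineDerivOp_apply_eq_fderiv]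
    have : (fun x => L (η x)) = L ∘ η := rfl
    unfold pd
    rw [this, fderiv_comp x L.differentiableAt (η.differentiable x)]
    simp
  exact ⟨e, e ▸ hL _⟩

/-- The identity is applied to the real and imaginary parts of `η`. Schwartz functions are needed
because the Fourier transform destroys compact support. -/
theorem weak_identity_schwartz {f₀ : R3 → ℝ} {f : Fin 3 → R3 → ℝ} (h₀ : MemLp f₀ 2)
    (hf : ∀ k, MemLp (f k) 2)
    (h : ∀ φ, IsTest φ → (∫ x, f₀ x * φ x) + ∑ k, ∫ x, f k x * pd k φ x = 0) (η : 𝓢(R3, ℂ)) :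
    (∫ x, η x * (f₀ x : ℂ)) + ∑ k, ∫ x,
      (LineDeriv.lineDerivOp (EuclideanSpace.single k (1 : ℝ)) η) x * (f k x : ℂ) = 0 := by
  have hint : ∀ (θ : 𝓢(R3, ℂ)) (g : R3 → ℝ), MemLp g 2 →
      Integrable (fun x => θ x * (g x : ℂ)) := fun θ g hg =>
    (θ.memLp 2 volume).integrable_mul hg.cx
  have key : ∀ L : ℂ →L[ℝ] ℝ, (∀ z (r : ℝ), L (z * r) = L z * r) →
      L ((∫ x, η x * (f₀ x : ℂ)) + ∑ k, ∫ x,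
        (LineDeriv.lineDerivOp (EuclideanSpace.single k (1 : ℝ)) η) x * (f k x : ℂ)) = 0 := by
    intro L hL
    obtain ⟨a1, a2, a3⟩ := schwartz_re_im η L
    have := weak_identity_smooth h₀ hf h a1 a2 fun k => (a3 k).2
    rw [map_add, map_sum, ← L.integral_comp_comm (hint _ _ h₀), ← this]
    congr 1
    · exact integral_congr_ae (Eventually.of_forall fun x => (hL _ _).trans (mul_comm _ _))
    · refine Finset.sum_congr rfl fun k _ => ?_
      rw [← L.integral_comp_comm (hint _ _ (hf k)), (a3 k).1]
      exact integral_congr_ae (Eventually.of_forall fun x => (hL _ _).trans (mul_comm _ _))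
  apply Complex.ext
  · simpa using key Complex.reCLM (by simp)
  · simpa using key Complex.imCLM (by simp)

/-- A first order distributional identity, in Fourier variables. -/
theorem L2F_of_weak_identity {f₀ : R3 → ℝ} {f : Fin 3 → R3 → ℝ} (h₀ : MemLp f₀ 2)
    (hf : ∀ k, MemLp (f k) 2)
    (h : ∀ φ, IsTest φ → (∫ x, f₀ x * φ x) + ∑ k, ∫ x, f k x * pd k φ x = 0) :
    L2F f₀ =ᵐ[volume] fun ξ => ∑ k, sym k ξ * L2F (f k) ξ := by
  have hloc : ∀ k, LocallyIntegrable (fun ξ => sym k ξ * L2F (f k) ξ) := fun k =>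
    (locallyIntegrable_of_memLp_two (memLp_L2F (f k))).continuous_mul (continuous_sym k)
  refine ae_eq_of_forall_schwartz (locallyIntegrable_of_memLp_two (memLp_L2F _))
    (locallyIntegrable_finsetSum _ fun k _ => hloc k) fun χ => ?_
  -- Testing with a Fourier transform turns the derivatives of the test function into multiplication
  -- of `χ` by the symbol, up to sign.
  have key := weak_identity_schwartz h₀ hf h (𝓕 χ)
  have e : ∀ k, ∫ x, (LineDeriv.lineDerivOp (EuclideanSpace.single k (1 : ℝ)) (𝓕 χ)) x *
      (f k x : ℂ) = - ∫ ξ, χ ξ * (sym k ξ * L2F (f k) ξ) := by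
    intro k
    rw [SchwartzMap.lineDerivOp_fourier_eq, ← integral_L2F_mul (hf k), ← integral_neg]
    refine integral_congr_ae (Eventually.of_forall fun ξ => ?_)
    simp only [neg_smul]
    rw [_root_.neg_apply, smul_smulLeftCLM_apply]
    ring
  have hint : ∀ k, Integrable (fun ξ => χ ξ * (sym k ξ * L2F (f k) ξ)) := by
    intro k
    have := (((2 * Real.pi * Complex.I) • SchwartzMap.smulLeftCLM ℂ (fun ξ : R3 => inner ℝ ξ
      (EuclideanSpace.single k (1 : ℝ))) χ).memLp 2 volume).integrable_mul (memLp_L2F (f k))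
    refine this.congr (Eventually.of_forall fun ξ => ?_)
    simp only [Pi.mul_apply]
    rw [smul_smulLeftCLM_apply]
    ring
  rw [Finset.sum_congr rfl fun k _ => e k, ← integral_L2F_mul h₀] at key
  simp only [Finset.mul_sum]
  rw [integral_finsetSum _ fun k _ => hint k]
  rw [Finset.sum_neg_distrib] at key
  linear_combination key

/-! ### Weakly singular kernels -/

theorem finrank_R3 : Module.finrank ℝ R3 = 3 := by simp

theorem locallyIntegrable_norm_rpow {a : ℝ} (ha : a < 3) :
    LocallyIntegrable (fun x : R3 => ‖x‖ ^ (-a)) := by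
  refine locallyIntegrable_of_norm_le_rpow (C := 1) (α := a) (by simp) (by simpa using ha) ?_
    (measurable_norm.pow_const _).aestronglyMeasurable
  filter_upwards with x
  rw [Real.norm_of_nonneg (by positivity), one_mul]

/-- Multiplying a bounded integrable function by `‖x‖ ^ (-a)` with `0 ≤ a < 3` keeps it
integrable. -/
theorem integrable_mul_norm_rpow {E : Type*} [NormedAddCommGroup E] [NormedSpace ℝ E] {a C : ℝ}
    (ha0 : 0 ≤ a) (ha : a < 3) {f : R3 → E} (hf : Integrable f) (hC : ∀ x, ‖f x‖ ≤ C) :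
    Integrable (fun x => ‖x‖ ^ (-a) • f x) := by
  have h1 : IntegrableOn (fun x : R3 => ‖x‖ ^ (-a)) (Metric.closedBall 0 1) :=
    (locallyIntegrable_norm_rpow ha).integrableOn_isCompact (isCompact_closedBall 0 1)
  have h2 : Integrable ((Metric.closedBall (0 : R3) 1).indicator fun x : R3 => ‖x‖ ^ (-a)) :=
    (integrable_indicator_iff Metric.isClosed_closedBall.measurableSet).2 h1
  have hm : AEStronglyMeasurable (fun x : R3 => ‖x‖ ^ (-a)) volume :=
    (measurable_norm.pow_const _).aestronglyMeasurable
  refine Integrable.mono' ((h2.mul_const C).add hf.norm)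
    (hm.smul hf.aestronglyMeasurable) ?_
  filter_upwards with x
  rw [norm_smul, Real.norm_of_nonneg (by positivity)]
  have hC0 : 0 ≤ C := (norm_nonneg _).trans (hC x)
  by_cases hx : ‖x‖ ≤ 1
  · have : x ∈ Metric.closedBall (0 : R3) 1 := by simpa using hx
    simp only [Set.indicator_of_mem this, Pi.add_apply]
    have := mul_le_mul_of_nonneg_left (hC x) (show 0 ≤ ‖x‖ ^ (-a) by positivity)
    linarith [norm_nonneg (f x)]
  · have h' : x ∉ Metric.closedBall (0 : R3) 1 := by simpa using hx
    simp only [Set.indicator_of_notMem h', Pi.add_apply, zero_mul, zero_add]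
    refine mul_le_of_le_one_left (norm_nonneg _) ?_
    exact Real.rpow_le_one_of_one_le_of_nonpos (not_le.1 hx).le (by linarith)

/-- Euler's integral for Γ(b) after the substitution t ↦ 1/t. With A = π|x|² it exhibits a power of
|x| as a superposition of Gaussians. -/
theorem integral_Ioi_exp_neg_div {b A : ℝ} (hb : 0 < b) (hA : 0 < A) :
    IntegrableOn (fun t : ℝ => t ^ (-b - 1) * Real.exp (-(A / t))) (Set.Ioi 0) ∧
    ∫ t in Set.Ioi (0 : ℝ), t ^ (-b - 1) * Real.exp (-(A / t)) =
      (1 / A) ^ b * Real.Gamma b := by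
  have e : Set.EqOn (fun x : ℝ => (|(-1 : ℝ)| * x ^ ((-1 : ℝ) - 1)) •
      ((x ^ (-1 : ℝ)) ^ (b - 1) * Real.exp (-(A * x ^ (-1 : ℝ)))))
      (fun t : ℝ => t ^ (-b - 1) * Real.exp (-(A / t))) (Set.Ioi 0) := by
    intro x hx
    have hx : 0 < x := hx
    simp only [smul_eq_mul, abs_neg, abs_one, one_mul]
    rw [← mul_assoc, ← Real.rpow_mul hx.le, ← Real.rpow_add hx, Real.rpow_neg_one]
    congr 2
    ring
  constructor
  · refine IntegrableOn.congr_fun ?_ e measurableSet_Ioi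
    refine (integrableOn_Ioi_comp_rpow_iff
      (fun x : ℝ => x ^ (b - 1) * Real.exp (-(A * x))) (by norm_num)).2 ?_
    have := integrableOn_rpow_mul_exp_neg_mul_rpow (p := 1) (s := b - 1) (b := A) (by linarith)
      one_pos hA
    simpa using this
  · rw [← Real.integral_rpow_mul_exp_neg_mul_Ioi hb hA,
      ← integral_comp_rpow_Ioi (fun x : ℝ => x ^ (b - 1) * Real.exp (-(A * x)))
      (p := -1) (by norm_num)]
    exact (setIntegral_congr_fun measurableSet_Ioi e).symm

/-- Fubini: since `k` is nonnegative, its absolute integral in t is `κ` itself, so integrability of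
`F` against `κ` suffices. -/
theorem integral_superposition {F : R3 → ℂ} {k : R3 → ℝ → ℝ} {κ : R3 → ℝ}
    (hF : AEStronglyMeasurable F volume) (hk : Measurable (Function.uncurry k))
    (hk0 : ∀ y, ∀ t ∈ Set.Ioi (0 : ℝ), 0 ≤ k y t)
    (hint : ∀ᵐ y, IntegrableOn (k y) (Set.Ioi 0))
    (hκ : ∀ᵐ y, ∫ t in Set.Ioi (0 : ℝ), k y t = κ y)
    (hFκ : Integrable (fun y => F y * (κ y : ℂ))) :
    ∫ t in Set.Ioi (0 : ℝ), ∫ y, F y * (k y t : ℂ) = ∫ y, F y * (κ y : ℂ) := by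
  have hmeas : AEStronglyMeasurable (Function.uncurry fun (y : R3) (t : ℝ) => F y * (k y t : ℂ))
      (volume.prod (volume.restrict (Set.Ioi 0))) := by
    refine (hF.comp_fst).mul ?_
    exact (Complex.measurable_ofReal.comp hk).aestronglyMeasurable
  have hI : Integrable (Function.uncurry fun (y : R3) (t : ℝ) => F y * (k y t : ℂ))
      (volume.prod (volume.restrict (Set.Ioi 0))) := by
    rw [integrable_prod_iff hmeas]
    constructor
    · filter_upwards [hint] with y hy
      exact (Integrable.ofReal hy).const_mul (F y)
    · refine hFκ.norm.congr ?_
      filter_upwards [hκ] with y hy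
      have hκ0 : 0 ≤ κ y := by
        rw [← hy]; exact setIntegral_nonneg measurableSet_Ioi (hk0 y)
      simp only [Function.uncurry_apply_pair, norm_mul, Complex.norm_real]
      rw [integral_const_mul]
      congr 1
      rw [Real.norm_of_nonneg hκ0, ← hy]
      exact setIntegral_congr_fun measurableSet_Ioi
        fun t ht => (Real.norm_of_nonneg (hk0 y t ht)).symm
  rw [← integral_integral_swap hI]
  refine integral_congr_ae ?_
  filter_upwards [hκ] with y hy
  rw [integral_const_mul, integral_complex_ofReal, hy]

/-- The multiplication formula ∫ φ̂ g = ∫ φ ĝ for a modulated Gaussian g, whose Fourier transform is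
a Gaussian centred at `x`. -/
theorem integral_schwartz_mul_gaussian (φ : 𝓢(R3, ℂ)) (x : R3) {s : ℝ} (hs : 0 < s) :
    ∫ ξ, (𝓕 φ ξ * Complex.exp (2 * Real.pi * Complex.I * (inner ℝ x ξ : ℝ))) *
      ((Real.exp (-(Real.pi * ‖ξ‖ ^ 2 * s)) : ℝ) : ℂ) =
    ∫ y, φ y * ((s ^ (-(3 / 2) : ℝ) * Real.exp (-(Real.pi * ‖x - y‖ ^ 2 / s)) : ℝ) : ℂ) := by
  have hb : 0 < ((Real.pi * s : ℝ) : ℂ).re := by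
    rw [Complex.ofReal_re]; exact mul_pos Real.pi_pos hs
  have h := VectorFourier.integral_fourierIntegral_smul_eq_flip (e := Real.fourierChar)
    (L := innerₗ R3) (μ := volume) (ν := volume) (f := φ)
    (g := fun v => Complex.exp (-((Real.pi * s : ℝ) : ℂ) * ‖v‖ ^ 2 +
      2 * Real.pi * Complex.I * (inner ℝ x v : ℝ))) Real.continuous_fourierChar
      continuous_inner φ.integrable (GaussianFourier.integrable_cexp_neg_mul_sq_norm_add hb _ _)
  rw [flip_innerₗ] at h
  have h2 : ∀ w, VectorFourier.fourierIntegral Real.fourierChar volume (innerₗ R3)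
      (fun v => Complex.exp (-((Real.pi * s : ℝ) : ℂ) * ‖v‖ ^ 2 +
      2 * Real.pi * Complex.I * (inner ℝ x v : ℝ))) w =
      ((s ^ (-(3 / 2) : ℝ) * Real.exp (-(Real.pi * ‖x - w‖ ^ 2 / s)) : ℝ) : ℂ) := by
    intro w
    have h3 := fourier_gaussian_innerProductSpace' hb x w
    refine h3.trans ?_
    have hpi := Real.pi_pos
    have e1 : ((Real.pi : ℂ) / ((Real.pi * s : ℝ) : ℂ)) = ((s⁻¹ : ℝ) : ℂ) := by
      push_cast; field_simp
    have e2 : (((Module.finrank ℝ R3 : ℕ) : ℂ) / 2) = ((3 / 2 : ℝ) : ℂ) := by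
      rw [finrank_R3]; push_cast; ring
    rw [e1, e2, ← Complex.ofReal_cpow (by positivity), Real.inv_rpow hs.le,
      ← Real.rpow_neg hs.le]
    push_cast
    congr 2
    field_simp
  refine Eq.trans ?_ (h.trans ?_)
  · refine integral_congr_ae (Eventually.of_forall fun ξ => ?_)
    simp only [smul_eq_mul]
    rw [mul_assoc]
    congr 1
    rw [Complex.ofReal_exp, ← Complex.exp_add]
    congr 1
    push_cast
    ring
  · simp only [h2, smul_eq_mul]

/-- The Fourier transform of a homogeneous kernel, tested against a Schwartz function. -/
theorem integral_schwartz_mul_kernel {b : ℝ} (hb : 0 < b) (hb' : b < 3 / 2) (φ : 𝓢(R3, ℂ))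
    (x : R3) (hφ : Integrable fun y => φ y * (((1 / (Real.pi * ‖x - y‖ ^ 2)) ^ b *
      Real.Gamma b : ℝ) : ℂ)) :
    ∫ y, φ y * (((1 / (Real.pi * ‖x - y‖ ^ 2)) ^ b * Real.Gamma b : ℝ) : ℂ) =
    ∫ ξ, (𝓕 φ ξ * Complex.exp (2 * Real.pi * Complex.I * (inner ℝ x ξ : ℝ))) *
      (((1 / (Real.pi * ‖ξ‖ ^ 2)) ^ (3 / 2 - b) * Real.Gamma (3 / 2 - b) : ℝ) : ℂ) := by
  have hpi := Real.pi_pos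
  have hc : 0 < 3 / 2 - b := by linarith
  have hne : ∀ z : R3, ∀ᵐ y : R3, y ≠ z := fun z => by
    simp [ae_iff, measure_singleton]
  have hbd : ∀ ξ, ‖𝓕 φ ξ‖ ≤ ‖(𝓕 φ).toBoundedContinuousFunction‖ := fun ξ =>
    (𝓕 φ).toBoundedContinuousFunction.norm_coe_le_norm ξ
  have hg : Continuous fun ξ : R3 => 𝓕 φ ξ *
      Complex.exp (2 * Real.pi * Complex.I * (inner ℝ x ξ : ℝ)) := by
    have := (𝓕 φ).continuous
    fun_prop
  have hexp : ∀ ξ : R3, ‖Complex.exp (2 * Real.pi * Complex.I * (inner ℝ x ξ : ℝ))‖ = 1 := by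
    intro ξ
    rw [Complex.norm_exp]
    simp
  have L := integral_superposition (F := fun y => φ y)
    (k := fun y t => t ^ (-b - 1) * Real.exp (-(Real.pi * ‖x - y‖ ^ 2 / t)))
    (κ := fun y => (1 / (Real.pi * ‖x - y‖ ^ 2)) ^ b * Real.Gamma b)
    φ.continuous.aestronglyMeasurable (by unfold Function.uncurry; fun_prop)
    (fun y t ht => by have : 0 < t := ht; positivity)
    (by
      filter_upwards [hne x] with y hy
      have : 0 < ‖x - y‖ := norm_pos_iff.2 (sub_ne_zero.2 (Ne.symm hy))
      exact (integral_Ioi_exp_neg_div hb (by positivity)).1)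
    (by
      filter_upwards [hne x] with y hy
      have : 0 < ‖x - y‖ := norm_pos_iff.2 (sub_ne_zero.2 (Ne.symm hy))
      exact (integral_Ioi_exp_neg_div hb (by positivity)).2) hφ
  have R := integral_superposition (F := fun ξ => 𝓕 φ ξ *
      Complex.exp (2 * Real.pi * Complex.I * (inner ℝ x ξ : ℝ)))
    (k := fun ξ t => t ^ ((3 / 2 - b) - 1) * Real.exp (-(Real.pi * ‖ξ‖ ^ 2 * t)))
    (κ := fun ξ => (1 / (Real.pi * ‖ξ‖ ^ 2)) ^ (3 / 2 - b) * Real.Gamma (3 / 2 - b))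
    hg.aestronglyMeasurable (by unfold Function.uncurry; fun_prop)
    (fun y t ht => by have : 0 < t := ht; positivity)
    (by
      filter_upwards [hne 0] with y hy
      have : 0 < ‖y‖ := norm_pos_iff.2 hy
      have := integrableOn_rpow_mul_exp_neg_mul_rpow (p := 1) (s := (3 / 2 - b) - 1)
        (b := Real.pi * ‖y‖ ^ 2) (by linarith) one_pos (by positivity)
      simpa using this)
    (by
      filter_upwards [hne 0] with y hy
      have : 0 < ‖y‖ := norm_pos_iff.2 hy
      exact Real.integral_rpow_mul_exp_neg_mul_Ioi hc (by positivity))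
    (by
      have hI : Integrable fun ξ : R3 => 𝓕 φ ξ *
          Complex.exp (2 * Real.pi * Complex.I * (inner ℝ x ξ : ℝ)) := by
        refine (𝓕 φ).integrable.mono hg.aestronglyMeasurable (Eventually.of_forall fun ξ => ?_)
        rw [norm_mul, hexp, mul_one]
      have := integrable_mul_norm_rpow (a := 2 * (3 / 2 - b)) (by linarith) (by linarith) hI
        (C := ‖(𝓕 φ).toBoundedContinuousFunction‖) (fun ξ => by
          rw [norm_mul, hexp, mul_one]; exact hbd ξ)
      refine (this.const_mul (((1 / Real.pi) ^ (3 / 2 - b) * Real.Gamma (3 / 2 - b) : ℝ) : ℂ)).congr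
        (Eventually.of_forall fun ξ => ?_)
      have e : (1 / (Real.pi * ‖ξ‖ ^ 2)) ^ (3 / 2 - b) =
          (1 / Real.pi) ^ (3 / 2 - b) * ‖ξ‖ ^ (-(2 * (3 / 2 - b))) := by
        rw [← one_div_mul_one_div, Real.mul_rpow (by positivity) (by positivity)]
        congr 1
        rw [one_div, Real.inv_rpow (by positivity), Real.rpow_neg (norm_nonneg _),
          ← Real.rpow_natCast, ← Real.rpow_mul (norm_nonneg _)]
        norm_num
      simp only [e, Complex.real_smul]
      push_cast
      ring)
  rw [← L, ← R]
  -- The two superpositions agree for each t separately, since -b - 1 = ((3/2 - b) - 1) - 3/2 and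
  -- t^(-3/2) is the normalisation of the Gaussian in dimension three.
  refine setIntegral_congr_fun measurableSet_Ioi fun t ht => ?_
  have ht : 0 < t := ht
  have G := integral_schwartz_mul_gaussian φ x ht
  calc ∫ y, φ y * ((t ^ (-b - 1) * Real.exp (-(Real.pi * ‖x - y‖ ^ 2 / t)) : ℝ) : ℂ)
      = ((t ^ ((3 / 2 - b) - 1) : ℝ) : ℂ) * ∫ y, φ y *
        ((t ^ (-(3 / 2) : ℝ) * Real.exp (-(Real.pi * ‖x - y‖ ^ 2 / t)) : ℝ) : ℂ) := by
        rw [← integral_const_mul]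
        refine integral_congr_ae (Eventually.of_forall fun y => ?_)
        have : t ^ (-b - 1) = t ^ ((3 / 2 - b) - 1) * t ^ (-(3 / 2) : ℝ) := by
          rw [← Real.rpow_add ht]; congr 1; ring
        simp only [this]
        push_cast
        ring
    _ = _ := by
        rw [← G, ← integral_const_mul]
        refine integral_congr_ae (Eventually.of_forall fun y => ?_)
        simp only
        push_cast
        ring

/-! ### Potentials of test functions -/

/-- Convolution of the kernel `κ` with `φ`. -/
def pot (κ φ : R3 → ℝ) (x : R3) : ℝ := ∫ y, κ y * φ (x - y)

theorem pot_eq_convolution (κ φ : R3 → ℝ) :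
    pot κ φ = convolution κ φ (ContinuousLinearMap.mul ℝ ℝ) volume := rfl

theorem contDiff_pot {κ φ : R3 → ℝ} (hκ : LocallyIntegrable κ) (hφ : IsTest φ) :
    ContDiff ℝ ∞ (pot κ φ) :=
  hφ.2.contDiff_convolution_right (ContinuousLinearMap.mul ℝ ℝ) hκ hφ.1

theorem pd_pot {κ φ : R3 → ℝ} (hκ : LocallyIntegrable κ) (hφ : IsTest φ) (i : Fin 3) :
    pd i (pot κ φ) = pot κ (pd i φ) := by
  ext x
  have h1 := hφ.2.hasFDerivAt_convolution_right (ContinuousLinearMap.mul ℝ ℝ) hκ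
    (hφ.1.of_le (by exact_mod_cast le_top)) x
  have h2 := convolution_precompR_apply (ContinuousLinearMap.mul ℝ ℝ) hκ
    (hφ.2.fderiv ℝ) (hφ.1.continuous_fderiv (by simp)) x (EuclideanSpace.single i 1)
  unfold pd
  rw [pot_eq_convolution, h1.fderiv, h2, pot_eq_convolution]

theorem integrable_pot {κ φ : R3 → ℝ} (hκ : LocallyIntegrable κ) (hφ : IsTest φ) (x : R3) :
    Integrable (fun y => κ y * φ (x - y)) := by
  have h := hφ.2.comp_homeomorph (Homeomorph.subLeft x)
  have c : Continuous (φ ∘ Homeomorph.subLeft x) := hφ.continuous.comp (Homeomorph.continuous _)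
  exact hκ.integrable_smul_right_of_hasCompactSupport c h

theorem pot_add {κ φ ψ : R3 → ℝ} (hκ : LocallyIntegrable κ) (hφ : IsTest φ) (hψ : IsTest ψ) :
    pot κ (fun x => φ x + ψ x) = fun x => pot κ φ x + pot κ ψ x := by
  ext x
  simp only [pot, mul_add]
  exact integral_add (integrable_pot hκ hφ x) (integrable_pot hκ hψ x)

theorem pot_const_mul (κ φ : R3 → ℝ) (c : ℝ) :
    pot κ (fun x => c * φ x) = fun x => c * pot κ φ x := by
  ext x
  simp only [pot, ← integral_const_mul]
  congr 1; ext y; ring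

/-! ### The Newtonian and Riesz kernels and their Fourier representations -/

/-- The Newtonian kernel. -/
def newtonKernel (y : R3) : ℝ := 1 / (4 * Real.pi * ‖y‖)

/-- The kernel of `(-Δ)^{-1/2}`. -/
def rieszKernel (y : R3) : ℝ := 1 / (2 * Real.pi ^ 2 * ‖y‖ ^ 2)

/-- The Riesz potential of order one of a scalar function. -/
def rieszPot (φ : R3 → ℝ) : R3 → ℝ := pot rieszKernel φ

theorem locallyIntegrable_newtonKernel : LocallyIntegrable newtonKernel := by
  refine ((locallyIntegrable_norm_rpow (a := 1) (by norm_num)).smul (1 / (4 * Real.pi))).congr ?_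
  filter_upwards with y
  simp only [Pi.smul_apply, smul_eq_mul, Real.rpow_neg_one, newtonKernel]
  rw [← one_div, one_div_mul_one_div]

theorem locallyIntegrable_rieszKernel : LocallyIntegrable rieszKernel := by
  refine ((locallyIntegrable_norm_rpow (a := 2) (by norm_num)).smul
    (1 / (2 * Real.pi ^ 2))).congr ?_
  filter_upwards with y
  simp only [Pi.smul_apply, smul_eq_mul, rieszKernel]
  rw [Real.rpow_neg (norm_nonneg _), ← one_div, one_div_mul_one_div]
  norm_num

theorem pot_eq_integral_kernel (κ φ : R3 → ℝ) (x : R3) :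
    pot κ φ x = ∫ y, φ y * κ (x - y) := by
  rw [← integral_sub_left_eq_self (fun y => φ y * κ (x - y)) volume x]
  simp only [pot, sub_sub_cancel, mul_comm]

theorem invLaplacian_eq_pot (φ : R3 → ℝ) : invLaplacian φ = pot newtonKernel φ := by
  ext x
  rw [pot_eq_integral_kernel]
  simp only [invLaplacian, newtonKernel, mul_one_div]

theorem contDiff_invLaplacian {φ : R3 → ℝ} (h : IsTest φ) : ContDiff ℝ ∞ (invLaplacian φ) := by
  rw [invLaplacian_eq_pot]; exact contDiff_pot locallyIntegrable_newtonKernel h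

theorem pd_invLaplacian {φ : R3 → ℝ} (h : IsTest φ) (i : Fin 3) :
    pd i (invLaplacian φ) = invLaplacian (pd i φ) := by
  rw [invLaplacian_eq_pot, invLaplacian_eq_pot, pd_pot locallyIntegrable_newtonKernel h]

theorem gamma_half_kernel {r : ℝ} (hr : 0 ≤ r) :
    (1 / (Real.pi * r ^ 2)) ^ (1 / 2 : ℝ) * Real.Gamma (1 / 2) = 1 / r := by
  have hpi := Real.pi_pos
  rw [Real.Gamma_one_half_eq, ← Real.sqrt_eq_rpow, ← Real.sqrt_mul (by positivity),
    show 1 / (Real.pi * r ^ 2) * Real.pi = (1 / r) ^ 2 by field_simp, Real.sqrt_sq (by positivity)]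

/-- The case b = 1/2 of the kernel formula: Γ(1/2) = √π makes the left kernel 1/|x|, and the dual
exponent 1 makes the right one 1/(π|ξ|²). -/
theorem invLaplacian_eq_fourierInv {φ : R3 → ℝ} (h : IsTest φ) (x : R3) :
    (invLaplacian φ x : ℂ) = 𝓕⁻ (fun ξ : R3 => 𝓕 (fun y => (φ y : ℂ)) ξ *
      ((1 / (4 * Real.pi ^ 2 * ‖ξ‖ ^ 2) : ℝ) : ℂ)) x := by
  have hpi := Real.pi_pos
  have hint : Integrable fun y => φ y * newtonKernel (x - y) := by
    have := (integrable_pot locallyIntegrable_newtonKernel h x).comp_sub_left x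
    simpa [mul_comm] using this
  have e : ∀ y : R3, h.toSchwartz y * (((1 / (Real.pi * ‖x - y‖ ^ 2)) ^ (1 / 2 : ℝ) *
      Real.Gamma (1 / 2) : ℝ) : ℂ) =
      (4 * Real.pi : ℂ) * ((φ y * newtonKernel (x - y) : ℝ) : ℂ) := by
    intro y
    rw [gamma_half_kernel (norm_nonneg _), h.toSchwartz_apply, newtonKernel]
    push_cast
    by_cases hy : ‖x - y‖ = 0
    · simp [hy]
    · have : (‖x - y‖ : ℂ) ≠ 0 := by exact_mod_cast hy
      field_simp
  have key := integral_schwartz_mul_kernel (b := 1 / 2) (by norm_num) (by norm_num) h.toSchwartz x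
    ((hint.ofReal.const_mul (4 * Real.pi : ℂ)).congr
      (Eventually.of_forall fun y => (e y).symm))
  simp only [e] at key
  rw [integral_const_mul, integral_complex_ofReal, ← pot_eq_integral_kernel,
    ← invLaplacian_eq_pot] at key
  have : (invLaplacian φ x : ℂ) = (1 / (4 * Real.pi) : ℂ) * (4 * Real.pi * invLaplacian φ x) := by
    have : (Real.pi : ℂ) ≠ 0 := by exact_mod_cast hpi.ne'
    field_simp
  rw [this, key, Real.fourierInv_eq', ← integral_const_mul]
  refine integral_congr_ae (Eventually.of_forall fun ξ => ?_)
  have e2 : 𝓕 h.toSchwartz ξ = 𝓕 (fun y => (φ y : ℂ)) ξ := rfl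
  have e3 : (1 / (Real.pi * ‖ξ‖ ^ 2)) ^ (3 / 2 - 1 / 2 : ℝ) * Real.Gamma (3 / 2 - 1 / 2) =
      1 / (Real.pi * ‖ξ‖ ^ 2) := by
    norm_num
  have e4 : Complex.exp (((2 * Real.pi * inner ℝ ξ x : ℝ) : ℂ) * Complex.I) =
      Complex.exp (2 * Real.pi * Complex.I * (inner ℝ x ξ : ℝ)) := by
    rw [real_inner_comm]; congr 1; push_cast; ring
  simp only [e2, e3, e4, smul_eq_mul]
  push_cast
  by_cases hy : ‖ξ‖ = 0
  · simp [hy]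
  · have : (‖ξ‖ : ℂ) ≠ 0 := by exact_mod_cast hy
    have : (Real.pi : ℂ) ≠ 0 := by exact_mod_cast hpi.ne'
    field_simp

/-- The case b = 1 of the kernel formula, with dual exponent 1/2. -/
theorem rieszPot_eq_fourierInv {φ : R3 → ℝ} (h : IsTest φ) (x : R3) :
    (rieszPot φ x : ℂ) = 𝓕⁻ (fun ξ : R3 => 𝓕 (fun y => (φ y : ℂ)) ξ *
      ((1 / (2 * Real.pi * ‖ξ‖) : ℝ) : ℂ)) x := by
  have hpi := Real.pi_pos
  have hint : Integrable fun y => φ y * rieszKernel (x - y) := by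
    have := (integrable_pot locallyIntegrable_rieszKernel h x).comp_sub_left x
    simpa [mul_comm] using this
  have e : ∀ y : R3, h.toSchwartz y * (((1 / (Real.pi * ‖x - y‖ ^ 2)) ^ (1 : ℝ) *
      Real.Gamma 1 : ℝ) : ℂ) =
      (2 * Real.pi : ℂ) * ((φ y * rieszKernel (x - y) : ℝ) : ℂ) := by
    intro y
    rw [Real.Gamma_one, Real.rpow_one, mul_one, h.toSchwartz_apply, rieszKernel]
    push_cast
    by_cases hy : ‖x - y‖ = 0
    · simp [hy]
    · have : (‖x - y‖ : ℂ) ≠ 0 := by exact_mod_cast hy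
      have : (Real.pi : ℂ) ≠ 0 := by exact_mod_cast hpi.ne'
      field_simp
  have key := integral_schwartz_mul_kernel (b := 1) (by norm_num) (by norm_num) h.toSchwartz x
    ((hint.ofReal.const_mul (2 * Real.pi : ℂ)).congr
      (Eventually.of_forall fun y => (e y).symm))
  simp only [e] at key
  rw [integral_const_mul, integral_complex_ofReal, ← pot_eq_integral_kernel] at key
  change _ * ((rieszPot φ x : ℝ) : ℂ) = _ at key
  have : (rieszPot φ x : ℂ) = (1 / (2 * Real.pi) : ℂ) * (2 * Real.pi * rieszPot φ x) := by
    have : (Real.pi : ℂ) ≠ 0 := by exact_mod_cast hpi.ne'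
    field_simp
  rw [this, key, Real.fourierInv_eq', ← integral_const_mul]
  refine integral_congr_ae (Eventually.of_forall fun ξ => ?_)
  have e2 : 𝓕 h.toSchwartz ξ = 𝓕 (fun y => (φ y : ℂ)) ξ := rfl
  have e3 : (1 / (Real.pi * ‖ξ‖ ^ 2)) ^ (3 / 2 - 1 : ℝ) * Real.Gamma (3 / 2 - 1) = 1 / ‖ξ‖ := by
    rw [show (3 / 2 - 1 : ℝ) = 1 / 2 by norm_num]
    exact gamma_half_kernel (norm_nonneg _)
  have e4 : Complex.exp (((2 * Real.pi * inner ℝ ξ x : ℝ) : ℂ) * Complex.I) =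
      Complex.exp (2 * Real.pi * Complex.I * (inner ℝ x ξ : ℝ)) := by
    rw [real_inner_comm]; congr 1; push_cast; ring
  simp only [e2, e3, e4, smul_eq_mul]
  push_cast
  by_cases hy : ‖ξ‖ = 0
  · simp [hy]
  · have : (‖ξ‖ : ℂ) ≠ 0 := by exact_mod_cast hy
    have : (Real.pi : ℂ) ≠ 0 := by exact_mod_cast hpi.ne'
    field_simp

/-! ### Inverse Fourier transforms of functions in `L¹ ∩ L²` -/

theorem continuous_fourierInv {h : R3 → ℂ} (h1 : Integrable h) : Continuous (𝓕⁻ h) :=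
  VectorFourier.fourierIntegral_continuous Real.continuous_fourierChar
    (L := -innerₗ R3) (continuous_inner (𝕜 := ℝ) (E := R3)).neg h1

theorem norm_fourierInv_le (h : R3 → ℂ) (x : R3) : ‖𝓕⁻ h x‖ ≤ ∫ ξ, ‖h ξ‖ := by
  rw [Real.fourierInv_eq]
  refine (norm_integral_le_integral_norm _).trans (le_of_eq ?_)
  simp [Circle.norm_smul]

theorem integral_fourierInv_mul {h g : R3 → ℂ} (h1 : Integrable h) (g1 : Integrable g) :
    ∫ x, 𝓕⁻ h x * g x = ∫ ξ, h ξ * 𝓕⁻ g ξ := by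
  have := VectorFourier.integral_fourierIntegral_smul_eq_flip (e := Real.fourierChar)
    (L := -innerₗ R3) (μ := volume) (ν := volume) Real.continuous_fourierChar
    (continuous_inner (𝕜 := ℝ) (E := R3)).neg h1 g1
  rw [show (-innerₗ R3).flip = -innerₗ R3 by
    ext x y; simp [real_inner_comm]] at this
  exact this

theorem fourierInv_ae_eq {h : R3 → ℂ} (h1 : Integrable h) (h2 : MemLp h 2 volume) :
    (𝓕⁻ (h2.toLp h : Lp ℂ 2 (volume : Measure R3)) : Lp ℂ 2 (volume : Measure R3))
      =ᵐ[volume] 𝓕⁻ h := by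
  refine ae_eq_of_forall_schwartz (locallyIntegrable_of_memLp_two (Lp.memLp _))
    (continuous_fourierInv h1).locallyIntegrable fun η => ?_
  have a := DFunLike.congr_fun (Lp.fourierInv_toTemperedDistribution_eq
    (h2.toLp h : Lp ℂ 2 (volume : Measure R3))) η
  rw [TemperedDistribution.fourierInv_apply, Lp.toTemperedDistribution_apply,
    Lp.toTemperedDistribution_apply] at a
  simp only [smul_eq_mul] at a
  rw [← a]
  have b := integral_fourierInv_mul η.integrable h1
  rw [← b]
  refine integral_congr_ae ?_
  filter_upwards [h2.coeFn_toLp] with x hx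
  rw [hx, SchwartzMap.fourierInv_coe]

/-- For `h` in L¹ ∩ L² the inverse Fourier integral and the Plancherel inverse agree almost
everywhere, so Fourier inversion in L² applies. -/
theorem L2F_of_fourierInv {f : R3 → ℝ} {h : R3 → ℂ} (h1 : Integrable h) (h2 : MemLp h 2 volume)
    (hf : ∀ x, (f x : ℂ) = 𝓕⁻ h x) : MemLp f 2 volume ∧ L2F f =ᵐ[volume] h := by
  have e : (fun x => (f x : ℂ)) = 𝓕⁻ h := funext hf
  have h3 : MemLp (fun x => (f x : ℂ)) 2 volume :=
    e ▸ (Lp.memLp _).ae_eq (fourierInv_ae_eq h1 h2)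
  have h4 : MemLp f 2 volume := by simpa using h3.re
  refine ⟨h4, ?_⟩
  rw [L2F_eq h4]
  have e5 : (h4.cx.toLp _ : Lp ℂ 2 (volume : Measure R3)) = 𝓕⁻ (h2.toLp h) := by
    refine Lp.ext ?_
    filter_upwards [h4.cx.coeFn_toLp, fourierInv_ae_eq h1 h2] with x a b
    rw [a, b, hf]
  rw [e5, FourierTransform.fourier_fourierInv_eq]
  exact h2.coeFn_toLp

/-! ### Fourier multipliers of the potentials -/

/-- In dimension three both |ξ|⁻¹ and |ξ|⁻² are locally integrable; the Schwartz factor takes care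
of infinity. -/
theorem memLp_of_norm_le_inv_mul_schwartz {m : R3 → ℂ} (hm : Measurable m) {C : ℝ}
    (hC : ∀ ξ, ‖m ξ‖ ≤ C * ‖ξ‖⁻¹) (η : 𝓢(R3, ℂ)) :
    Integrable (fun ξ => m ξ * η ξ) ∧ MemLp (fun ξ => m ξ * η ξ) 2 volume := by
  have hmeas : AEStronglyMeasurable (fun ξ => m ξ * η ξ) volume :=
    hm.aestronglyMeasurable.mul η.continuous.aestronglyMeasurable
  have hbd : ∀ ξ, ‖η ξ‖ ≤ ‖η.toBoundedContinuousFunction‖ := fun ξ =>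
    η.toBoundedContinuousFunction.norm_coe_le_norm ξ
  constructor
  · have := integrable_mul_norm_rpow (a := 1) (by norm_num) (by norm_num) η.integrable hbd
    refine (this.norm.const_mul C).mono' hmeas (Eventually.of_forall fun ξ => ?_)
    rw [norm_mul, norm_smul, Real.rpow_neg_one, norm_inv, norm_norm, ← mul_assoc]
    exact mul_le_mul_of_nonneg_right (hC ξ) (norm_nonneg _)
  · rw [memLp_two_iff_integrable_sq_norm hmeas]
    have hsq : Integrable (fun ξ => ‖η ξ‖ ^ 2) :=
      (memLp_two_iff_integrable_sq_norm η.continuous.aestronglyMeasurable).1 (η.memLp 2 volume)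
    have := integrable_mul_norm_rpow (a := 2) (C := ‖η.toBoundedContinuousFunction‖ ^ 2)
      (by norm_num) (by norm_num) hsq (fun ξ => by
        rw [norm_pow, norm_norm]
        exact pow_le_pow_left₀ (norm_nonneg _) (hbd ξ) 2)
    refine (this.const_mul (C ^ 2)).mono' (hmeas.norm.pow 2) (Eventually.of_forall fun ξ => ?_)
    rw [norm_pow, norm_norm, norm_mul, smul_eq_mul, Real.rpow_neg (norm_nonneg _), ← mul_assoc,
      mul_pow]
    refine mul_le_mul_of_nonneg_right ?_ (by positivity)
    calc ‖m ξ‖ ^ 2 ≤ (C * ‖ξ‖⁻¹) ^ 2 := pow_le_pow_left₀ (norm_nonneg _) (hC ξ) 2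
      _ = _ := by rw [mul_pow, inv_pow]; norm_num

/-- The Fourier symbol of `∂_k (-Δ)⁻¹`. -/
def nsym (k : Fin 3) (ξ : R3) : ℂ := sym k ξ * ((1 / (4 * Real.pi ^ 2 * ‖ξ‖ ^ 2) : ℝ) : ℂ)

/-- The Fourier symbol of `(-Δ)^{-1/2}`. -/
def rsym (ξ : R3) : ℝ := 1 / (2 * Real.pi * ‖ξ‖)

theorem measurable_sym (k : Fin 3) : Measurable (sym k) := (continuous_sym k).measurable

theorem measurable_nsym (k : Fin 3) : Measurable (nsym k) := by
  unfold nsym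
  refine (measurable_sym k).mul (Complex.measurable_ofReal.comp ?_)
  fun_prop

theorem measurable_rsym : Measurable rsym := by
  unfold rsym; fun_prop

theorem norm_sym_le (k : Fin 3) (ξ : R3) : ‖sym k ξ‖ ≤ 2 * Real.pi * ‖ξ‖ := by
  have h : |ξ k| ≤ ‖ξ‖ := by simpa using PiLp.norm_apply_le ξ k
  simp only [sym, norm_mul, Complex.norm_I, mul_one, Complex.norm_real, Real.norm_eq_abs,
    abs_of_pos Real.pi_pos, Complex.norm_ofNat]
  exact mul_le_mul_of_nonneg_left h (by positivity)

theorem norm_nsym_le (k : Fin 3) (ξ : R3) : ‖nsym k ξ‖ ≤ 1 / (2 * Real.pi) * ‖ξ‖⁻¹ := by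
  rw [nsym, norm_mul, Complex.norm_real, Real.norm_of_nonneg (by positivity)]
  refine (mul_le_mul_of_nonneg_right (norm_sym_le k ξ) (by positivity)).trans (le_of_eq ?_)
  have := Real.pi_pos
  by_cases h : ‖ξ‖ = 0
  · simp [h]
  · field_simp; norm_num

theorem norm_rsym_le (ξ : R3) : ‖((rsym ξ : ℝ) : ℂ)‖ ≤ 1 / (2 * Real.pi) * ‖ξ‖⁻¹ := by
  have := Real.pi_pos
  rw [Complex.norm_real, rsym, Real.norm_of_nonneg (by positivity), one_div_mul_eq_div,
    one_div, mul_inv]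
  rw [div_eq_mul_inv, mul_comm]

theorem sym_mul_nsym (i k : Fin 3) (ξ : R3) :
    sym i ξ * nsym k ξ = -((ξ i * ξ k / ‖ξ‖ ^ 2 : ℝ) : ℂ) := by
  have : (Real.pi : ℂ) ≠ 0 := by exact_mod_cast Real.pi_pos.ne'
  unfold nsym sym
  by_cases h : ‖ξ‖ = 0
  · simp [h]
  · have : (‖ξ‖ : ℂ) ≠ 0 := by exact_mod_cast h
    push_cast
    field_simp
    rw [Complex.I_sq]
    ring

theorem norm_sym_mul_nsym_le (i k : Fin 3) (ξ : R3) : ‖sym i ξ * nsym k ξ‖ ≤ 1 := by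
  rw [norm_mul]
  refine (mul_le_mul (norm_sym_le i ξ) (norm_nsym_le k ξ) (norm_nonneg _) (by positivity)).trans ?_
  have := Real.pi_pos
  by_cases h : ‖ξ‖ = 0
  · simp [h]
  · field_simp; norm_num

/-- The derivative lowers the singularity of the symbol from |ξ|⁻² to |ξ|⁻¹. The product with a
Schwartz function is then in L², which |ξ|⁻² alone would not ensure, and in L¹, which bounds the
potential. -/
theorem invLaplacian_pd_spec {φ : R3 → ℝ} (h : IsTest φ) (k : Fin 3) :
    MemLp (invLaplacian (pd k φ)) 2 volume ∧
    (L2F (invLaplacian (pd k φ)) =ᵐ[volume] fun ξ => nsym k ξ * L2F φ ξ) ∧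
    ∃ C, ∀ x, |invLaplacian (pd k φ) x| ≤ C := by
  obtain ⟨h1, h2⟩ := memLp_of_norm_le_inv_mul_schwartz (measurable_nsym k) (norm_nsym_le k)
    (𝓕 h.toSchwartz)
  have e : ∀ x, (invLaplacian (pd k φ) x : ℂ) = 𝓕⁻ (fun ξ => nsym k ξ * 𝓕 h.toSchwartz ξ) x := by
    intro x
    rw [invLaplacian_eq_fourierInv (h.pd k)]
    refine congrArg (fun F : R3 → ℂ => 𝓕⁻ F x) (funext fun ξ => ?_)
    rw [fourier_pd h, nsym]
    have : 𝓕 h.toSchwartz ξ = 𝓕 (fun y => (φ y : ℂ)) ξ := rfl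
    rw [this]; ring
  obtain ⟨a, b⟩ := L2F_of_fourierInv h1 h2 e
  refine ⟨a, ?_, ∫ ξ, ‖nsym k ξ * 𝓕 h.toSchwartz ξ‖, fun x => ?_⟩
  · filter_upwards [b, L2F_test h] with ξ hb ht
    rw [hb, ht]; rfl
  · have := norm_fourierInv_le (fun ξ => nsym k ξ * 𝓕 h.toSchwartz ξ) x
    rw [← e x] at this
    simpa using this

theorem rieszPot_spec {φ : R3 → ℝ} (h : IsTest φ) :
    MemLp (rieszPot φ) 2 volume ∧
    (L2F (rieszPot φ) =ᵐ[volume] fun ξ => (rsym ξ : ℂ) * L2F φ ξ) := by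
  obtain ⟨h1, h2⟩ := memLp_of_norm_le_inv_mul_schwartz
    (Complex.measurable_ofReal.comp measurable_rsym) norm_rsym_le (𝓕 h.toSchwartz)
  have e : ∀ x, (rieszPot φ x : ℂ) = 𝓕⁻ (fun ξ => (rsym ξ : ℂ) * 𝓕 h.toSchwartz ξ) x := by
    intro x
    rw [rieszPot_eq_fourierInv h]
    refine congrArg (fun F : R3 → ℂ => 𝓕⁻ F x) (funext fun ξ => ?_)
    have : 𝓕 h.toSchwartz ξ = 𝓕 (fun y => (φ y : ℂ)) ξ := rfl
    rw [this, rsym]; ring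
  obtain ⟨a, b⟩ := L2F_of_fourierInv h1 h2 e
  refine ⟨a, ?_⟩
  filter_upwards [b, L2F_test h] with ξ hb ht
  rw [hb, ht]; rfl

theorem L2F_pd {φ : R3 → ℝ} (h : IsTest φ) (k : Fin 3) :
    L2F (pd k φ) =ᵐ[volume] fun ξ => sym k ξ * L2F φ ξ := by
  filter_upwards [L2F_test (h.pd k), L2F_test h] with ξ a b
  rw [a, b, fourier_pd h]

/-! ### A Bellman function -/

/-- The variable part of the Bellman function, in the variables `z` and `t` with `η = t|t|`. -/
def bellR (z t : ℝ) : ℝ := z ^ 2 * max |z| |t| - max |z| |t| ^ 3 / 3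

/-- As a function of m ≥ 0, z²m - m³/3 increases up to |z| and decreases afterwards, so on m ≥ |t|
it is maximal at max(|z|, |t|). Thus `bellR` is a maximum, and lower bounds for it come from
choosing m. -/
theorem bellR_ge {z t m : ℝ} (hm : |t| ≤ m) : z ^ 2 * m - m ^ 3 / 3 ≤ bellR z t := by
  have hm0 : 0 ≤ m := (abs_nonneg t).trans hm
  unfold bellR
  rw [← sq_abs z]
  generalize ha : |z| = a
  have ha0 : 0 ≤ a := ha ▸ abs_nonneg z
  generalize hs : |t| = s at *
  have hs0 : 0 ≤ s := hs ▸ abs_nonneg t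
  rcases le_total s a with h | h
  · rw [max_eq_left h]
    nlinarith [mul_nonneg (sq_nonneg (m - a)) (show 0 ≤ m + 2 * a by positivity)]
  · rw [max_eq_right h]
    have h1 : a ^ 2 ≤ (m ^ 2 + m * s + s ^ 2) / 3 := by nlinarith
    nlinarith [mul_nonneg (sub_nonneg.2 hm) (sub_nonneg.2 h1)]

/-- The partial derivative of `bellR` with respect to `η`. -/
def bellRη (z t : ℝ) : ℝ := if |t| ≤ |z| then 0 else (z ^ 2 - t ^ 2) / (2 * t)

theorem bellRη_neg (z t : ℝ) : bellRη z (-t) = -bellRη z t := by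
  unfold bellRη
  rw [abs_neg]
  split_ifs
  · simp
  · rw [neg_sq, mul_neg, div_neg]

/-- The squares (D ± cq)²/c are added with the weights s ± z, which are nonnegative. -/
theorem neg_cross_le {s z D q c : ℝ} (hz : |z| ≤ s) (hc : 0 < c) :
    -(2 * (z * D * q)) ≤ s * (D ^ 2 / c + c * q ^ 2) := by
  obtain ⟨h1, h2⟩ := abs_le.1 hz
  have a := mul_nonneg (show 0 ≤ s + z by linarith)
    (show 0 ≤ D ^ 2 / c + 2 * D * q + c * q ^ 2 by
      have : D ^ 2 / c + 2 * D * q + c * q ^ 2 = (D + c * q) ^ 2 / c := by field_simp; ring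
      rw [this]; positivity)
  have b := mul_nonneg (show 0 ≤ s - z by linarith)
    (show 0 ≤ D ^ 2 / c - 2 * D * q + c * q ^ 2 by
      have : D ^ 2 / c - 2 * D * q + c * q ^ 2 = (D - c * q) ^ 2 / c := by field_simp; ring
      rw [this]; positivity)
  linarith

/-- The function is convex in z but not in η = t|t|. The gain in z'-z is what the Bellman function
needs; the loss in t'-t is repaid later by a multiple of |t|³. -/
theorem bellR_first_order_of_nonneg {z t z' t' : ℝ} (ht : 0 ≤ t) :
    bellR z t + 2 * z * max |z| |t| * (z' - z) + bellRη z t * (t' * |t'| - t * |t|) +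
      (|t| + |t'|) * (z' - z) ^ 2 / 10 - 12 * ((|t| + |t'|) * (t' - t) ^ 2) ≤ bellR z' t' := by
  have hbR : ∀ m, |t'| ≤ m → z' ^ 2 * m - m ^ 3 / 3 ≤ bellR z' t' := fun m hm => bellR_ge hm
  generalize bellR z' t' = B at *
  rw [abs_of_nonneg ht]
  obtain ⟨D, rfl⟩ : ∃ D, z' = z + D := ⟨z' - z, by ring⟩
  rw [show z + D - z = D by ring]
  -- For t ≤ |z| the maximiser at the base point is |z|. At the new point m = |z| serves if |t'| ≤
  -- |z|, and m = |t'| otherwise.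
  rcases le_or_gt t |z| with h | h
  · have e1 : bellRη z t = 0 := by unfold bellRη; rw [if_pos (by rwa [abs_of_nonneg ht])]
    have e2 : bellR z t = 2 / 3 * |z| ^ 3 := by
      unfold bellR; rw [abs_of_nonneg ht, max_eq_left h, ← sq_abs z]; ring
    rw [e1, e2, max_eq_left h]
    have hza : z ^ 2 = |z| ^ 2 := (sq_abs z).symm
    generalize |z| = a at *
    have ha0 : 0 ≤ a := ht.trans h
    have hzs : |z| ≤ a := abs_le_of_sq_le_sq hza.le ha0
    have hs0 : 0 ≤ |t'| := abs_nonneg t'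
    have hst : a ≤ |t'| → (|t'| - a) ^ 2 ≤ (t' - t) ^ 2 := by
      intro h2
      rcases abs_cases t' with ⟨h5, h6⟩ | ⟨h5, h6⟩ <;> rw [h5] at h2 ⊢
      · exact pow_le_pow_left₀ (by linarith) (by linarith) 2
      · rw [← neg_sq (t' - t)]
        exact pow_le_pow_left₀ (by linarith) (by linarith) 2
    generalize |t'| = s at *
    have hT : 0 ≤ (t + s) * (t' - t) ^ 2 := by positivity
    have hsD : 0 ≤ s * D ^ 2 := by positivity
    have haD : 0 ≤ a * D ^ 2 := by positivity
    rcases le_total s a with h2 | h2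
    · have h3 := hbR a h2
      have h4 : (t + s) * D ^ 2 ≤ 2 * a * D ^ 2 :=
        mul_le_mul_of_nonneg_right (by linarith) (sq_nonneg D)
      have e3 : (z + D) ^ 2 * a - a ^ 3 / 3 = 2 / 3 * a ^ 3 + 2 * z * a * D + a * D ^ 2 := by
        linear_combination a * hza
      linarith
    · have h3 := hbR s le_rfl
      have h4 : (t + s) * D ^ 2 ≤ 2 * s * D ^ 2 :=
        mul_le_mul_of_nonneg_right (by linarith) (sq_nonneg D)
      have h5 := neg_cross_le (z := z) (D := D) (q := s - a) (c := 2) (hzs.trans h2) two_pos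
      have e3 : (z + D) ^ 2 * s - s ^ 3 / 3 = 2 / 3 * a ^ 3 + 2 * z * a * D + s * D ^ 2
          + 2 * (z * D * (s - a)) - (s - a) ^ 2 * (s + 2 * a) / 3 := by
        linear_combination s * hza
      have h6 : (s - a) ^ 2 * (s + 2 * a) ≤ (s - a) ^ 2 * (3 * s) :=
        mul_le_mul_of_nonneg_left (by linarith) (sq_nonneg _)
      have h7 : s * (s - a) ^ 2 ≤ (t + s) * (t' - t) ^ 2 :=
        mul_le_mul (by linarith) (hst h2) (sq_nonneg _) (by linarith)
      linarith
  · have htpos : 0 < t := (abs_nonneg z).trans_lt h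
    obtain ⟨g, hg⟩ : ∃ g, g = (t ^ 2 - z ^ 2) / (2 * t) := ⟨_, rfl⟩
    have hg1 : 2 * t * g = t ^ 2 - z ^ 2 := by rw [hg]; field_simp
    have hz2 : z ^ 2 ≤ t ^ 2 := by
      rw [← sq_abs z]; exact pow_le_pow_left₀ (abs_nonneg z) h.le 2
    have hg0 : 0 ≤ g := by rw [hg]; exact div_nonneg (by linarith) (by linarith)
    have hg2 : g ≤ t / 2 := by nlinarith [sq_nonneg z]
    have e1 : bellRη z t = -g := by
      unfold bellRη
      rw [if_neg (by rw [abs_of_nonneg ht]; exact not_le.2 h), hg, ← neg_div, neg_sub]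
    have e2 : bellR z t = z ^ 2 * t - t ^ 3 / 3 := by
      unfold bellR; rw [abs_of_nonneg ht, max_eq_right h.le]
    rw [e1, e2, max_eq_right h.le]
    have htD : 0 ≤ t * D ^ 2 := by positivity
    -- The maximiser at the base point is now t. The choices are m = t' for t' ≥ t/4, m = t for
    -- smaller t' with |t'| ≤ t, and m = -t' for t' < -t. In the last two cases t - t' exceeds 3t/4,
    -- which makes the loss term large.
    rcases le_or_gt (t / 4) t' with h2 | h2
    · have ht' : 0 ≤ t' := by linarith
      have h3 := hbR t' (abs_of_nonneg ht').le
      rw [abs_of_nonneg ht']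
      have h5 := neg_cross_le (z := z) (D := D) (q := t' - t) (c := 8) h.le (by norm_num)
      have e3 : (z + D) ^ 2 * t' - t' ^ 3 / 3 = z ^ 2 * t - t ^ 3 / 3 + 2 * z * t * D
          - g * (t' * t' - t * t) + t' * D ^ 2 + 2 * (z * D * (t' - t))
          - (t / 2 - g) * (t' - t) ^ 2 - (t' - t) ^ 2 * (t' / 3 + t / 6) := by
        linear_combination (t' - t) * hg1
      have h6 : t / 4 * D ^ 2 ≤ t' * D ^ 2 := mul_le_mul_of_nonneg_right h2 (sq_nonneg D)
      have h7 : 0 ≤ t * (t' - t) ^ 2 := by positivity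
      have h8 : 0 ≤ t' * (t' - t) ^ 2 := by positivity
      have h9 : 0 ≤ g * (t' - t) ^ 2 := by positivity
      linarith
    · rcases le_or_gt |t'| t with h4 | h4
      · have h3 := hbR t h4
        have hs0 : 0 ≤ |t'| := abs_nonneg t'
        have hlow : -(|t'| ^ 2) ≤ t' * |t'| := by
          nlinarith [neg_abs_le t']
        have hup : t' * |t'| ≤ |t'| ^ 2 := by
          nlinarith [le_abs_self t']
        have h5 : (t + |t'|) * D ^ 2 ≤ 2 * t * D ^ 2 :=
          mul_le_mul_of_nonneg_right (by linarith) (sq_nonneg D)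
        have h6 : t * (9 / 16 * t ^ 2) ≤ (t + |t'|) * (t' - t) ^ 2 := by
          refine mul_le_mul (by linarith) ?_ (by positivity) (by linarith)
          nlinarith
        have h7 : |t'| ^ 2 ≤ t ^ 2 := pow_le_pow_left₀ hs0 h4 2
        have h8 : g * (t * t - t' * |t'|) ≤ t / 2 * (2 * t ^ 2) :=
          mul_le_mul hg2 (by linarith) (by linarith) (by linarith)
        nlinarith
      · have hneg : t' < 0 := by
          by_contra h0
          rw [abs_of_nonneg (not_lt.1 h0)] at h4
          linarith
        obtain ⟨s, rfl⟩ : ∃ s, t' = -s := ⟨-t', by ring⟩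
        have hs : 0 < s := by linarith
        rw [abs_neg, abs_of_pos hs] at *
        have h3 := hbR s le_rfl
        have h5 := neg_cross_le (z := z) (D := D) (q := s - t) (c := 2) (h.le.trans h4.le) two_pos
        have h6 : g * (s ^ 2 + t ^ 2) ≤ t / 2 * (s ^ 2 + t ^ 2) :=
          mul_le_mul_of_nonneg_right hg2 (by positivity)
        have h7 : 0 ≤ z ^ 2 * (s - t) := mul_nonneg (sq_nonneg z) (by linarith)
        have h8 : (t + s) * D ^ 2 ≤ 2 * s * D ^ 2 :=
          mul_le_mul_of_nonneg_right (by linarith) (sq_nonneg D)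
        have h9 : 0 ≤ s * D ^ 2 := by positivity
        have h10 : 0 ≤ s ^ 2 * t := by positivity
        have h11 : 0 ≤ s * t ^ 2 := by positivity
        have h12 : 0 ≤ s ^ 3 := by positivity
        have h13 : 0 ≤ t ^ 3 := by positivity
        nlinarith

theorem bellR_first_order (z t z' t' : ℝ) :
    bellR z t + 2 * z * max |z| |t| * (z' - z) + bellRη z t * (t' * |t'| - t * |t|) +
      (|t| + |t'|) * (z' - z) ^ 2 / 10 - 12 * ((|t| + |t'|) * (t' - t) ^ 2) ≤ bellR z' t' := by
  rcases le_total 0 t with h | h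
  · exact bellR_first_order_of_nonneg h
  · have := bellR_first_order_of_nonneg (z := z) (t := -t) (z' := z') (t' := -t') (by linarith)
    have e : ∀ z t, bellR z (-t) = bellR z t := fun z t => by unfold bellR; rw [abs_neg]
    rw [e, e, bellRη_neg, abs_neg, abs_neg] at this
    have e2 : (-t' - -t) ^ 2 = (t' - t) ^ 2 := by ring
    rw [e2] at this
    linarith

/-- In the variable η = t|t| the function |t|³ = |η|^{3/2} is convex with slope 3t/2; the quadratic
term quantifies the convexity. -/
theorem cube_first_order_of_nonneg {t t' : ℝ} (ht : 0 ≤ t) :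
    |t| ^ 3 + 3 / 2 * t * (t' * |t'| - t * |t|) + (|t| + |t'|) * (t' - t) ^ 2 / 4 ≤ |t'| ^ 3 := by
  rw [abs_of_nonneg ht]
  rcases le_total 0 t' with h | h
  · rw [abs_of_nonneg h]
    nlinarith [mul_nonneg (sq_nonneg (t' - t)) (show 0 ≤ 3 / 4 * t' + t / 4 by linarith)]
  · obtain ⟨s, rfl⟩ : ∃ s, t' = -s := ⟨-t', by ring⟩
    have hs : 0 ≤ s := by linarith
    rw [abs_neg, abs_of_nonneg hs]
    nlinarith [mul_nonneg hs (sq_nonneg (s - t)), mul_nonneg ht (sq_nonneg (s - t)),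
      pow_nonneg hs 3, pow_nonneg ht 3, mul_nonneg hs (mul_nonneg ht ht),
      mul_nonneg ht (mul_nonneg hs hs), mul_nonneg hs (sq_nonneg (2 * s - t)),
      mul_nonneg ht (sq_nonneg (2 * s - t))]

theorem cube_first_order (t t' : ℝ) :
    |t| ^ 3 + 3 / 2 * t * (t' * |t'| - t * |t|) + (|t| + |t'|) * (t' - t) ^ 2 / 4 ≤ |t'| ^ 3 := by
  rcases le_total 0 t with h | h
  · exact cube_first_order_of_nonneg h
  · have := cube_first_order_of_nonneg (t := -t) (t' := -t') (by linarith)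
    simp only [abs_neg] at this
    have e2 : (-t' - -t) ^ 2 = (t' - t) ^ 2 := by ring
    rw [e2] at this
    linarith

theorem abs_mul_abs_sub_le (t t' : ℝ) : abs (t' * |t'| - t * |t|) ≤ (|t| + |t'|) * |t' - t| := by
  have h : 2 * (t' * |t'| - t * |t|) = (|t'| + |t|) * (t' - t) + (t' + t) * (|t'| - |t|) := by ring
  have h1 : abs ((t' + t) * (|t'| - |t|)) ≤ (|t| + |t'|) * |t' - t| := by
    rw [abs_mul]
    refine mul_le_mul ?_ (abs_abs_sub_abs_le t' t) (abs_nonneg _) (by positivity)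
    rw [add_comm |t|]; exact abs_add_le t' t
  have h2 : abs ((|t'| + |t|) * (t' - t)) = (|t| + |t'|) * |t' - t| := by
    rw [abs_mul, abs_of_nonneg (by positivity : 0 ≤ |t'| + |t|), add_comm]
  have h3 : 2 * abs (t' * |t'| - t * |t|) ≤ 2 * ((|t| + |t'|) * |t' - t|) := by
    rw [show 2 * abs (t' * |t'| - t * |t|) = abs (2 * (t' * |t'| - t * |t|)) by
      rw [abs_mul, abs_two], h]
    refine (abs_add_le _ _).trans ?_
    rw [h2]; linarith
  linarith

/-- The Bellman function in the variables `z` and `t`, where `η = t|t|`. -/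
def bellAux (z t : ℝ) : ℝ := 60 * |t| ^ 3 + bellR z t

/-- The weight 60 gives 60/4 = 15 against the loss 12, leaving 3(t'-t)². Since 4 · 3/10 ≥ 1,
(z'-z)²/10 + 3(t'-t)² dominates |z'-z||t'-t|, and |Δη| ≤ (|t| + |t'|)|t'-t| converts this to η. -/
theorem bellAux_first_order (z t z' t' : ℝ) :
    bellAux z t + 2 * z * max |z| |t| * (z' - z) +
      (90 * t + bellRη z t) * (t' * |t'| - t * |t|) + |z' - z| * abs (t' * |t'| - t * |t|) ≤
      bellAux z' t' := by
  have h1 := bellR_first_order z t z' t'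
  have h2 := cube_first_order t t'
  have h3 : |z' - z| * abs (t' * |t'| - t * |t|) ≤ (|t| + |t'|) * (|z' - z| * |t' - t|) := by
    calc _ ≤ |z' - z| * ((|t| + |t'|) * |t' - t|) :=
          mul_le_mul_of_nonneg_left (abs_mul_abs_sub_le t t') (abs_nonneg _)
      _ = _ := by ring
  have h4 : (|t| + |t'|) * (|z' - z| * |t' - t|) ≤
      (|t| + |t'|) * ((z' - z) ^ 2 / 10 + 3 * (t' - t) ^ 2) := by
    refine mul_le_mul_of_nonneg_left ?_ (by positivity)
    rw [← sq_abs (z' - z), ← sq_abs (t' - t)]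
    nlinarith [sq_nonneg (|z' - z| - 5 * |t' - t|)]
  unfold bellAux
  linarith

theorem abs_bellR_le (z t : ℝ) : |bellR z t| ≤ |z| ^ 3 + |t| ^ 3 := by
  have hz := abs_nonneg z
  have ht := abs_nonneg t
  unfold bellR
  rw [← sq_abs z]
  generalize |z| = a at *
  generalize |t| = s at *
  rw [abs_le]
  have h1 : 0 ≤ a ^ 3 := by positivity
  have h2 : 0 ≤ s ^ 3 := by positivity
  rcases le_total a s with h | h
  · rw [max_eq_right h]
    have : a ^ 2 * s ≤ s ^ 2 * s := mul_le_mul_of_nonneg_right (pow_le_pow_left₀ hz h 2) ht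
    have : 0 ≤ a ^ 2 * s := by positivity
    constructor <;> nlinarith
  · rw [max_eq_left h]
    constructor <;> nlinarith

/-- The signed square root. -/
def ssqrt (y : ℝ) : ℝ := SignType.sign y * Real.sqrt |y|

theorem abs_ssqrt (y : ℝ) : |ssqrt y| = Real.sqrt |y| := by
  unfold ssqrt
  rcases lt_trichotomy y 0 with h | rfl | h
  · simp [sign_neg h, abs_of_nonneg (Real.sqrt_nonneg _)]
  · simp
  · simp [sign_pos h, abs_of_nonneg (Real.sqrt_nonneg _)]

theorem ssqrt_mul_abs (y : ℝ) : ssqrt y * |ssqrt y| = y := by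
  rw [abs_ssqrt]
  unfold ssqrt
  rw [mul_assoc, Real.mul_self_sqrt (abs_nonneg _), sign_mul_abs]

/-- The Bellman function. -/
def bell (z y : ℝ) : ℝ := bellAux z (ssqrt y)

theorem bell_eq (z y : ℝ) : bell z y = 60 * Real.sqrt |y| ^ 3 +
    (z ^ 2 * max |z| (Real.sqrt |y|) - max |z| (Real.sqrt |y|) ^ 3 / 3) := by
  unfold bell bellAux bellR; rw [abs_ssqrt]

theorem continuous_bell : Continuous fun p : ℝ × ℝ => bell p.1 p.2 := by
  simp only [bell_eq]; fun_prop

/-- A supporting plane with a surplus. The slopes `p`, `q` matter only through their existence: they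
disappear when the inequality is summed over increments of mean zero. -/
theorem bell_first_order (z y : ℝ) : ∃ p q : ℝ, ∀ z' y',
    bell z y + p * (z' - z) + q * (y' - y) + |z' - z| * |y' - y| ≤ bell z' y' := by
  refine ⟨2 * z * max |z| |ssqrt y|, 90 * ssqrt y + bellRη z (ssqrt y), fun z' y' => ?_⟩
  have := bellAux_first_order z (ssqrt y) z' (ssqrt y')
  rwa [ssqrt_mul_abs, ssqrt_mul_abs] at this

theorem abs_bell_le (z y : ℝ) : |bell z y| ≤ |z| ^ 3 + 61 * Real.sqrt |y| ^ 3 := by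
  have := abs_bellR_le z (ssqrt y)
  unfold bell bellAux
  rw [abs_ssqrt] at *
  refine (abs_add_le _ _).trans ?_
  rw [abs_of_nonneg (show 0 ≤ 60 * √|y| ^ 3 by positivity)]
  linarith

theorem bell_nonneg (z y : ℝ) : 0 ≤ bell z y := by
  have := bellR_ge (z := z) (t := ssqrt y) le_rfl
  unfold bell bellAux
  have h := abs_nonneg (ssqrt y)
  have : 0 ≤ z ^ 2 * |ssqrt y| := by positivity
  have : 0 ≤ |ssqrt y| ^ 3 := by positivity
  linarith

/-! ### Random walks and their Fourier symbols -/

section RandomWalk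

variable {ι : Type*} [Fintype ι]

/-- Averaging over the steps of a random walk. -/
def walk (w : ι → R3) (u : R3 → ℝ) (x : R3) : ℝ := (1 / (Fintype.card ι : ℝ)) * ∑ i, u (x + w i)

theorem IsTest.walk {u : R3 → ℝ} (hu : IsTest u) (w : ι → R3) : IsTest (walk w u) :=
  (IsTest.sum fun i _ => hu.comp_add (w i)).const_mul _

theorem IsTest.walk_iterate {u : R3 → ℝ} (hu : IsTest u) (w : ι → R3) (n : ℕ) :
    IsTest ((_root_.walk w)^[n] u) := by
  induction n with
  | zero => exact hu
  | succ n ih => rw [Function.iterate_succ_apply']; exact ih.walk w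

/-- The increment of `u` along a step, relative to the average. -/
def incr (w : ι → R3) (u : R3 → ℝ) (i : ι) (x : R3) : ℝ := u (x + w i) - walk w u x

theorem IsTest.incr {u : R3 → ℝ} (hu : IsTest u) (w : ι → R3) (i : ι) : IsTest (incr w u i) :=
  (hu.comp_add (w i)).sub (hu.walk w)

theorem sum_incr [Nonempty ι] (w : ι → R3) (u : R3 → ℝ) (x : R3) : ∑ i, incr w u i x = 0 := by
  have : (Fintype.card ι : ℝ) ≠ 0 := by exact_mod_cast Fintype.card_ne_zero
  simp only [incr, walk, Finset.sum_sub_distrib, Finset.sum_const, Finset.card_univ, nsmul_eq_mul]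
  field_simp
  simp

theorem integrable_bell {u v : R3 → ℝ} (hu : IsTest u) (hv : IsTest v) :
    Integrable (fun x => bell (u x) (v x)) := by
  refine (continuous_bell.comp (hu.continuous.prodMk hv.continuous)).integrable_of_hasCompactSupport
    ?_
  refine HasCompactSupport.intro (hu.2.isCompact.union hv.2.isCompact) fun x hx => ?_
  have h1 : u x = 0 := image_eq_zero_of_notMem_tsupport fun h => hx (Or.inl h)
  have h2 : v x = 0 := image_eq_zero_of_notMem_tsupport fun h => hx (Or.inr h)
  simp [h1, h2, bell_eq]

theorem integrable_abs_mul_abs {u v : R3 → ℝ} (hu : IsTest u) (hv : IsTest v) :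
    Integrable (fun x => |u x| * |v x|) := by
  simpa [abs_mul] using (hu.mul_smooth hv.1).integrable.abs

/-- The supporting plane at the averaged values is summed over the steps. The linear terms cancel by
`sum_incr`, and by translation invariance every shifted term has the same integral. -/
theorem integral_bell_walk_le [Nonempty ι] (w : ι → R3) {u v : R3 → ℝ} (hu : IsTest u)
    (hv : IsTest v) :
    (∑ i, ∫ x, |incr w u i x| * |incr w v i x|) ≤ (Fintype.card ι : ℝ) *
      ((∫ x, bell (u x) (v x)) - ∫ x, bell (walk w u x) (walk w v x)) := by
  have hpt : ∀ x, (∑ i, |incr w u i x| * |incr w v i x|) +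
      (Fintype.card ι : ℝ) * bell (walk w u x) (walk w v x) ≤
      ∑ i, bell (u (x + w i)) (v (x + w i)) := by
    intro x
    obtain ⟨p, q, h⟩ := bell_first_order (walk w u x) (walk w v x)
    have h1 := Finset.sum_le_sum fun i (_ : i ∈ Finset.univ) => h (u (x + w i)) (v (x + w i))
    refine le_trans (le_of_eq ?_) h1
    have e : ∀ i, bell (walk w u x) (walk w v x) + p * (u (x + w i) - walk w u x) +
        q * (v (x + w i) - walk w v x) + |u (x + w i) - walk w u x| * |v (x + w i) - walk w v x| =
        bell (walk w u x) (walk w v x) + p * incr w u i x + q * incr w v i x +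
        |incr w u i x| * |incr w v i x| := fun i => rfl
    simp only [e, Finset.sum_add_distrib, ← Finset.mul_sum, sum_incr, Finset.sum_const,
      Finset.card_univ, nsmul_eq_mul]
    ring
  have hI : ∀ i, Integrable fun x => bell (u (x + w i)) (v (x + w i)) := fun i =>
    (integrable_bell hu hv).comp_add_right (w i)
  have hJ : ∀ i, Integrable fun x => |incr w u i x| * |incr w v i x| := fun i =>
    integrable_abs_mul_abs (hu.incr w i) (hv.incr w i)
  have hK := integrable_bell (hu.walk w) (hv.walk w)
  have hS : Integrable fun x => ∑ i, |incr w u i x| * |incr w v i x| :=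
    integrable_finsetSum _ fun i _ => hJ i
  have h := integral_mono (hS.add (hK.const_mul (Fintype.card ι : ℝ)))
    (integrable_finsetSum Finset.univ fun i _ => hI i) hpt
  have e1 := integral_add hS (hK.const_mul (Fintype.card ι : ℝ))
  simp only [Pi.add_apply] at h
  rw [e1, integral_finsetSum _ fun i _ => hI i, integral_finsetSum _ fun i _ => hJ i,
    integral_const_mul] at h
  have e2 : ∀ i, ∫ x, bell (u (x + w i)) (v (x + w i)) = ∫ x, bell (u x) (v x) := fun i =>
    integral_add_right_eq_self (fun x => bell (u x) (v x)) (w i)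
  simp only [e2, Finset.sum_const, Finset.card_univ, nsmul_eq_mul] at h
  linarith

/-- The drops of the integral of `bell` telescope, and `bell_nonneg` discards the last value, so the
bound does not depend on `M`. -/
theorem sum_range_integral_incr_le [Nonempty ι] (w : ι → R3) {f g : R3 → ℝ} (hf : IsTest f)
    (hg : IsTest g) (i : ι) (M : ℕ) :
    |∑ n ∈ Finset.range M, ∫ x, incr w ((walk w)^[n] f) i x * incr w ((walk w)^[n] g) i x| ≤
      (Fintype.card ι : ℝ) * ∫ x, bell (f x) (g x) := by
  have key : ∀ M : ℕ, ∑ n ∈ Finset.range M,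
      (∑ i, ∫ x, |incr w ((walk w)^[n] f) i x| * |incr w ((walk w)^[n] g) i x|) ≤
      (Fintype.card ι : ℝ) * ((∫ x, bell (f x) (g x)) -
        ∫ x, bell ((walk w)^[M] f x) ((walk w)^[M] g x)) := by
    intro M
    induction M with
    | zero => simp
    | succ M ih =>
      have := integral_bell_walk_le w (hf.walk_iterate w M) (hg.walk_iterate w M)
      rw [Finset.sum_range_succ, Function.iterate_succ_apply', Function.iterate_succ_apply']
      linarith
  have hpos : 0 ≤ ∫ x, bell ((walk w)^[M] f x) ((walk w)^[M] g x) :=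
    integral_nonneg fun x => bell_nonneg _ _
  have hle : ∀ n, |∫ x, incr w ((walk w)^[n] f) i x * incr w ((walk w)^[n] g) i x| ≤
      ∑ i, ∫ x, |incr w ((walk w)^[n] f) i x| * |incr w ((walk w)^[n] g) i x| := by
    intro n
    refine le_trans ?_ (Finset.single_le_sum
      (f := fun i => ∫ x, |incr w ((walk w)^[n] f) i x| * |incr w ((walk w)^[n] g) i x|)
      (fun j _ => integral_nonneg fun x => by positivity) (Finset.mem_univ i))
    refine (abs_integral_le_integral_abs).trans (le_of_eq ?_)
    simp only [abs_mul]
  refine (Finset.abs_sum_le_sum_abs _ _).trans ((Finset.sum_le_sum fun n _ => hle n).trans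
    ((key M).trans ?_))
  refine mul_le_mul_of_nonneg_left (by linarith) (by positivity)

/-! ### Fourier symbols of the walk -/

/-- The Fourier transform of a test function. -/
def ftest (φ : R3 → ℝ) (ξ : R3) : ℂ := 𝓕 (fun x => (φ x : ℂ)) ξ

theorem ftest_const_mul (c : ℝ) (φ : R3 → ℝ) (ξ : R3) :
    ftest (fun x => c * φ x) ξ = c * ftest φ ξ := by
  simp only [ftest, Real.fourier_eq, ← integral_const_mul]
  congr 1; ext x
  simp only [Circle.smul_def, smul_eq_mul]; push_cast; ring

theorem IsTest.integrable_fourier {φ : R3 → ℝ} (h : IsTest φ) (ξ : R3) :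
    Integrable fun x => Real.fourierChar (-inner ℝ x ξ) • (φ x : ℂ) :=
  (Real.fourierIntegral_convergent_iff ξ).2 h.integrable.ofReal

theorem ftest_sub {φ ψ : R3 → ℝ} (h : IsTest φ) (k : IsTest ψ) (ξ : R3) :
    ftest (fun x => φ x - ψ x) ξ = ftest φ ξ - ftest ψ ξ := by
  simp only [ftest, Real.fourier_eq, Complex.ofReal_sub, smul_sub]
  exact integral_sub (h.integrable_fourier ξ) (k.integrable_fourier ξ)

theorem ftest_sum {f : ι → R3 → ℝ} (h : ∀ i, IsTest (f i)) (ξ : R3) :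
    ftest (fun x => ∑ i, f i x) ξ = ∑ i, ftest (f i) ξ := by
  simp only [ftest, Real.fourier_eq, Complex.ofReal_sum, Finset.smul_sum]
  exact integral_finsetSum _ fun i _ => (h i).integrable_fourier ξ

theorem ftest_comp_add (φ : R3 → ℝ) (w ξ : R3) :
    ftest (fun x => φ (x + w)) ξ = (Real.fourierChar (inner ℝ w ξ) : ℂ) * ftest φ ξ := by
  have := congrFun (VectorFourier.fourierIntegral_comp_add_right Real.fourierChar volume
    (innerₗ R3) (fun x => (φ x : ℂ)) w) ξ
  exact this

/-- The Fourier symbol of a step. -/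
def stepSym (w : ι → R3) (i : ι) (ξ : R3) : ℂ := Real.fourierChar (inner ℝ (w i) ξ)

/-- The Fourier symbol of the averaging operator. -/
def walkSym (w : ι → R3) (ξ : R3) : ℂ := (1 / (Fintype.card ι : ℂ)) * ∑ i, stepSym w i ξ

theorem ftest_walk (w : ι → R3) {u : R3 → ℝ} (hu : IsTest u) (ξ : R3) :
    ftest (walk w u) ξ = walkSym w ξ * ftest u ξ := by
  have e : walk w u = fun x => (1 / (Fintype.card ι : ℝ)) * ∑ i, u (x + w i) := rfl
  rw [e, ftest_const_mul, ftest_sum fun i => hu.comp_add (w i)]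
  simp only [ftest_comp_add, ← Finset.sum_mul, walkSym, stepSym]
  push_cast
  ring

theorem ftest_walk_iterate (w : ι → R3) {u : R3 → ℝ} (hu : IsTest u) (n : ℕ) (ξ : R3) :
    ftest ((walk w)^[n] u) ξ = walkSym w ξ ^ n * ftest u ξ := by
  induction n with
  | zero => simp
  | succ n ih =>
    rw [Function.iterate_succ_apply', ftest_walk w (hu.walk_iterate w n), ih]; ring

theorem ftest_incr (w : ι → R3) {u : R3 → ℝ} (hu : IsTest u) (i : ι) (ξ : R3) :
    ftest (incr w u i) ξ = (stepSym w i ξ - walkSym w ξ) * ftest u ξ := by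
  have e : incr w u i = fun x => u (x + w i) - walk w u x := rfl
  rw [e, ftest_sub (hu.comp_add (w i)) (hu.walk w), ftest_comp_add, ftest_walk w hu, stepSym]
  ring

theorem parseval_test {φ ψ : R3 → ℝ} (h : IsTest φ) (k : IsTest ψ) :
    ∫ x, φ x * ψ x = (∫ ξ, conj (ftest φ ξ) * ftest ψ ξ).re := by
  rw [parseval (h.memLp 2) (k.memLp 2)]
  congr 1
  refine integral_congr_ae ?_
  filter_upwards [L2F_test h, L2F_test k] with ξ a b
  rw [a, b]; rfl

theorem IsTest.ftest_memLp {φ : R3 → ℝ} (h : IsTest φ) : MemLp (ftest φ) 2 volume :=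
  (memLp_L2F φ).ae_eq (L2F_test h)

theorem IsTest.integrable_ftest_mul {φ ψ : R3 → ℝ} (h : IsTest φ) (k : IsTest ψ) :
    Integrable fun ξ => conj (ftest φ ξ) * ftest ψ ξ :=
  h.ftest_memLp.star.integrable_mul k.ftest_memLp

theorem continuous_stepSym (w : ι → R3) (i : ι) : Continuous (stepSym w i) := by
  unfold stepSym
  exact continuous_subtype_val.comp (Real.continuous_fourierChar.comp (by fun_prop))

theorem continuous_walkSym (w : ι → R3) : Continuous (walkSym w) :=
  continuous_const.mul (continuous_finsetSum _ fun i _ => continuous_stepSym w i)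

theorem norm_stepSym (w : ι → R3) (i : ι) (ξ : R3) : ‖stepSym w i ξ‖ = 1 := Circle.norm_coe _

/-- The variance of unit complex numbers about their mean. -/
theorem sum_norm_stepSym_sub_sq [Nonempty ι] (w : ι → R3) (ξ : R3) :
    ∑ i, ‖stepSym w i ξ - walkSym w ξ‖ ^ 2 =
      (Fintype.card ι : ℝ) * (1 - ‖walkSym w ξ‖ ^ 2) := by
  have hN : (Fintype.card ι : ℂ) ≠ 0 := by exact_mod_cast Fintype.card_ne_zero
  have hs : ∑ i, stepSym w i ξ = (Fintype.card ι : ℂ) * walkSym w ξ := by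
    unfold walkSym; field_simp
  have e : ∀ i, ‖stepSym w i ξ - walkSym w ξ‖ ^ 2 =
      1 - 2 * (conj (walkSym w ξ) * stepSym w i ξ).re + ‖walkSym w ξ‖ ^ 2 := by
    intro i
    have h1 := norm_stepSym w i ξ
    rw [← sq_eq_sq₀ (norm_nonneg _) one_pos.le, ← Complex.normSq_eq_norm_sq, Complex.normSq_apply]
      at h1
    rw [← Complex.normSq_eq_norm_sq, ← Complex.normSq_eq_norm_sq, Complex.normSq_apply,
      Complex.normSq_apply]
    simp only [Complex.sub_re, Complex.sub_im, Complex.mul_re, Complex.conj_re, Complex.conj_im]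
    linarith
  simp only [e, Finset.sum_add_distrib, Finset.sum_sub_distrib, ← Finset.mul_sum,
    ← Complex.re_sum, hs, Finset.sum_const, Finset.card_univ, nsmul_eq_mul]
  have : (conj (walkSym w ξ) * ((Fintype.card ι : ℂ) * walkSym w ξ)).re =
      (Fintype.card ι : ℝ) * ‖walkSym w ξ‖ ^ 2 := by
    rw [show conj (walkSym w ξ) * ((Fintype.card ι : ℂ) * walkSym w ξ) =
      (Fintype.card ι : ℂ) * (walkSym w ξ * conj (walkSym w ξ)) by ring, Complex.mul_conj,
      Complex.normSq_eq_norm_sq]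
    norm_cast
  rw [this]
  ring

end RandomWalk

/-! ### The multipliers produced by the walk and their limit for small steps -/

section RandomWalk

variable {ι : Type*} [Fintype ι]

theorem integral_incr_mul_incr (w : ι → R3) {f g : R3 → ℝ} (hf : IsTest f) (hg : IsTest g)
    (i : ι) (n : ℕ) :
    ∫ x, incr w ((walk w)^[n] f) i x * incr w ((walk w)^[n] g) i x =
      (∫ ξ, ((‖stepSym w i ξ - walkSym w ξ‖ ^ 2 * (‖walkSym w ξ‖ ^ 2) ^ n : ℝ) : ℂ) *
        (conj (ftest f ξ) * ftest g ξ)).re := by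
  rw [parseval_test ((hf.walk_iterate w n).incr w i) ((hg.walk_iterate w n).incr w i)]
  congr 1
  refine integral_congr_ae (Eventually.of_forall fun ξ => ?_)
  simp only [ftest_incr w (hf.walk_iterate w n), ftest_incr w (hg.walk_iterate w n),
    ftest_walk_iterate w hf, ftest_walk_iterate w hg, map_mul, map_pow]
  push_cast
  rw [← Complex.mul_conj', ← Complex.mul_conj']
  ring

/-- The Fourier multiplier collecting the first `M` steps of the walk. -/
def partialSym (w : ι → R3) (i : ι) (M : ℕ) (ξ : R3) : ℝ :=
  ‖stepSym w i ξ - walkSym w ξ‖ ^ 2 * ∑ n ∈ Finset.range M, (‖walkSym w ξ‖ ^ 2) ^ n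

/-- The Fourier multiplier collecting all steps of the walk. -/
def fullSym (w : ι → R3) (i : ι) (ξ : R3) : ℝ :=
  ‖stepSym w i ξ - walkSym w ξ‖ ^ 2 / (1 - ‖walkSym w ξ‖ ^ 2)

theorem norm_step_sub_walk_sq_le [Nonempty ι] (w : ι → R3) (i : ι) (ξ : R3) :
    ‖stepSym w i ξ - walkSym w ξ‖ ^ 2 ≤ (Fintype.card ι : ℝ) * (1 - ‖walkSym w ξ‖ ^ 2) := by
  rw [← sum_norm_stepSym_sub_sq]
  exact Finset.single_le_sum (f := fun i => ‖stepSym w i ξ - walkSym w ξ‖ ^ 2)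
    (fun j _ => by positivity) (Finset.mem_univ i)

theorem walkSym_sq_le_one [Nonempty ι] (w : ι → R3) (ξ : R3) : ‖walkSym w ξ‖ ^ 2 ≤ 1 := by
  obtain ⟨i⟩ := ‹Nonempty ι›
  have h := norm_step_sub_walk_sq_le w i ξ
  have h2 : 0 < (Fintype.card ι : ℝ) := by exact_mod_cast Fintype.card_pos
  have h3 : 0 ≤ ‖stepSym w i ξ - walkSym w ξ‖ ^ 2 := by positivity
  by_contra h4
  have := mul_neg_of_pos_of_neg h2 (show 1 - ‖walkSym w ξ‖ ^ 2 < 0 by linarith)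
  linarith

/-- The variance identity bounds the first factor by N(1-r), with r the squared modulus of the mean,
and (1-r) times the geometric sum is at most 1. -/
theorem abs_partialSym_le [Nonempty ι] (w : ι → R3) (i : ι) (M : ℕ) (ξ : R3) :
    |partialSym w i M ξ| ≤ Fintype.card ι := by
  have h1 := norm_step_sub_walk_sq_le w i ξ
  have h2 := walkSym_sq_le_one w ξ
  unfold partialSym
  have h0 : 0 ≤ ‖walkSym w ξ‖ ^ 2 := by positivity
  generalize ‖walkSym w ξ‖ ^ 2 = r at *
  have hs : 0 ≤ ∑ n ∈ Finset.range M, r ^ n := Finset.sum_nonneg fun n _ => by positivity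
  rw [abs_of_nonneg (by positivity)]
  have hg : (1 - r) * ∑ n ∈ Finset.range M, r ^ n = 1 - r ^ M := by
    rw [mul_comm, geom_sum_mul_neg]
  have hr : 0 ≤ r ^ M := by positivity
  calc _ ≤ (Fintype.card ι : ℝ) * (1 - r) * ∑ n ∈ Finset.range M, r ^ n :=
        mul_le_mul_of_nonneg_right h1 hs
    _ = (Fintype.card ι : ℝ) * (1 - r ^ M) := by rw [mul_assoc, hg]
    _ ≤ _ := mul_le_of_le_one_right (by positivity) (by linarith)

theorem tendsto_partialSym [Nonempty ι] (w : ι → R3) (i : ι) (ξ : R3) :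
    Tendsto (fun M => partialSym w i M ξ) atTop (𝓝 (fullSym w i ξ)) := by
  have h1 := norm_step_sub_walk_sq_le w i ξ
  have h2 := walkSym_sq_le_one w ξ
  have h0 : 0 ≤ ‖walkSym w ξ‖ ^ 2 := by positivity
  unfold partialSym fullSym
  generalize ‖walkSym w ξ‖ ^ 2 = r at *
  rcases h2.lt_or_eq with h | h
  · rw [div_eq_mul_inv]
    exact ((hasSum_geometric_of_lt_one h0 h).tendsto_sum_nat).const_mul _
  -- If the mean has modulus one, every step symbol equals it. The partial multipliers are then 0,
  -- and so is the full one, as a quotient 0/0.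
  · have : ‖stepSym w i ξ - walkSym w ξ‖ ^ 2 = 0 := by
      refine le_antisymm (h1.trans ?_) (by positivity)
      rw [h]; simp
    rw [this]; simp

theorem abs_fullSym_le [Nonempty ι] (w : ι → R3) (i : ι) (ξ : R3) :
    |fullSym w i ξ| ≤ Fintype.card ι :=
  le_of_tendsto (tendsto_partialSym w i ξ).abs
    (Eventually.of_forall fun M => abs_partialSym_le w i M ξ)

theorem continuous_partialSym (w : ι → R3) (i : ι) (M : ℕ) : Continuous (partialSym w i M) := by
  have h1 := continuous_stepSym w i
  have h2 := continuous_walkSym w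
  unfold partialSym
  fun_prop

theorem measurable_fullSym (w : ι → R3) (i : ι) : Measurable (fullSym w i) := by
  have h1 := (continuous_stepSym w i).measurable
  have h2 := (continuous_walkSym w).measurable
  unfold fullSym
  fun_prop

/-- Bounds for bounded multipliers pass to almost everywhere limits. -/
theorem abs_re_integral_le_of_tendsto {F : R3 → ℂ} (hF : Integrable F) {m : ℕ → R3 → ℝ}
    {m' : R3 → ℝ} (hm : ∀ n, Measurable (m n)) {N B : ℝ} (hN : ∀ n ξ, |m n ξ| ≤ N)
    (hlim : ∀ᵐ ξ, Tendsto (fun n => m n ξ) atTop (𝓝 (m' ξ)))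
    (hB : ∀ n, |(∫ ξ, (m n ξ : ℂ) * F ξ).re| ≤ B) : |(∫ ξ, (m' ξ : ℂ) * F ξ).re| ≤ B := by
  have h : Tendsto (fun n => ∫ ξ, (m n ξ : ℂ) * F ξ) atTop (𝓝 (∫ ξ, (m' ξ : ℂ) * F ξ)) := by
    refine tendsto_integral_of_dominated_convergence (fun ξ => N * ‖F ξ‖) (fun n => ?_)
      (hF.norm.const_mul N) (fun n => ?_) ?_
    · exact (Complex.measurable_ofReal.comp (hm n)).aestronglyMeasurable.mul hF.aestronglyMeasurable
    · filter_upwards with ξ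
      rw [norm_mul, Complex.norm_real, Real.norm_eq_abs]
      exact mul_le_mul_of_nonneg_right (hN n ξ) (norm_nonneg _)
    · filter_upwards [hlim] with ξ hξ
      exact ((Complex.continuous_ofReal.tendsto _).comp hξ).mul_const _
  exact le_of_tendsto ((Complex.continuous_re.tendsto _).comp h).abs (Eventually.of_forall hB)

theorem abs_re_integral_partialSym_le [Nonempty ι] (w : ι → R3) {f g : R3 → ℝ} (hf : IsTest f)
    (hg : IsTest g) (i : ι) (M : ℕ) :
    |(∫ ξ, (partialSym w i M ξ : ℂ) * (conj (ftest f ξ) * ftest g ξ)).re| ≤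
      (Fintype.card ι : ℝ) * ∫ x, bell (f x) (g x) := by
  refine le_trans (le_of_eq ?_) (sum_range_integral_incr_le w hf hg i M)
  congr 1
  simp only [integral_incr_mul_incr w hf hg]
  rw [← Complex.re_sum, ← integral_finsetSum]
  · congr 2
    ext ξ
    rw [← Finset.sum_mul, partialSym]
    push_cast
    rw [Finset.mul_sum]
  · intro n _
    have h1 := continuous_stepSym w i
    have h2 := continuous_walkSym w
    refine (hf.integrable_ftest_mul hg).bdd_mul (c := Fintype.card ι) ?_
      (Eventually.of_forall fun ξ => ?_)
    · exact Continuous.aestronglyMeasurable (by fun_prop)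
    · rw [Complex.norm_real, Real.norm_of_nonneg (by positivity)]
      have a := norm_step_sub_walk_sq_le w i ξ
      have b := walkSym_sq_le_one w ξ
      have c : (‖walkSym w ξ‖ ^ 2) ^ n ≤ 1 := pow_le_one₀ (by positivity) b
      have d : (Fintype.card ι : ℝ) * (1 - ‖walkSym w ξ‖ ^ 2) ≤ Fintype.card ι :=
        mul_le_of_le_one_right (by positivity) (by linarith [sq_nonneg ‖walkSym w ξ‖])
      exact (mul_le_of_le_one_right (by positivity) c).trans (a.trans d)

theorem abs_re_integral_fullSym_le [Nonempty ι] (w : ι → R3) {f g : R3 → ℝ} (hf : IsTest f)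
    (hg : IsTest g) (i : ι) :
    |(∫ ξ, (fullSym w i ξ : ℂ) * (conj (ftest f ξ) * ftest g ξ)).re| ≤
      (Fintype.card ι : ℝ) * ∫ x, bell (f x) (g x) :=
  abs_re_integral_le_of_tendsto (hf.integrable_ftest_mul hg)
    (fun M => (continuous_partialSym w i M).measurable) (fun M ξ => abs_partialSym_le w i M ξ)
    (Eventually.of_forall fun ξ => tendsto_partialSym w i ξ)
    (fun M => abs_re_integral_partialSym_le w hf hg i M)

theorem tendsto_stepSym_quotient (θ : ℝ) :
    Tendsto (fun n : ℕ => ((Real.fourierChar (1 / ((n : ℝ) + 1) * θ) : ℂ) - 1) *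
      ((n : ℂ) + 1)) atTop (𝓝 (2 * Real.pi * Complex.I * θ)) := by
  have h1 : HasDerivAt (fun t : ℝ => (Real.fourierChar (t * θ) : ℂ))
      (2 * Real.pi * Complex.I * θ) 0 := by
    have h := Real.hasDerivAt_fourierChar (0 * θ)
    have := h.scomp (0 : ℝ) (hasDerivAt_mul_const θ)
    simpa [mul_comm, mul_left_comm, Function.comp_def] using this
  have h2 := h1.tendsto_slope_zero_right
  have h3 : Tendsto (fun n : ℕ => 1 / ((n : ℝ) + 1)) atTop (𝓝[>] 0) :=
    tendsto_nhdsWithin_iff.2 ⟨tendsto_one_div_add_atTop_nhds_zero_nat,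
      Eventually.of_forall fun n => by simp only [Set.mem_Ioi]; positivity⟩
  refine (h2.comp h3).congr fun n => ?_
  simp [mul_comm]

/-- Numerator and denominator are both quadratic in the step length. The steps sum to zero, so the
mean symbol is 1 up to o(1/(n+1)); the denominator follows from the numerators by the variance
identity, without any second order expansion. -/
theorem tendsto_fullSym [Nonempty ι] (w : ι → R3) (hw : ∑ i, w i = 0) (i : ι) (ξ : R3)
    (hξ : ∑ j, (inner ℝ (w j) ξ : ℝ) ^ 2 ≠ 0) :
    Tendsto (fun n : ℕ => fullSym (fun j => (1 / ((n : ℝ) + 1)) • w j) i ξ) atTop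
      (𝓝 ((Fintype.card ι : ℝ) * (inner ℝ (w i) ξ : ℝ) ^ 2 / ∑ j, (inner ℝ (w j) ξ : ℝ) ^ 2)) := by
  have hN : (Fintype.card ι : ℂ) ≠ 0 := by exact_mod_cast Fintype.card_ne_zero
  have hN' : (Fintype.card ι : ℝ) ≠ 0 := by exact_mod_cast Fintype.card_ne_zero
  set W : ℕ → ι → R3 := fun n j => (1 / ((n : ℝ) + 1)) • w j with hW
  have hstep : ∀ j, Tendsto (fun n : ℕ => (stepSym (W n) j ξ - 1) * ((n : ℂ) + 1)) atTop
      (𝓝 (2 * Real.pi * Complex.I * (inner ℝ (w j) ξ : ℝ))) := by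
    intro j
    refine (tendsto_stepSym_quotient (inner ℝ (w j) ξ)).congr fun n => ?_
    simp only [stepSym, hW, inner_smul_left]
    simp
  have hwalk : Tendsto (fun n : ℕ => (walkSym (W n) ξ - 1) * ((n : ℂ) + 1)) atTop (𝓝 0) := by
    have h := (tendsto_finsetSum Finset.univ fun j _ => hstep j).const_mul
      (1 / (Fintype.card ι : ℂ))
    have e : ∑ j, 2 * Real.pi * Complex.I * ((inner ℝ (w j) ξ : ℝ) : ℂ) = 0 := by
      rw [← Finset.mul_sum, ← Complex.ofReal_sum, ← sum_inner, hw]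
      simp
    rw [e, mul_zero] at h
    refine h.congr fun n => ?_
    rw [← Finset.sum_mul, Finset.sum_sub_distrib, walkSym]
    simp only [Finset.sum_const, Finset.card_univ, nsmul_eq_mul, mul_one]
    field_simp
  have hdiff : ∀ j, Tendsto (fun n : ℕ => ‖stepSym (W n) j ξ - walkSym (W n) ξ‖ ^ 2 *
      ((n : ℝ) + 1) ^ 2) atTop (𝓝 ((2 * Real.pi) ^ 2 * (inner ℝ (w j) ξ : ℝ) ^ 2)) := by
    intro j
    have h := (((hstep j).sub hwalk).norm).pow 2
    have e : ‖2 * Real.pi * Complex.I * ((inner ℝ (w j) ξ : ℝ) : ℂ) - 0‖ ^ 2 =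
        (2 * Real.pi) ^ 2 * (inner ℝ (w j) ξ : ℝ) ^ 2 := by
      rw [sub_zero, norm_mul, Complex.norm_real, mul_pow, Real.norm_eq_abs, sq_abs]
      congr 2
      simp [abs_of_pos Real.pi_pos]
    rw [e] at h
    refine h.congr fun n => ?_
    rw [← mul_pow, ← sub_mul, sub_sub_sub_cancel_right, norm_mul]
    congr 2
    rw [show (n : ℂ) + 1 = ((n + 1 : ℝ) : ℂ) by push_cast; ring, Complex.norm_real,
      Real.norm_of_nonneg (by positivity)]
  have hden : Tendsto (fun n : ℕ => (1 - ‖walkSym (W n) ξ‖ ^ 2) * ((n : ℝ) + 1) ^ 2) atTop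
      (𝓝 ((1 / (Fintype.card ι : ℝ)) * ((2 * Real.pi) ^ 2 *
        ∑ j, (inner ℝ (w j) ξ : ℝ) ^ 2))) := by
    have h := (tendsto_finsetSum Finset.univ fun j _ => hdiff j).const_mul
      (1 / (Fintype.card ι : ℝ))
    rw [← Finset.mul_sum] at h
    refine h.congr fun n => ?_
    rw [← Finset.sum_mul, sum_norm_stepSym_sub_sq]
    field_simp
  have hpi := Real.pi_pos
  have h := (hdiff i).div hden (by positivity)
  have e : (2 * Real.pi) ^ 2 * (inner ℝ (w i) ξ : ℝ) ^ 2 / ((1 / (Fintype.card ι : ℝ)) *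
      ((2 * Real.pi) ^ 2 * ∑ j, (inner ℝ (w j) ξ : ℝ) ^ 2)) =
      (Fintype.card ι : ℝ) * (inner ℝ (w i) ξ : ℝ) ^ 2 / ∑ j, (inner ℝ (w j) ξ : ℝ) ^ 2 := by
    field_simp
  rw [e] at h
  refine h.congr fun n => ?_
  simp only [Pi.div_apply]
  rw [fullSym, mul_div_mul_right _ _ (by positivity)]

theorem abs_re_integral_quadratic_le [Nonempty ι] (w : ι → R3) (hw : ∑ i, w i = 0)
    (hξ : ∀ᵐ ξ, ∑ j, (inner ℝ (w j) ξ : ℝ) ^ 2 ≠ 0) {f g : R3 → ℝ} (hf : IsTest f)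
    (hg : IsTest g) (i : ι) :
    |(∫ ξ, (((Fintype.card ι : ℝ) * (inner ℝ (w i) ξ : ℝ) ^ 2 /
      ∑ j, (inner ℝ (w j) ξ : ℝ) ^ 2 : ℝ) : ℂ) * (conj (ftest f ξ) * ftest g ξ)).re| ≤
      (Fintype.card ι : ℝ) * ∫ x, bell (f x) (g x) := by
  refine abs_re_integral_le_of_tendsto (hf.integrable_ftest_mul hg)
    (m := fun n ξ => fullSym (fun j => (1 / ((n : ℝ) + 1)) • w j) i ξ)
    (fun n => measurable_fullSym _ i) (fun n ξ => abs_fullSym_le _ i ξ) ?_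
    (fun n => abs_re_integral_fullSym_le _ hf hg i)
  filter_upwards [hξ] with ξ h
  exact tendsto_fullSym w hw i ξ h

end RandomWalk

/-! ### The second order Riesz transforms on test functions -/

/-- The operator `∂_i ∂_k (-Δ)⁻¹`. -/
def riesz (i k : Fin 3) (φ : R3 → ℝ) : R3 → ℝ := invLaplacian (pd k (pd i φ))

/-- The symbol of `∂_i ∂_k (-Δ)⁻¹`. -/
def qsym (i k : Fin 3) (ξ : R3) : ℝ := -(ξ i * ξ k / ‖ξ‖ ^ 2)

theorem measurable_qsym (i k : Fin 3) : Measurable (qsym i k) := by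
  unfold qsym; fun_prop

theorem abs_qsym_le (i k : Fin 3) (ξ : R3) : |qsym i k ξ| ≤ 1 := by
  have := norm_sym_mul_nsym_le i k ξ
  rw [sym_mul_nsym, norm_neg, Complex.norm_real, Real.norm_eq_abs] at this
  rwa [qsym, abs_neg]

theorem IsTest.riesz_memLp {φ : R3 → ℝ} (h : IsTest φ) (i k : Fin 3) :
    MemLp (riesz i k φ) 2 volume := (invLaplacian_pd_spec (h.pd i) k).1

theorem IsTest.exists_riesz_le {φ : R3 → ℝ} (h : IsTest φ) (i k : Fin 3) :
    ∃ C, ∀ x, |riesz i k φ x| ≤ C := (invLaplacian_pd_spec (h.pd i) k).2.2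

theorem IsTest.contDiff_riesz {φ : R3 → ℝ} (h : IsTest φ) (i k : Fin 3) :
    ContDiff ℝ ∞ (riesz i k φ) := contDiff_invLaplacian ((h.pd i).pd k)

theorem L2F_riesz {φ : R3 → ℝ} (h : IsTest φ) (i k : Fin 3) :
    L2F (riesz i k φ) =ᵐ[volume] fun ξ => (qsym i k ξ : ℂ) * L2F φ ξ := by
  filter_upwards [(invLaplacian_pd_spec (h.pd i) k).2.1, L2F_pd h i] with ξ a b
  have e := sym_mul_nsym i k ξ
  rw [riesz, a, b, qsym, ← mul_assoc, mul_comm (nsym k ξ), e]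
  push_cast; ring

theorem integral_riesz_mul {f g : R3 → ℝ} (hf : IsTest f) (hg : MemLp g 2 volume)
    (i k : Fin 3) : ∫ x, riesz i k f x * g x =
      (∫ ξ, (qsym i k ξ : ℂ) * (conj (L2F f ξ) * L2F g ξ)).re := by
  rw [parseval (hf.riesz_memLp i k) hg]
  refine congrArg Complex.re (integral_congr_ae ?_)
  filter_upwards [L2F_riesz hf i k] with ξ a
  rw [a, map_mul, Complex.conj_ofReal]; ring

theorem integral_riesz_mul_comm {f g : R3 → ℝ} (hf : IsTest f) (hg : IsTest g)
    (i k : Fin 3) : ∫ x, riesz i k f x * g x = ∫ x, f x * riesz i k g x := by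
  rw [integral_riesz_mul hf (hg.memLp 2), parseval (hf.memLp 2) (hg.riesz_memLp i k)]
  refine congrArg Complex.re (integral_congr_ae ?_)
  filter_upwards [L2F_riesz hg i k] with ξ a
  rw [a]; ring

/-! ### Diagonal steps and polarisation -/

/-- The steps of the random walk: sums of two signed unit vectors. -/
def diagStep (p : (Bool × Fin 3) × (Bool × Fin 3)) : R3 :=
  (if p.1.1 then (1 : ℝ) else -1) • EuclideanSpace.single p.1.2 1 +
    (if p.2.1 then (1 : ℝ) else -1) • EuclideanSpace.single p.2.2 1

theorem inner_diagStep (p : (Bool × Fin 3) × (Bool × Fin 3)) (ξ : R3) :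
    (inner ℝ (diagStep p) ξ : ℝ) = (if p.1.1 then (1 : ℝ) else -1) * ξ p.1.2 +
      (if p.2.1 then (1 : ℝ) else -1) * ξ p.2.2 := by
  simp only [diagStep, inner_add_left, inner_smul_left, EuclideanSpace.inner_single_left]
  simp

theorem sum_diagStep : ∑ p, diagStep p = 0 := by
  simp only [Fintype.sum_prod_type, diagStep]
  simp [Finset.sum_add_distrib]

theorem sum_inner_diagStep (ξ : R3) :
    ∑ p, (inner ℝ (diagStep p) ξ : ℝ) ^ 2 = 24 * ‖ξ‖ ^ 2 := by
  simp only [inner_diagStep, Fintype.sum_prod_type, EuclideanSpace.norm_sq_eq, Fin.sum_univ_three,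
    Fintype.sum_bool, Real.norm_eq_abs, sq_abs]
  simp
  ring

theorem re_integral_linear_combination {F G H : R3 → ℂ} (hF : Integrable F) (hG : Integrable G)
    (hH : Integrable H) (a b c : ℝ) :
    a * (∫ ξ, F ξ).re + b * (∫ ξ, G ξ).re + c * (∫ ξ, H ξ).re =
      (∫ ξ, ((a : ℂ) * F ξ + b * G ξ + c * H ξ)).re := by
  have h1 : Integrable fun ξ => (a : ℂ) * F ξ + b * G ξ := (hF.const_mul _).add (hG.const_mul _)
  rw [integral_add h1 (hH.const_mul _), integral_add (hF.const_mul _) (hG.const_mul _)]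
  simp only [integral_const_mul, Complex.add_re, Complex.re_ofReal_mul]

/-- The step e_a + e_b yields the multiplier 36(ξ_a + ξ_b)²/(24|ξ|²), whence the factor 3/2.
Polarising, -ξ_i ξ_k is a combination of three such multipliers with coefficients -1/3, 1/12, 1/12,
and 36(1/3 + 1/12 + 1/12) = 18. -/
theorem abs_integral_riesz_le_bell {f g : R3 → ℝ} (hf : IsTest f) (hg : IsTest g)
    (i k : Fin 3) : |∫ x, riesz i k f x * g x| ≤ 18 * ∫ x, bell (f x) (g x) := by
  have hne : ∀ᵐ ξ : R3, ξ ≠ 0 := Measure.ae_ne volume 0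
  have hcard : (Fintype.card ((Bool × Fin 3) × (Bool × Fin 3)) : ℝ) = 36 := by
    norm_num
  have key : ∀ a b : Fin 3, |(∫ ξ, ((3 / 2 * (ξ a + ξ b) ^ 2 / ‖ξ‖ ^ 2 : ℝ) : ℂ) *
      (conj (ftest f ξ) * ftest g ξ)).re| ≤ 36 * ∫ x, bell (f x) (g x) := by
    intro a b
    have h := abs_re_integral_quadratic_le diagStep sum_diagStep (by
      filter_upwards [hne] with ξ hξ
      rw [sum_inner_diagStep]
      have : ‖ξ‖ ≠ 0 := norm_ne_zero_iff.2 hξ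
      positivity) hf hg ((true, a), (true, b))
    rw [hcard] at h
    refine le_trans (le_of_eq ?_) h
    congr 3
    refine funext fun ξ => ?_
    rw [sum_inner_diagStep, inner_diagStep]
    congr 2
    simp only [if_true, one_mul]
    by_cases h0 : ‖ξ‖ = 0
    · simp [h0]
    · field_simp; ring
  have hint : ∀ a b : Fin 3, Integrable fun ξ => ((3 / 2 * (ξ a + ξ b) ^ 2 / ‖ξ‖ ^ 2 : ℝ) : ℂ) *
      (conj (ftest f ξ) * ftest g ξ) := by
    intro a b
    refine (hf.integrable_ftest_mul hg).bdd_mul (c := 6)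
      (Complex.measurable_ofReal.comp (by fun_prop)).aestronglyMeasurable
      (Eventually.of_forall fun ξ => ?_)
    rw [Complex.norm_real, Real.norm_of_nonneg (by positivity)]
    have ha : ξ a ^ 2 ≤ ‖ξ‖ ^ 2 := sq_le_sq' (by have := PiLp.norm_apply_le ξ a; rw [Real.norm_eq_abs] at this; linarith [neg_abs_le (ξ a)]) ((le_abs_self _).trans (PiLp.norm_apply_le ξ a))
    have hb : ξ b ^ 2 ≤ ‖ξ‖ ^ 2 := sq_le_sq' (by have := PiLp.norm_apply_le ξ b; rw [Real.norm_eq_abs] at this; linarith [neg_abs_le (ξ b)]) ((le_abs_self _).trans (PiLp.norm_apply_le ξ b))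
    exact div_le_of_le_mul₀ (by positivity) (by norm_num)
      (by nlinarith [sq_nonneg (ξ a - ξ b)])
  have e : ∫ x, riesz i k f x * g x = -(1 / 3) * (∫ ξ, ((3 / 2 * (ξ i + ξ k) ^ 2 / ‖ξ‖ ^ 2 : ℝ) : ℂ) *
      (conj (ftest f ξ) * ftest g ξ)).re + 1 / 12 * (∫ ξ, ((3 / 2 * (ξ i + ξ i) ^ 2 / ‖ξ‖ ^ 2 : ℝ) : ℂ) *
      (conj (ftest f ξ) * ftest g ξ)).re + 1 / 12 * (∫ ξ, ((3 / 2 * (ξ k + ξ k) ^ 2 / ‖ξ‖ ^ 2 : ℝ) : ℂ) *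
      (conj (ftest f ξ) * ftest g ξ)).re := by
    rw [integral_riesz_mul hf (hg.memLp 2)]
    rw [re_integral_linear_combination (hint i k) (hint i i) (hint k k)]
    refine congrArg Complex.re (integral_congr_ae ?_)
    filter_upwards [L2F_test hf, L2F_test hg] with ξ a b
    rw [a, b, qsym]
    change _ * (conj (ftest f ξ) * ftest g ξ) = _
    push_cast
    ring
  rw [e]
  have h1 := abs_le.1 (key i k)
  have h2 := abs_le.1 (key i i)
  have h3 := abs_le.1 (key k k)
  rw [abs_le]
  constructor <;> linarith [h1.1, h1.2, h2.1, h2.2, h3.1, h3.2]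

theorem abs_integral_riesz_le {f g : R3 → ℝ} (hf : IsTest f) (hg : IsTest g)
    (i k : Fin 3) : |∫ x, riesz i k f x * g x| ≤
      18 * ((∫ x, |f x| ^ 3) + 61 * ∫ x, Real.sqrt |g x| ^ 3) := by
  have h1 : Integrable fun x => |f x| ^ 3 := by
    refine Continuous.integrable_of_hasCompactSupport (hf.continuous.abs.pow 3) ?_
    exact hf.2.comp_left (g := fun y : ℝ => |y| ^ 3) (by simp)
  have h2 : Integrable fun x => Real.sqrt |g x| ^ 3 := by
    refine Continuous.integrable_of_hasCompactSupport (hg.continuous.abs.sqrt.pow 3) ?_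
    exact hg.2.comp_left (g := fun y : ℝ => Real.sqrt |y| ^ 3) (by simp)
  refine (abs_integral_riesz_le_bell hf hg i k).trans ?_
  rw [← integral_const_mul (61 : ℝ), ← integral_add h1 (h2.const_mul _)]
  refine mul_le_mul_of_nonneg_left (integral_mono (integrable_bell hf hg) (h1.add (h2.const_mul _))
    fun x => ?_) (by norm_num)
  exact (le_abs_self _).trans (abs_bell_le _ _)

/-! ### Bounds of the Riesz transforms in `L³` and `L^{3/2}` -/

/-- Fatou's lemma along the cutoffs; it replaces a priori integrability by uniform truncated bounds.
-/
theorem integrable_of_forall_cutoff_le {h : R3 → ℝ} (hc : Continuous h) (h0 : ∀ x, 0 ≤ h x) {B : ℝ}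
    (hB : ∀ n, ∫ x, cutoff n x * h x ≤ B) : Integrable h ∧ ∫ x, h x ≤ B := by
  have hn0 : ∀ n x, 0 ≤ cutoff n x * h x := fun n x => mul_nonneg (cutoff_nonneg n x) (h0 x)
  have hint : ∀ n, Integrable fun x => cutoff n x * h x := fun n =>
    ((cutoff_isTest n).continuous.mul hc).integrable_of_hasCompactSupport
      (cutoff_isTest n).2.mul_right
  have hB0 : 0 ≤ B := (integral_nonneg (hn0 0)).trans (hB 0)
  have hle : eLpNorm h 1 volume ≤ ENNReal.ofReal B := by
    refine Lp.eLpNorm_le_of_ae_tendsto (u := atTop) (f := fun n x => cutoff n x * h x)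
      (Eventually.of_forall fun n => ?_) (fun n => (hint n).aestronglyMeasurable) ?_
    · rw [eLpNorm_one_eq_lintegral_enorm, ← ofReal_integral_norm_eq_lintegral_enorm (hint n)]
      refine ENNReal.ofReal_le_ofReal ?_
      simpa only [Real.norm_of_nonneg (hn0 n _)] using hB n
    · filter_upwards with x
      simpa using (cutoff_tendsto x).mul_const (h x)
  have hi : Integrable h := memLp_one_iff_integrable.1
    ⟨hc.aestronglyMeasurable, hle.trans_lt ENNReal.ofReal_lt_top⟩
  refine ⟨hi, ?_⟩
  rw [eLpNorm_one_eq_lintegral_enorm, ← ofReal_integral_norm_eq_lintegral_enorm hi,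
    ENNReal.ofReal_le_ofReal_iff hB0] at hle
  simpa only [Real.norm_of_nonneg (h0 _)] using hle

theorem IsTest.integrable_mul_continuous {χ h : R3 → ℝ} (hχ : IsTest χ) (hc : Continuous h) :
    Integrable fun x => χ x * h x :=
  (hχ.continuous.mul hc).integrable_of_hasCompactSupport hχ.2.mul_right

theorem sqrt_mul_sqrt_le {χ ν F ε : ℝ} (h0 : 0 ≤ χ) (h1 : χ ≤ 1) (hν : 0 ≤ ν) (hε : 0 ≤ ε) :
    Real.sqrt |χ * (ν ^ 2 * (F * Real.sqrt (F ^ 2 + ε ^ 2)))| ^ 3 ≤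
      ν ^ 3 * (4 * (χ * |F| ^ 3) + 4 * ε ^ 3 * χ) := by
  have hs : Real.sqrt (F ^ 2 + ε ^ 2) ≤ |F| + ε :=
    Real.sqrt_le_iff.2 ⟨by positivity, by nlinarith [abs_nonneg F, sq_abs F]⟩
  have hF := abs_nonneg F
  have h2 : |χ * (ν ^ 2 * (F * Real.sqrt (F ^ 2 + ε ^ 2)))| ≤ χ * (ν * (|F| + ε)) ^ 2 := by
    rw [abs_mul, abs_of_nonneg h0, abs_mul, abs_of_nonneg (sq_nonneg ν), abs_mul,
      abs_of_nonneg (Real.sqrt_nonneg _), mul_pow]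
    gcongr
    nlinarith [Real.sqrt_nonneg (F ^ 2 + ε ^ 2)]
  have h3 : Real.sqrt |χ * (ν ^ 2 * (F * Real.sqrt (F ^ 2 + ε ^ 2)))| ≤
      Real.sqrt χ * (ν * (|F| + ε)) := by
    refine (Real.sqrt_le_sqrt h2).trans (le_of_eq ?_)
    rw [Real.sqrt_mul h0, Real.sqrt_sq (by positivity)]
  have h4 : Real.sqrt χ ^ 3 ≤ χ := by
    have e := Real.sq_sqrt h0
    have : Real.sqrt χ ≤ 1 := Real.sqrt_le_one.2 h1
    nlinarith [Real.sqrt_nonneg χ]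
  have h5 : (|F| + ε) ^ 3 ≤ 4 * |F| ^ 3 + 4 * ε ^ 3 := by
    nlinarith [mul_nonneg (add_nonneg hF hε) (sq_nonneg (|F| - ε))]
  calc _ ≤ (Real.sqrt χ * (ν * (|F| + ε))) ^ 3 := pow_le_pow_left₀ (Real.sqrt_nonneg _) h3 3
    _ = Real.sqrt χ ^ 3 * (ν ^ 3 * (|F| + ε) ^ 3) := by ring
    _ ≤ χ * (ν ^ 3 * (4 * |F| ^ 3 + 4 * ε ^ 3)) := by gcongr
    _ = _ := by ring

/-- The transform F is paired with a cut off and smoothed version of ν²F|F|. Both sides then contain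
A = ∫ χ|F|³, with powers ν² and ν³; A is finite thanks to the cutoff, so for small ν the right one
is absorbed. -/
theorem exists_integral_riesz_cube_le : ∃ C : ℝ, 0 ≤ C ∧ ∀ (i k : Fin 3) (f : R3 → ℝ), IsTest f →
    Integrable (fun x => |riesz i k f x| ^ 3) ∧
      ∫ x, |riesz i k f x| ^ 3 ≤ C * ∫ x, |f x| ^ 3 := by
  refine ⟨36 * 8784 ^ 2, by norm_num, fun i k f hf => ?_⟩
  set F := riesz i k f with hFdef
  have hFs : ContDiff ℝ ∞ F := hf.contDiff_riesz i k
  have hFc := hFs.continuous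
  refine integrable_of_forall_cutoff_le (h := fun x => |F x| ^ 3) (hFc.abs.pow 3) (fun x => by positivity) fun n => ?_
  have hχ := cutoff_isTest n
  set χ := cutoff n with hχdef
  set A := ∫ x, χ x * |F x| ^ 3 with hA
  set K := ∫ x, χ x with hK
  have hK0 : 0 ≤ K := integral_nonneg (cutoff_nonneg n)
  have hAint : Integrable fun x => χ x * |F x| ^ 3 := hχ.integrable_mul_continuous (hFc.abs.pow 3)
  -- Here 18 · 61 · 4 = 4392 is the coefficient of ν³A on the right, and 8784 is twice that, so half
  -- of the left side survives.
  set ν : ℝ := 1 / 8784 with hν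
  have main : ∀ ε : ℝ, 0 < ε →
      ν ^ 2 * A ≤ 18 * ((∫ x, |f x| ^ 3) + 61 * (ν ^ 3 * (4 * A + 4 * ε ^ 3 * K))) := by
    intro ε hε
    have hpos : ∀ x, F x ^ 2 + ε ^ 2 ≠ 0 := fun x => by positivity
    have hrs : ContDiff ℝ ∞ fun x => ν ^ 2 * (F x * Real.sqrt (F x ^ 2 + ε ^ 2)) :=
      contDiff_const.mul (hFs.mul (((hFs.pow 2).add contDiff_const).sqrt hpos))
    have hg : IsTest fun x => χ x * (ν ^ 2 * (F x * Real.sqrt (F x ^ 2 + ε ^ 2))) :=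
      hχ.mul_smooth hrs
    have h1 := (le_abs_self _).trans (abs_integral_riesz_le hf hg i k)
    rw [← hFdef] at h1
    have h2 : ν ^ 2 * A ≤ ∫ x, F x * (χ x * (ν ^ 2 * (F x * Real.sqrt (F x ^ 2 + ε ^ 2)))) := by
      rw [hA, ← integral_const_mul]
      refine integral_mono (hAint.const_mul _) ?_ fun x => ?_
      · have := hχ.integrable_mul_continuous (hFc.mul hrs.continuous)
        refine this.congr (Eventually.of_forall fun x => ?_)
        simp only [Pi.mul_apply]; ring
      · have hs : |F x| ≤ Real.sqrt (F x ^ 2 + ε ^ 2) := by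
          rw [← Real.sqrt_sq_eq_abs]; exact Real.sqrt_le_sqrt (by nlinarith)
        have e : |F x| ^ 3 = F x ^ 2 * |F x| := by rw [pow_succ, sq_abs]
        have := cutoff_nonneg n x
        calc ν ^ 2 * (χ x * |F x| ^ 3) = (ν ^ 2 * χ x * F x ^ 2) * |F x| := by rw [e]; ring
          _ ≤ (ν ^ 2 * χ x * F x ^ 2) * Real.sqrt (F x ^ 2 + ε ^ 2) := by gcongr
          _ = _ := by ring
    refine h2.trans (h1.trans ?_)
    have h3 : ∫ x, Real.sqrt |χ x * (ν ^ 2 * (F x * Real.sqrt (F x ^ 2 + ε ^ 2)))| ^ 3 ≤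
        ν ^ 3 * (4 * A + 4 * ε ^ 3 * K) := by
      have hKi : Integrable fun x => 4 * ε ^ 3 * χ x := hχ.integrable.const_mul _
      rw [hA, hK, ← integral_const_mul, ← integral_const_mul,
        ← integral_add (hAint.const_mul 4) hKi, ← integral_const_mul]
      refine integral_mono ?_ (((hAint.const_mul 4).add hKi).const_mul _) fun x => ?_
      · refine Continuous.integrable_of_hasCompactSupport (hg.continuous.abs.sqrt.pow 3) ?_
        exact hg.2.comp_left (g := fun y : ℝ => Real.sqrt |y| ^ 3) (by simp)
      · exact sqrt_mul_sqrt_le (cutoff_nonneg n x) (cutoff_le_one n x) (by positivity) hε.le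
    gcongr
  have hlim : Tendsto (fun ε : ℝ => 18 * ((∫ x, |f x| ^ 3) + 61 * (ν ^ 3 * (4 * A + 4 * ε ^ 3 * K))))
      (𝓝[>] 0) (𝓝 (18 * ((∫ x, |f x| ^ 3) + 61 * (ν ^ 3 * (4 * A + 4 * 0 ^ 3 * K))))) := by
    refine Tendsto.mono_left ?_ nhdsWithin_le_nhds
    exact Continuous.tendsto (by fun_prop) 0
  have hfin := ge_of_tendsto hlim (by
    filter_upwards [self_mem_nhdsWithin] with ε hε using main ε hε)
  rw [hν] at hfin
  norm_num at hfin
  linarith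

/-- A smooth substitute for sign(F)|F|^{1/2}. With h = |F|^{1/2} and q⁴ = h⁴ + e⁴ one has h ≤ q, and
q ≤ 2h once h ≥ e; for h ≤ e the lower bound is trivial. -/
theorem sqrt_sqrt_lower {F e : ℝ} (he : 0 < e) :
    (Real.sqrt |F| ^ 3 - e ^ 3) / 2 ≤ F ^ 2 / Real.sqrt (Real.sqrt (F ^ 2 + e ^ 4)) ∧
    |F / Real.sqrt (Real.sqrt (F ^ 2 + e ^ 4))| ≤ Real.sqrt |F| := by
  set q := Real.sqrt (Real.sqrt (F ^ 2 + e ^ 4)) with hq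
  set h := Real.sqrt |F| with hh
  have hq0 : 0 < q := by positivity
  have hh0 : 0 ≤ h := Real.sqrt_nonneg _
  have hF : h ^ 2 = |F| := Real.sq_sqrt (abs_nonneg F)
  have hF2 : F ^ 2 = h ^ 4 := by rw [← sq_abs, ← hF]; ring
  have hq4 : q ^ 4 = h ^ 4 + e ^ 4 := by
    have : q ^ 4 = (q ^ 2) ^ 2 := by ring
    rw [this, hq, Real.sq_sqrt (Real.sqrt_nonneg _), Real.sq_sqrt (by positivity), hF2]
  have hhq : h ≤ q := by
    refine le_of_pow_le_pow_left₀ (n := 4) (by norm_num) hq0.le ?_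
    rw [hq4]; nlinarith [pow_pos he 4]
  constructor
  · rw [hF2, le_div_iff₀ hq0]
    rcases le_total h e with h1 | h1
    · have : h ^ 3 ≤ e ^ 3 := pow_le_pow_left₀ hh0 h1 3
      have h4 : 0 ≤ h ^ 4 := by positivity
      nlinarith
    · have h2 : q ≤ 2 * h := by
        refine le_of_pow_le_pow_left₀ (n := 4) (by norm_num) (by positivity) ?_
        rw [hq4]
        have : e ^ 4 ≤ h ^ 4 := pow_le_pow_left₀ he.le h1 4
        nlinarith [pow_nonneg hh0 4]
      have h3 : 0 ≤ h ^ 3 - e ^ 3 := by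
        have : e ^ 3 ≤ h ^ 3 := pow_le_pow_left₀ he.le h1 3
        linarith
      have h5 : 0 < e ^ 3 := by positivity
      nlinarith [mul_le_mul_of_nonneg_left h2 h3]
  · rw [abs_div, abs_of_pos hq0, ← hF, div_le_iff₀ hq0]
    nlinarith

/-- The dual of the L³ argument, with the symmetry of the transform. Only finiteness is recorded: it
is what allows the transform of a test function to be paired with L³ functions. -/
theorem IsTest.riesz_integrable_sqrt_cube {g : R3 → ℝ} (hg : IsTest g) (i k : Fin 3) :
    Integrable (fun x => Real.sqrt |riesz i k g x| ^ 3) := by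
  set F := riesz i k g with hFdef
  have hFs : ContDiff ℝ ∞ F := hg.contDiff_riesz i k
  have hFc := hFs.continuous
  set B := ∫ x, Real.sqrt |g x| ^ 3 with hB
  have hB0 : 0 ≤ B := integral_nonneg fun x => by positivity
  refine (integrable_of_forall_cutoff_le (h := fun x => Real.sqrt |F x| ^ 3)
    (B := 40000 * B) (hFc.abs.sqrt.pow 3)
    (fun x => by positivity) fun n => ?_).1
  have hχ := cutoff_isTest n
  set χ := cutoff n with hχdef
  set A := ∫ x, χ x * Real.sqrt |F x| ^ 3 with hA
  set K := ∫ x, χ x with hK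
  have hAint : Integrable fun x => χ x * Real.sqrt |F x| ^ 3 :=
    hχ.integrable_mul_continuous (hFc.abs.sqrt.pow 3)
  -- The coefficient μ/2 - 18μ³ = 0.032 left for `A` after absorption is positive, and 18 · 61/0.032
  -- < 40000.
  set μ : ℝ := 1 / 10 with hμ
  have main : ∀ e : ℝ, 0 < e → μ / 2 * A + -(μ * e ^ 3 / 2) * K ≤ 18 * (μ ^ 3 * A + 61 * B) := by
    intro e he
    have hpos : ∀ x, F x ^ 2 + e ^ 4 ≠ 0 := fun x => by positivity
    have hpos' : ∀ x, Real.sqrt (F x ^ 2 + e ^ 4) ≠ 0 := fun x => by positivity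
    have hpos'' : ∀ x, Real.sqrt (Real.sqrt (F x ^ 2 + e ^ 4)) ≠ 0 := fun x => by positivity
    have hrs : ContDiff ℝ ∞ fun x => μ * (F x / Real.sqrt (Real.sqrt (F x ^ 2 + e ^ 4))) :=
      contDiff_const.mul (hFs.div ((((hFs.pow 2).add contDiff_const).sqrt hpos).sqrt hpos') hpos'')
    have hf : IsTest fun x => χ x * (μ * (F x / Real.sqrt (Real.sqrt (F x ^ 2 + e ^ 4)))) :=
      hχ.mul_smooth hrs
    have h1 := (le_abs_self _).trans (abs_integral_riesz_le hf hg i k)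
    rw [integral_riesz_mul_comm hf hg, ← hFdef] at h1
    have hlow : μ / 2 * A + -(μ * e ^ 3 / 2) * K ≤
        ∫ x, χ x * (μ * (F x / Real.sqrt (Real.sqrt (F x ^ 2 + e ^ 4)))) * F x := by
      have hKi : Integrable fun x => -(μ * e ^ 3 / 2) * χ x := hχ.integrable.const_mul _
      rw [hA, hK, ← integral_const_mul, ← integral_const_mul, ← integral_add (hAint.const_mul _) hKi]
      refine integral_mono ((hAint.const_mul _).add hKi) ?_ fun x => ?_
      · have := hχ.integrable_mul_continuous (hrs.continuous.mul hFc)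
        refine this.congr (Eventually.of_forall fun x => ?_)
        simp only [Pi.mul_apply]; ring
      · have h0 := cutoff_nonneg n x
        have hl := (sqrt_sqrt_lower (F := F x) he).1
        calc _ = μ * χ x * ((Real.sqrt |F x| ^ 3 - e ^ 3) / 2) := by ring
          _ ≤ μ * χ x * (F x ^ 2 / Real.sqrt (Real.sqrt (F x ^ 2 + e ^ 4))) := by gcongr
          _ = _ := by ring
    refine hlow.trans (h1.trans ?_)
    have hup : ∫ x, |χ x * (μ * (F x / Real.sqrt (Real.sqrt (F x ^ 2 + e ^ 4))))| ^ 3 ≤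
        μ ^ 3 * A := by
      rw [hA, ← integral_const_mul]
      refine integral_mono ?_ (hAint.const_mul _) fun x => ?_
      · refine Continuous.integrable_of_hasCompactSupport (hf.continuous.abs.pow 3) ?_
        exact hf.2.comp_left (g := fun y : ℝ => |y| ^ 3) (by simp)
      · have h0 := cutoff_nonneg n x
        have h1 := cutoff_le_one n x
        have hl := (sqrt_sqrt_lower (F := F x) he).2
        have h3 : χ x ^ 3 ≤ χ x := by
          have := pow_le_pow_of_le_one h0 h1 (show 1 ≤ 3 by norm_num)
          simpa using this
        calc |χ x * (μ * (F x / Real.sqrt (Real.sqrt (F x ^ 2 + e ^ 4))))| ^ 3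
            = χ x ^ 3 * (μ ^ 3 * |F x / Real.sqrt (Real.sqrt (F x ^ 2 + e ^ 4))| ^ 3) := by
              rw [abs_mul, abs_of_nonneg h0, abs_mul, abs_of_nonneg (by positivity)]; ring
          _ ≤ χ x * (μ ^ 3 * Real.sqrt |F x| ^ 3) := by gcongr
          _ = _ := by ring
    gcongr
  have hlim : Tendsto (fun e : ℝ => μ / 2 * A + -(μ * e ^ 3 / 2) * K)
      (𝓝[>] 0) (𝓝 (μ / 2 * A + -(μ * 0 ^ 3 / 2) * K)) := by
    refine Tendsto.mono_left ?_ nhdsWithin_le_nhds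
    exact Continuous.tendsto (by fun_prop) 0
  have hfin := le_of_tendsto hlim (by
    filter_upwards [self_mem_nhdsWithin] with ε hε using main ε hε)
  rw [hμ] at hfin
  norm_num at hfin
  linarith

theorem IsTest.riesz_memLp_three {f : R3 → ℝ} (hf : IsTest f) (i k : Fin 3) :
    MemLp (riesz i k f) 3 volume := by
  have h := (exists_integral_riesz_cube_le.choose_spec.2 i k f hf).1
  refine (integrable_norm_rpow_iff (hf.contDiff_riesz i k).continuous.aestronglyMeasurable
    (by norm_num) (by norm_num)).1 (h.congr (Eventually.of_forall fun x => ?_))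
  simp only [ENNReal.toReal_ofNat, Real.rpow_ofNat, Real.norm_eq_abs]

theorem IsTest.riesz_memLp_three_halves {f : R3 → ℝ} (hf : IsTest f) (i k : Fin 3) :
    MemLp (riesz i k f) (3 / 2) volume := by
  have h := hf.riesz_integrable_sqrt_cube i k
  refine (integrable_norm_rpow_iff (hf.contDiff_riesz i k).continuous.aestronglyMeasurable
    (by norm_num) (ENNReal.div_ne_top (by norm_num) (by norm_num))).1
    (h.congr (Eventually.of_forall fun x => ?_))
  simp only [Real.norm_eq_abs, ENNReal.toReal_div, ENNReal.toReal_ofNat]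
  rw [Real.sqrt_eq_rpow, ← Real.rpow_natCast, ← Real.rpow_mul (abs_nonneg _)]
  norm_num

theorem exists_eLpNorm_riesz_le : ∃ C : ℝ≥0∞, C ≠ ⊤ ∧ ∀ (i k : Fin 3) (f : R3 → ℝ), IsTest f →
    eLpNorm (riesz i k f) 3 volume ≤ C * eLpNorm f 3 volume := by
  obtain ⟨C, hC0, hC⟩ := exists_integral_riesz_cube_le
  refine ⟨ENNReal.ofReal (C ^ ((3 : ℝ)⁻¹)), ENNReal.ofReal_ne_top, fun i k f hf => ?_⟩
  have h := (hC i k f hf).2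
  rw [(hf.riesz_memLp_three i k).eLpNorm_eq_integral_rpow_norm (by norm_num) (by norm_num),
    (hf.memLp 3).eLpNorm_eq_integral_rpow_norm (by norm_num) (by norm_num),
    ← ENNReal.ofReal_mul (by positivity)]
  refine ENNReal.ofReal_le_ofReal ?_
  simp only [ENNReal.toReal_ofNat, Real.norm_eq_abs]
  rw [← Real.mul_rpow hC0 (integral_nonneg fun x => by positivity)]
  refine Real.rpow_le_rpow (integral_nonneg fun x => by positivity) ?_ (by norm_num)
  simpa only [Real.rpow_ofNat] using h

/-! ### Convergence in Lebesgue spaces -/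

/-- The functions `f n ∈ L^p` converge to `s` in `L^p(ℝ³)`. -/
structure LpTendsto (p : ℝ≥0∞) (f : ℕ → R3 → ℝ) (s : R3 → ℝ) : Prop where
  mem : ∀ n, MemLp (f n) p volume
  lim : MemLp s p volume
  tendsto : Tendsto (fun n => eLpNorm (fun x => f n x - s x) p volume) atTop (𝓝 0)

instance holderTriple_three_three : ENNReal.HolderTriple 3 3 (3 / 2) where
  inv_add_inv_eq_inv := by
    rw [ENNReal.inv_div (by norm_num) (by norm_num), ENNReal.div_eq_inv_mul, mul_two]

instance holderTriple_three_three_halves : ENNReal.HolderTriple 3 (3 / 2) 1 where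
  inv_add_inv_eq_inv := by
    rw [ENNReal.inv_div (by norm_num) (by norm_num), ENNReal.div_eq_inv_mul, inv_one]
    nth_rewrite 1 [← mul_one (3 : ℝ≥0∞)⁻¹]
    rw [← mul_add, show (1 : ℝ≥0∞) + 2 = 3 by norm_num]
    exact ENNReal.inv_mul_cancel (by norm_num) (by norm_num)

namespace LpTendsto

variable {p q r : ℝ≥0∞} {f g : ℕ → R3 → ℝ} {s t : R3 → ℝ}

theorem const (hs : MemLp s p volume) : LpTendsto p (fun _ => s) s :=
  ⟨fun _ => hs, hs, by simp⟩

theorem add (hp : 1 ≤ p) (hf : LpTendsto p f s) (hg : LpTendsto p g t) :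
    LpTendsto p (fun n x => f n x + g n x) (fun x => s x + t x) := by
  refine ⟨fun n => (hf.mem n).add (hg.mem n), hf.lim.add hg.lim, ?_⟩
  refine tendsto_of_tendsto_of_tendsto_of_le_of_le tendsto_const_nhds
    (by simpa using hf.tendsto.add hg.tendsto) (fun _ => zero_le) fun n => ?_
  refine le_trans (le_of_eq ?_) (eLpNorm_add_le ((hf.mem n).sub hf.lim).aestronglyMeasurable
    ((hg.mem n).sub hg.lim).aestronglyMeasurable hp)
  congr 1
  funext x
  simp only [Pi.add_apply, Pi.sub_apply]; ring

theorem const_mul (c : ℝ) (hf : LpTendsto p f s) :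
    LpTendsto p (fun n x => c * f n x) (fun x => c * s x) := by
  refine ⟨fun n => (hf.mem n).const_mul c, hf.lim.const_mul c, ?_⟩
  have e : ∀ n, eLpNorm (fun x => c * f n x - c * s x) p volume =
      ‖c‖ₑ * eLpNorm (fun x => f n x - s x) p volume := fun n => by
    rw [← eLpNorm_const_smul]
    congr 1
    funext x
    simp only [Pi.smul_apply, smul_eq_mul]; ring
  simp only [e]
  simpa using ENNReal.Tendsto.const_mul (a := ‖c‖ₑ) hf.tendsto (Or.inr (by simp))

theorem sub (hp : 1 ≤ p) (hf : LpTendsto p f s) (hg : LpTendsto p g t) :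
    LpTendsto p (fun n x => f n x - g n x) (fun x => s x - t x) := by
  simpa [sub_eq_add_neg] using hf.add hp (hg.const_mul (-1))

theorem sum {ι : Type*} {σ : Finset ι} {f : ι → ℕ → R3 → ℝ} {s : ι → R3 → ℝ} (hp : 1 ≤ p)
    (hf : ∀ i, LpTendsto p (f i) (s i)) :
    LpTendsto p (fun n x => ∑ i ∈ σ, f i n x) (fun x => ∑ i ∈ σ, s i x) := by
  classical
  induction σ using Finset.induction_on with
  | empty => simpa using const (p := p) (s := fun _ => 0) MemLp.zero
  | insert a σ ha ih =>
    simp only [Finset.sum_insert ha]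
    exact (hf a).add hp ih

/-- Hölder's inequality applied to fg - st = (f-s)(g-t) + (f-s)t + s(g-t). -/
theorem mul [ENNReal.HolderTriple p q r] (hr : 1 ≤ r) (hf : LpTendsto p f s)
    (hg : LpTendsto q g t) : LpTendsto r (fun n x => f n x * g n x) (fun x => s x * t x) := by
  refine ⟨fun n => (hg.mem n).mul' (hf.mem n), hg.lim.mul' hf.lim, ?_⟩
  have df : ∀ n, MemLp (fun x => f n x - s x) p volume := fun n => (hf.mem n).sub hf.lim
  have dg : ∀ n, MemLp (fun x => g n x - t x) q volume := fun n => (hg.mem n).sub hg.lim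
  have key : ∀ n, eLpNorm (fun x => f n x * g n x - s x * t x) r volume ≤
      eLpNorm (fun x => f n x - s x) p volume * eLpNorm (fun x => g n x - t x) q volume +
      eLpNorm (fun x => f n x - s x) p volume * eLpNorm t q volume +
      eLpNorm s p volume * eLpNorm (fun x => g n x - t x) q volume := by
    intro n
    have e : (fun x => f n x * g n x - s x * t x) =
        ((fun x => f n x - s x) • (fun x => g n x - t x) + (fun x => f n x - s x) • t) +
          s • fun x => g n x - t x := by
      funext x
      simp only [Pi.add_apply, Pi.mul_apply, smul_eq_mul]; ring
    have m1 : MemLp ((fun x => f n x - s x) • fun x => g n x - t x) r volume :=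
      (dg n).smul (df n)
    have m2 : MemLp ((fun x => f n x - s x) • t) r volume := hg.lim.smul (df n)
    have m3 : MemLp (s • fun x => g n x - t x) r volume := (dg n).smul hf.lim
    rw [e]
    refine (eLpNorm_add_le (m1.add m2).1 m3.1 hr).trans (add_le_add
      ((eLpNorm_add_le m1.1 m2.1 hr).trans (add_le_add ?_ ?_)) ?_)
    · exact eLpNorm_smul_le_mul_eLpNorm (dg n).1 (df n).1
    · exact eLpNorm_smul_le_mul_eLpNorm hg.lim.1 (df n).1
    · exact eLpNorm_smul_le_mul_eLpNorm (dg n).1 hf.lim.1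
  refine tendsto_of_tendsto_of_tendsto_of_le_of_le tendsto_const_nhds ?_ (fun _ => zero_le) key
  have h1 := ENNReal.Tendsto.mul hf.tendsto (Or.inr ENNReal.zero_ne_top) hg.tendsto
    (Or.inr ENNReal.zero_ne_top)
  have h2 := ENNReal.Tendsto.mul_const (b := eLpNorm t q volume) hf.tendsto
    (Or.inr hg.lim.eLpNorm_ne_top)
  have h3 := ENNReal.Tendsto.const_mul (a := eLpNorm s p volume) hg.tendsto
    (Or.inr hf.lim.eLpNorm_ne_top)
  simpa using (h1.add h2).add h3

theorem integral (hf : LpTendsto 1 f s) :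
    Tendsto (fun n => ∫ x, f n x) atTop (𝓝 (∫ x, s x)) :=
  tendsto_integral_of_L1' s hf.lim.aestronglyMeasurable
    (Eventually.of_forall fun n => memLp_one_iff_integrable.1 (hf.mem n)) hf.tendsto

theorem congr (hf : LpTendsto p f s) (h : ∀ n, g n = f n) : LpTendsto p g s := by
  have : g = f := funext h
  rwa [this]

end LpTendsto

theorem exists_test_LpTendsto {p : ℝ≥0∞} (hp : p ≠ ⊤) (hp1 : 1 ≤ p) {s : R3 → ℝ}
    (hs : MemLp s p volume) : ∃ f : ℕ → R3 → ℝ, (∀ n, IsTest (f n)) ∧ LpTendsto p f s := by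
  obtain ⟨f, h1, h2⟩ := exists_test_tendsto hp hp1 hs
  exact ⟨f, h1, fun n => (h1 n).memLp p, hs, h2⟩

theorem exists_LpTendsto_of_cauchy {p : ℝ≥0∞} (hp : 1 ≤ p) {f : ℕ → R3 → ℝ}
    (hf : ∀ n, MemLp (f n) p volume)
    (h : Tendsto (fun n : ℕ × ℕ => eLpNorm (fun x => f n.1 x - f n.2 x) p volume) atTop (𝓝 0)) :
    ∃ s, LpTendsto p f s := by
  have : Fact (1 ≤ p) := ⟨hp⟩
  have hc : CauchySeq fun n => ((hf n).toLp (f n) : Lp ℝ p (volume : Measure R3)) := by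
    rw [Lp.cauchySeq_Lp_iff_cauchySeq_eLpNorm]
    refine h.congr fun n => eLpNorm_congr_ae ?_
    filter_upwards [(hf n.1).coeFn_toLp, (hf n.2).coeFn_toLp] with x a b
    simp only [Pi.sub_apply, a, b]
  obtain ⟨s, hs⟩ := cauchySeq_tendsto_of_complete hc
  refine ⟨s, hf, Lp.memLp s, ?_⟩
  rw [← Lp.toLp_coeFn s (Lp.memLp s)] at hs
  exact (Lp.tendsto_Lp_iff_tendsto_eLpNorm'' f hf s (Lp.memLp s)).1 hs

theorem LpTendsto.cauchy {p : ℝ≥0∞} (hp : 1 ≤ p) {f : ℕ → R3 → ℝ} {s : R3 → ℝ}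
    (hf : LpTendsto p f s) :
    Tendsto (fun n : ℕ × ℕ => eLpNorm (fun x => f n.1 x - f n.2 x) p volume) atTop (𝓝 0) := by
  have h1 : Tendsto (fun n : ℕ × ℕ => eLpNorm (fun x => f n.1 x - s x) p volume +
      eLpNorm (fun x => f n.2 x - s x) p volume) atTop (𝓝 0) := by
    rw [← prod_atTop_atTop_eq]
    simpa using (hf.tendsto.comp tendsto_fst).add (hf.tendsto.comp tendsto_snd)
  refine tendsto_of_tendsto_of_tendsto_of_le_of_le tendsto_const_nhds h1 (fun _ => zero_le)
    fun n => ?_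
  refine le_trans (le_of_eq ?_) (eLpNorm_sub_le ((hf.mem n.1).sub hf.lim).aestronglyMeasurable
    ((hf.mem n.2).sub hf.lim).aestronglyMeasurable hp)
  congr 1
  funext x
  simp only [Pi.sub_apply]; ring

/-! ### The Riesz transforms in `L³` -/

theorem invLaplacian_sub {φ ψ : R3 → ℝ} (hφ : IsTest φ) (hψ : IsTest ψ) (x : R3) :
    invLaplacian (fun x => φ x - ψ x) x = invLaplacian φ x - invLaplacian ψ x := by
  have e : (fun x => φ x - ψ x) = fun x => φ x + (-1) * ψ x := by funext x; ring
  rw [e, invLaplacian_eq_pot, invLaplacian_eq_pot, invLaplacian_eq_pot,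
    pot_add locallyIntegrable_newtonKernel hφ (hψ.const_mul _), pot_const_mul]
  ring

theorem riesz_sub {φ ψ : R3 → ℝ} (hφ : IsTest φ) (hψ : IsTest ψ) (i k : Fin 3) (x : R3) :
    riesz i k (fun x => φ x - ψ x) x = riesz i k φ x - riesz i k ψ x := by
  unfold riesz
  rw [pd_sub hφ.differentiable hψ.differentiable,
    pd_sub (hφ.pd i).differentiable (hψ.pd i).differentiable,
    invLaplacian_sub ((hφ.pd i).pd k) ((hψ.pd i).pd k)]

theorem pd_invLaplacian_pd {φ : R3 → ℝ} (hφ : IsTest φ) (i k : Fin 3) :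
    pd i (invLaplacian (pd k φ)) = riesz i k φ := by
  rw [pd_invLaplacian (hφ.pd k), pd_comm hφ.1, riesz]

/-- The uniform L³ bound makes the transforms a Cauchy sequence. Symmetry on test functions
identifies the limit as a distribution, the transform of `φ` being in L^{3/2}. -/
theorem exists_LpTendsto_riesz {f : ℕ → R3 → ℝ} (hf : ∀ n, IsTest (f n)) {s : R3 → ℝ}
    (hs : LpTendsto 3 f s) (i k : Fin 3) : ∃ t, LpTendsto 3 (fun n => riesz i k (f n)) t ∧
      ∀ φ, IsTest φ → ∫ x, t x * φ x = ∫ x, s x * riesz i k φ x := by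
  obtain ⟨C, hC, hb⟩ := exists_eLpNorm_riesz_le
  obtain ⟨t, ht⟩ := exists_LpTendsto_of_cauchy (p := 3) (by norm_num)
    (fun n => (hf n).riesz_memLp_three i k) (by
      have h := ENNReal.Tendsto.const_mul (a := C) (hs.cauchy (by norm_num)) (Or.inr hC)
      rw [mul_zero] at h
      refine tendsto_of_tendsto_of_tendsto_of_le_of_le tendsto_const_nhds h (fun _ => zero_le)
        fun n => ?_
      refine le_trans (le_of_eq ?_) (hb i k _ ((hf n.1).sub (hf n.2)))
      congr 1
      funext x
      rw [riesz_sub (hf n.1) (hf n.2)])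
  refine ⟨t, ht, fun φ hφ => ?_⟩
  have h1 := (LpTendsto.mul (r := 1) le_rfl ht (LpTendsto.const (hφ.memLp (3 / 2)))).integral
  have h2 := (LpTendsto.mul (r := 1) le_rfl hs
    (LpTendsto.const (hφ.riesz_memLp_three_halves i k))).integral
  refine tendsto_nhds_unique h1 (h2.congr fun n => ?_)
  exact (integral_riesz_mul_comm (hf n) hφ i k).symm

/-! ### The null Lagrangian `det ∇w` -/

theorem IsTest.integral_pd {φ : R3 → ℝ} (h : IsTest φ) (k : Fin 3) : ∫ x, _root_.pd k φ x = 0 := by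
  have := integral_mul_fderiv_eq_neg_fderiv_mul_of_integrable (μ := (volume : Measure R3))
    (f := fun _ => (1 : ℝ)) (g := φ) (v := EuclideanSpace.single k 1) (𝕜 := ℝ)
    (by simp) (by simp only [one_mul]; exact (h.pd k).integrable) (by simpa using h.integrable)
    (by fun_prop) (fun x _ => h.differentiable x)
  simp only [one_mul, fderiv_fun_const, Pi.zero_apply, zero_apply, zero_mul,
    integral_zero, neg_zero] at this
  exact this

/-- The `k`-th component of `∇v × ∇w`. -/
def crossGrad (v w : R3 → ℝ) (k : Fin 3) (x : R3) : ℝ :=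
  pd (k + 1) v x * pd (k + 2) w x - pd (k + 2) v x * pd (k + 1) w x

theorem contDiff_crossGrad {v w : R3 → ℝ} (hv : ContDiff ℝ ∞ v) (hw : ContDiff ℝ ∞ w)
    (k : Fin 3) : ContDiff ℝ ∞ (crossGrad v w k) :=
  ((hv.pd _).mul (hw.pd _)).sub ((hv.pd _).mul (hw.pd _))

theorem sum_pd_crossGrad {v w : R3 → ℝ} (hv : ContDiff ℝ ∞ v) (hw : ContDiff ℝ ∞ w) (x : R3) :
    ∑ k, pd k (crossGrad v w k) x = 0 := by
  have hd : ∀ {f : R3 → ℝ}, ContDiff ℝ ∞ f → Differentiable ℝ f := fun h =>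
    h.differentiable (by simp)
  have e : ∀ k, pd k (crossGrad v w k) x =
      pd (k + 1) v x * pd k (pd (k + 2) w) x + pd (k + 2) w x * pd k (pd (k + 1) v) x -
      (pd (k + 2) v x * pd k (pd (k + 1) w) x + pd (k + 1) w x * pd k (pd (k + 2) v) x) := by
    intro k
    have : crossGrad v w k = fun x =>
      pd (k + 1) v x * pd (k + 2) w x - pd (k + 2) v x * pd (k + 1) w x := rfl
    rw [this, pd_sub (hd ((hv.pd _).mul (hw.pd _))) (hd ((hv.pd _).mul (hw.pd _))),
      pd_mul (hd (hv.pd _)) (hd (hw.pd _)), pd_mul (hd (hv.pd _)) (hd (hw.pd _))]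
  simp only [e, Fin.sum_univ_three]
  have i1 : (0 : Fin 3) + 1 = 1 := rfl
  have i2 : (0 : Fin 3) + 2 = 2 := rfl
  have i3 : (1 : Fin 3) + 1 = 2 := rfl
  have i4 : (1 : Fin 3) + 2 = 0 := rfl
  have i5 : (2 : Fin 3) + 1 = 0 := rfl
  have i6 : (2 : Fin 3) + 2 = 1 := rfl
  simp only [i1, i2, i3, i4, i5, i6]
  rw [pd_comm hw 1 0, pd_comm hv 1 0, pd_comm hw 2 0, pd_comm hv 2 0, pd_comm hw 2 1,
    pd_comm hv 2 1]
  ring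

theorem sum_integral_crossGrad_mul_pd {v w φ : R3 → ℝ} (hv : ContDiff ℝ ∞ v)
    (hw : ContDiff ℝ ∞ w) (hφ : IsTest φ) :
    ∑ k, ∫ x, crossGrad v w k x * pd k φ x = 0 := by
  have hc := contDiff_crossGrad hv hw
  have h1 : ∀ k, Integrable fun x => crossGrad v w k x * pd k φ x := fun k =>
    ((hφ.pd k).mul_smooth (hc k)).integrable.congr (Eventually.of_forall fun x => mul_comm _ _)
  have h2 : ∀ k, Integrable fun x => φ x * pd k (crossGrad v w k) x := fun k =>
    (hφ.mul_smooth ((hc k).pd k)).integrable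
  have h3 : ∀ k, ∫ x, crossGrad v w k x * pd k φ x = -∫ x, φ x * pd k (crossGrad v w k) x := by
    intro k
    have := (hφ.mul_smooth (hc k)).integral_pd k
    rw [pd_mul hφ.differentiable ((hc k).differentiable (by simp)),
      integral_add (h2 k) (h1 k)] at this
    linarith
  simp only [h3, Finset.sum_neg_distrib]
  rw [← integral_finsetSum _ fun k _ => h2 k]
  simp only [← Finset.mul_sum, sum_pd_crossGrad hv hw]
  simp

theorem MeasureTheory.MemLp.mul_bdd_two {f g : R3 → ℝ} (hf : MemLp f 2 volume) (hg : Continuous g) {C : ℝ}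
    (hC : ∀ x, |g x| ≤ C) : MemLp (fun x => g x * f x) 2 volume := by
  refine (hf.const_mul C).mono (hg.aestronglyMeasurable.mul hf.aestronglyMeasurable)
    (Eventually.of_forall fun x => ?_)
  rw [norm_mul, norm_mul]
  exact mul_le_mul_of_nonneg_right ((hC x).trans (le_abs_self C)) (norm_nonneg _)

/-- The determinant is ∇w_0 · (∇w_1 × ∇w_2). One bounded and one square integrable factor put the
divergence free cross product in L², so w_0 may serve as test function without compact support. -/
theorem integral_det_grad_eq_zero {w : Fin 3 → R3 → ℝ} (hw : ∀ j, ContDiff ℝ ∞ (w j))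
    (h2 : ∀ j, MemLp (w j) 2 volume) (hd : ∀ i j, MemLp (pd i (w j)) 2 volume)
    (hb : ∀ i j, ∃ C, ∀ x, |pd i (w j) x| ≤ C) :
    ∫ x, (Matrix.of fun i j => pd i (w j) x).det = 0 := by
  have hm : ∀ k, MemLp (crossGrad (w 1) (w 2) k) 2 volume := by
    intro k
    obtain ⟨C, hC⟩ := hb (k + 1) 1
    obtain ⟨D, hD⟩ := hb (k + 2) 1
    exact ((hd (k + 2) 2).mul_bdd_two ((hw 1).pd _).continuous hC).sub
      ((hd (k + 1) 2).mul_bdd_two ((hw 1).pd _).continuous hD)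
  have h := weak_identity_smooth (f₀ := fun _ => 0) (f := crossGrad (w 1) (w 2)) MemLp.zero hm
    (fun φ hφ => by simpa using sum_integral_crossGrad_mul_pd (hw 1) (hw 2) hφ) (hw 0) (h2 0)
    (fun k => hd k 0)
  simp only [zero_mul, integral_zero, zero_add] at h
  rw [← integral_finsetSum _ fun k _ => (hm k).integrable_mul_two (hd k 0)] at h
  rw [← h]
  refine integral_congr_ae (Eventually.of_forall fun x => ?_)
  simp only [Matrix.det_fin_three, Matrix.of_apply, Fin.sum_univ_three, crossGrad]
  have i1 : (0 : Fin 3) + 1 = 1 := rfl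
  have i2 : (0 : Fin 3) + 2 = 2 := rfl
  have i3 : (1 : Fin 3) + 1 = 2 := rfl
  have i4 : (1 : Fin 3) + 2 = 0 := rfl
  have i5 : (2 : Fin 3) + 1 = 0 := rfl
  have i6 : (2 : Fin 3) + 2 = 1 := rfl
  simp only [i1, i2, i3, i4, i5, i6]
  ring

/-! ### The velocity gradient of an `L³` strain -/

theorem LpTendsto.det {F : ℕ → Fin 3 → Fin 3 → R3 → ℝ} {U : Fin 3 → Fin 3 → R3 → ℝ}
    (h : ∀ i j, LpTendsto 3 (fun n => F n i j) (U i j)) :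
    LpTendsto 1 (fun n x => (Matrix.of fun i j => F n i j x).det)
      (fun x => (Matrix.of fun i j => U i j x).det) := by
  have m : ∀ a b c d e f, LpTendsto 1 (fun n x => F n a b x * (F n c d x * F n e f x))
      (fun x => U a b x * (U c d x * U e f x)) := fun a b c d e f =>
    LpTendsto.mul (q := 3 / 2) le_rfl (h a b) (LpTendsto.mul (by
      rw [ENNReal.le_div_iff_mul_le (by norm_num) (by norm_num)]; norm_num) (h c d) (h e f))
  have k := ((((((m 0 0 1 1 2 2).sub le_rfl (m 0 0 1 2 2 1)).sub le_rfl (m 0 1 1 0 2 2)).add le_rfl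
    (m 0 1 1 2 2 0)).add le_rfl (m 0 2 1 0 2 1)).sub le_rfl (m 0 2 1 1 2 0))
  simp only [Matrix.det_fin_three, Matrix.of_apply, mul_assoc]
  exact k

/-- `U i j` represents `∂_i u_j`, where `u = -2 div (-Δ)⁻¹ S`. -/
theorem exists_velocity_gradient_three {S : R3 → Mat3} (hS : MemLqMat 3 S) :
    ∃ U : Fin 3 → Fin 3 → R3 → ℝ, (∀ i j, MemLp (U i j) 3 volume) ∧
      (∀ i j φ, IsTest φ → ∫ x, U i j x * φ x = distDeriv i (velocity S j) φ) ∧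
      Integrable (fun x => (Matrix.of fun i j => U i j x).det) ∧
      ∫ x, (Matrix.of fun i j => U i j x).det = 0 := by
  -- The entries are approximated independently. The approximants need not be symmetric, trace free
  -- or strains, because the determinant integrates to zero for every gradient.
  choose f hf hfl using fun k j => exists_test_LpTendsto (p := 3) (by norm_num) (by norm_num) (hS k j)
  choose t ht hti using fun i k j => exists_LpTendsto_riesz (hf k j) (hfl k j) i k
  have hU : ∀ i j, LpTendsto 3 (fun n x => (-2) * ∑ k, riesz i k (f k j n) x)
      (fun x => (-2) * ∑ k, t i k j x) := fun i j =>
    (LpTendsto.sum (by norm_num) fun k => ht i k j).const_mul (-2)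
  have hdet := LpTendsto.det (F := fun n i j x => (-2) * ∑ k, riesz i k (f k j n) x) hU
  refine ⟨fun i j x => (-2) * ∑ k, t i k j x, fun i j => (hU i j).lim, fun i j φ hφ => ?_,
    memLp_one_iff_integrable.1 hdet.lim, ?_⟩
  · have h1 : ∀ k, Integrable fun x => t i k j x * φ x := fun k =>
      memLp_one_iff_integrable.1 ((hφ.memLp (3 / 2)).mul' (ht i k j).lim)
    simp only [distDeriv, velocity, mul_assoc, Finset.sum_mul]
    rw [integral_const_mul, integral_finsetSum _ fun k _ => h1 k]
    simp only [hti _ _ _ φ hφ, riesz]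
    ring
  · refine tendsto_nhds_unique hdet.integral ?_
    refine tendsto_const_nhds.congr fun n => ?_
    have hw : ∀ j k, ContDiff ℝ ∞ (invLaplacian (pd k (f k j n))) := fun j k =>
      contDiff_invLaplacian ((hf k j n).pd k)
    have hpd : ∀ i j, pd i (fun x => (-2) * ∑ k, invLaplacian (pd k (f k j n)) x) =
        fun x => (-2) * ∑ k, riesz i k (f k j n) x := by
      intro i j
      have hsum : Differentiable ℝ fun x => ∑ k, invLaplacian (pd k (f k j n)) x :=
        Differentiable.fun_sum fun k _ => (hw j k).differentiable (by simp)
      rw [pd_const_mul hsum]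
      funext x
      congr 1
      simp only [← pd_invLaplacian_pd (hf _ j n)]
      simp only [pd]
      rw [fderiv_fun_sum fun k _ => ((hw j k).differentiable (by simp)) x]
      simp
    have := integral_det_grad_eq_zero (w := fun j x => (-2) * ∑ k, invLaplacian (pd k (f k j n)) x)
      (fun j => contDiff_const.mul (ContDiff.sum fun k _ => hw j k))
      (fun j => (memLp_finsetSum _ fun k _ => (invLaplacian_pd_spec (hf k j n) k).1).const_mul (-2))
      (fun i j => by
        rw [hpd]
        exact (memLp_finsetSum _ fun k _ => (hf k j n).riesz_memLp i k).const_mul (-2))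
      (fun i j => by
        rw [hpd]
        choose C hC using fun k => (hf k j n).exists_riesz_le i k
        refine ⟨2 * ∑ k, C k, fun x => ?_⟩
        rw [abs_mul, abs_neg, abs_two]
        exact mul_le_mul_of_nonneg_left ((Finset.abs_sum_le_sum_abs _ _).trans
          (Finset.sum_le_sum fun k _ => hC k x)) (by norm_num))
    simp only [hpd] at this
    exact this.symm

/-! ### The determinant identity -/

/-- Expansion of the determinant at a symmetric matrix: the terms linear and cubic in the
antisymmetric part vanish, and the quadratic one is M : (w ⊗ w)/4. No trace condition enters. -/
theorem frob_tensorSq_eq {M : Mat3} {U : Fin 3 → Fin 3 → ℝ} {w : R3}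
    (hM : ∀ i j, M i j = (U i j + U j i) / 2)
    (hw : ∀ k, w k = U (k + 1) (k + 2) - U (k + 2) (k + 1)) :
    frob M (tensorSq w) = 4 * ((Matrix.of U).det - M.det) := by
  have i1 : (0 : Fin 3) + 1 = 1 := rfl
  have i2 : (0 : Fin 3) + 2 = 2 := rfl
  have i3 : (1 : Fin 3) + 1 = 2 := rfl
  have i4 : (1 : Fin 3) + 2 = 0 := rfl
  have i5 : (2 : Fin 3) + 1 = 0 := rfl
  have i6 : (2 : Fin 3) + 2 = 1 := rfl
  simp only [frob, tensorSq, Matrix.det_fin_three, Matrix.of_apply, Fin.sum_univ_three, hM, hw,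
    i1, i2, i3, i4, i5, i6]
  ring

/-- By symmetry the left side is tr M³, which Cayley–Hamilton evaluates when the trace vanishes. -/
theorem frob_mul_self_eq {M : Mat3} (hM : M.IsSymm) (ht : M.trace = 0) :
    frob M (M * M) = 3 * M.det := by
  have h := fun i j => hM.apply i j
  simp only [Matrix.trace, Matrix.diag, Fin.sum_univ_three] at ht
  simp only [frob, Matrix.det_fin_three, Matrix.mul_apply, Fin.sum_univ_three]
  rw [h 0 1, h 0 2, h 1 2]
  have e : M 2 2 = -M 0 0 - M 1 1 := by linarith
  rw [e]
  ring

theorem frob_combination (M : Mat3) (w : R3) :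
    frob M ((1 / 3 : ℝ) • (M * M) + (1 / 4 : ℝ) • tensorSq w) =
      1 / 3 * frob M (M * M) + 1 / 4 * frob M (tensorSq w) := by
  simp only [frob, Matrix.add_apply, Matrix.smul_apply, smul_eq_mul, Fin.sum_univ_three]
  ring

section gradient

variable {S : R3 → Mat3} {U : Fin 3 → Fin 3 → R3 → ℝ}

theorem represents_distCurl (hU : ∀ i j, LocallyIntegrable (U i j))
    (h : ∀ i j φ, IsTest φ → ∫ x, U i j x * φ x = distDeriv i (velocity S j) φ) (k : Fin 3) :
    Represents (fun x => U (k + 1) (k + 2) x - U (k + 2) (k + 1) x) (distCurl (velocity S) k) := by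
  refine ⟨(hU _ _).sub (hU _ _), fun φ hφ => ?_⟩
  have hi : ∀ i j, Integrable fun x => U i j x * φ x := fun i j => by
    simpa [mul_comm] using (hU i j).integrable_smul_left_of_hasCompactSupport hφ.continuous hφ.2
  simp only [sub_mul]
  rw [integral_sub (hi _ _) (hi _ _), h _ _ φ hφ, h _ _ φ hφ]
  rfl

theorem represents_distSymGrad (hU : ∀ i j, LocallyIntegrable (U i j))
    (h : ∀ i j φ, IsTest φ → ∫ x, U i j x * φ x = distDeriv i (velocity S j) φ) (i j : Fin 3) :
    Represents (fun x => (U i j x + U j i x) / 2) (distSymGrad (velocity S) i j) := by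
  have hl : LocallyIntegrable fun x => (U i j x + U j i x) / 2 := by
    have := ((hU i j).add (hU j i)).smul (2⁻¹ : ℝ)
    have e : (fun x => (U i j x + U j i x) / 2) = (2⁻¹ : ℝ) • (U i j + U j i) := by
      funext x; simp [div_eq_inv_mul]
    rwa [e]
  refine ⟨hl, fun φ hφ => ?_⟩
  have hi : ∀ i j, Integrable fun x => U i j x * φ x := fun i j => by
    simpa [mul_comm] using (hU i j).integrable_smul_left_of_hasCompactSupport hφ.continuous hφ.2
  have e : ∀ x, (U i j x + U j i x) / 2 * φ x = (2⁻¹ : ℝ) * (U i j x * φ x + U j i x * φ x) :=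
    fun x => by ring
  simp only [e, integral_const_mul]
  rw [integral_add (hi _ _) (hi _ _), h _ _ φ hφ, h _ _ φ hφ, distSymGrad]
  ring

end gradient

theorem exists_isVorticity {S : R3 → Mat3} {U : Fin 3 → Fin 3 → R3 → ℝ}
    (hU : ∀ i j, LocallyIntegrable (U i j))
    (h : ∀ i j φ, IsTest φ → ∫ x, U i j x * φ x = distDeriv i (velocity S j) φ) :
    ∃ w : R3 → R3, IsVorticity S w :=
  ⟨fun x => WithLp.toLp 2 fun k => U (k + 1) (k + 2) x - U (k + 2) (k + 1) x,
    fun k => represents_distCurl hU h k⟩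

/-- Representatives are unique almost everywhere, so `S` and any given vorticity are the symmetric
part and the curl of the gradient built in `exists_velocity_gradient_three`, and the pointwise
algebra applies. -/
theorem strain_determinant_identity {S : R3 → Mat3} (hS : MemLqSt 3 S) :
    (∃ w : R3 → R3, IsVorticity S w) ∧
      ∀ w : R3 → R3, IsVorticity S w →
        MemLqVec 3 w ∧
        Integrable (fun x => (S x).det) ∧
        Integrable (fun x => frob (S x) (tensorSq (w x))) ∧
        -4 * ∫ x, (S x).det = ∫ x, frob (S x) (tensorSq (w x)) ∧
        Integrable (fun x =>
          frob (S x) ((1 / 3 : ℝ) • (S x * S x) + (1 / 4 : ℝ) • tensorSq (w x))) ∧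
        ∫ x, frob (S x) ((1 / 3 : ℝ) • (S x * S x) + (1 / 4 : ℝ) • tensorSq (w x)) = 0 := by
  obtain ⟨hS3, hsymm, htr, hrep⟩ := hS
  obtain ⟨U, hU3, hUr, hUi, hU0⟩ := exists_velocity_gradient_three hS3
  have hUl : ∀ i j, LocallyIntegrable (U i j) := fun i j =>
    (hU3 i j).locallyIntegrable (by norm_num)
  refine ⟨exists_isVorticity hUl hUr, fun w hw => ?_⟩
  have hw' : ∀ k, (fun x => w x k) =ᵐ[volume] fun x => U (k + 1) (k + 2) x - U (k + 2) (k + 1) x :=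
    fun k => (hw k).ae_eq (represents_distCurl hUl hUr k)
  have hS' : ∀ i j, (fun x => S x i j) =ᵐ[volume] fun x => (U i j x + U j i x) / 2 := fun i j =>
    (hrep i j).ae_eq (represents_distSymGrad hUl hUr i j)
  have hdet : Integrable fun x => (S x).det := memLp_one_iff_integrable.1
    (LpTendsto.det (F := fun _ i j x => S x i j) fun i j => LpTendsto.const (hS3 i j)).lim
  have hpt : ∀ᵐ x, frob (S x) (tensorSq (w x)) =
      4 * ((Matrix.of fun i j => U i j x).det - (S x).det) := by
    filter_upwards [ae_all_iff.2 hw', ae_all_iff.2 fun i => ae_all_iff.2 (hS' i)] with x h1 h2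
    exact frob_tensorSq_eq (U := fun i j => U i j x) h2 h1
  have hfi : Integrable fun x => frob (S x) (tensorSq (w x)) :=
    ((hUi.sub hdet).const_mul 4).congr (hpt.mono fun x hx => hx.symm)
  have hid : -4 * ∫ x, (S x).det = ∫ x, frob (S x) (tensorSq (w x)) := by
    rw [integral_congr_ae hpt, integral_const_mul, integral_sub hUi hdet, hU0]
    ring
  have hpt2 : ∀ᵐ x, frob (S x) ((1 / 3 : ℝ) • (S x * S x) + (1 / 4 : ℝ) • tensorSq (w x)) =
      (S x).det + 1 / 4 * frob (S x) (tensorSq (w x)) := by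
    filter_upwards [hsymm, htr] with x h1 h2
    rw [frob_combination, frob_mul_self_eq h1 h2]
    ring
  refine ⟨fun k => ?_, hdet, hfi, hid,
    (hdet.add (hfi.const_mul (1 / 4))).congr (hpt2.mono fun x hx => hx.symm), ?_⟩
  · exact ((hU3 _ _).sub (hU3 _ _)).ae_eq (hw' k).symm
  · rw [integral_congr_ae hpt2, integral_add hdet (hfi.const_mul _), integral_const_mul, ← hid]
    ring

/-! ### Linearity and injectivity of the `L²` Fourier transform -/

theorem L2F_add {f g : R3 → ℝ} (hf : MemLp f 2 volume) (hg : MemLp g 2 volume) :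
    L2F (fun x => f x + g x) =ᵐ[volume] fun ξ => L2F f ξ + L2F g ξ := by
  rw [L2F_eq (f := fun x => f x + g x) (hf.add hg), L2F_eq hf, L2F_eq hg]
  have e : ((hf.add hg).cx.toLp _ : Lp ℂ 2 (volume : Measure R3)) =
      hf.cx.toLp _ + hg.cx.toLp _ := by
    rw [← MemLp.toLp_add]
    exact MemLp.toLp_congr _ _ (Eventually.of_forall fun x => by simp)
  have e' : (𝓕 ((hf.add hg).cx.toLp _ : Lp ℂ 2 (volume : Measure R3)) : Lp ℂ 2 (volume : Measure R3)) =
      𝓕 (hf.cx.toLp _ : Lp ℂ 2 (volume : Measure R3)) + 𝓕 (hg.cx.toLp _ : Lp ℂ 2 (volume : Measure R3)) := by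
    rw [e, FourierTransform.fourier_add]
  have := Lp.coeFn_add (𝓕 (hf.cx.toLp _ : Lp ℂ 2 (volume : Measure R3)) : Lp ℂ 2 (volume : Measure R3))
    (𝓕 (hg.cx.toLp _ : Lp ℂ 2 (volume : Measure R3)) : Lp ℂ 2 (volume : Measure R3))
  rw [← e'] at this
  exact this

theorem L2F_const_mul {f : R3 → ℝ} (hf : MemLp f 2 volume) (c : ℝ) :
    L2F (fun x => c * f x) =ᵐ[volume] fun ξ => c * L2F f ξ := by
  rw [L2F_eq (f := fun x => c * f x) (hf.const_mul c), L2F_eq hf]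
  have e : ((hf.const_mul c).cx.toLp _ : Lp ℂ 2 (volume : Measure R3)) =
      (c : ℂ) • hf.cx.toLp _ := by
    rw [← MemLp.toLp_const_smul]
    exact MemLp.toLp_congr _ _ (Eventually.of_forall fun x => by simp)
  have e' : (𝓕 ((hf.const_mul c).cx.toLp _ : Lp ℂ 2 (volume : Measure R3)) : Lp ℂ 2 (volume : Measure R3)) =
      (c : ℂ) • 𝓕 (hf.cx.toLp _ : Lp ℂ 2 (volume : Measure R3)) := by
    rw [e, FourierTransform.fourier_smul]
  have := Lp.coeFn_smul (c : ℂ) (𝓕 (hf.cx.toLp _ : Lp ℂ 2 (volume : Measure R3)) : Lp ℂ 2 (volume : Measure R3))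
  rw [← e'] at this
  exact this

theorem L2F_sum {ι : Type*} (s : Finset ι) {f : ι → R3 → ℝ} (hf : ∀ i, MemLp (f i) 2 volume) :
    L2F (fun x => ∑ i ∈ s, f i x) =ᵐ[volume] fun ξ => ∑ i ∈ s, L2F (f i) ξ := by
  classical
  induction s using Finset.induction_on with
  | empty =>
    have h := L2F_const_mul (f := fun _ => (0 : ℝ)) MemLp.zero 0
    simpa using h
  | insert a s ha ih =>
    simp only [Finset.sum_insert ha]
    filter_upwards [L2F_add (hf a) (memLp_finsetSum s fun i _ => hf i), ih] with ξ h1 h2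
    rw [h1, h2]

theorem L2F_sub {f g : R3 → ℝ} (hf : MemLp f 2 volume) (hg : MemLp g 2 volume) :
    L2F (fun x => f x - g x) =ᵐ[volume] fun ξ => L2F f ξ - L2F g ξ := by
  have e : (fun x => f x - g x) = fun x => f x + (-1) * g x := by funext x; ring
  rw [e]
  filter_upwards [L2F_add hf (hg.const_mul (-1)), L2F_const_mul hg (-1)] with ξ h1 h2
  rw [h1, h2]; push_cast; ring

theorem eLpNorm_L2F {f : R3 → ℝ} (hf : MemLp f 2 volume) :
    eLpNorm (L2F f) 2 volume = eLpNorm f 2 volume := by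
  have h := Lp.norm_fourier_eq (hf.cx.toLp _ : Lp ℂ 2 (volume : Measure R3))
  rw [Lp.norm_def, Lp.norm_def, ENNReal.toReal_eq_toReal_iff' (Lp.eLpNorm_ne_top _)
    (Lp.eLpNorm_ne_top _), ← L2F_eq hf, eLpNorm_congr_ae hf.cx.coeFn_toLp] at h
  rw [h]
  exact eLpNorm_congr_norm_ae (Eventually.of_forall fun x => by simp)

theorem ae_eq_of_L2F_eq {f g : R3 → ℝ} (hf : MemLp f 2 volume) (hg : MemLp g 2 volume)
    (h : L2F f =ᵐ[volume] L2F g) : f =ᵐ[volume] g := by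
  refine ae_eq_of_forall_test (locallyIntegrable_of_memLp_two hf) (locallyIntegrable_of_memLp_two hg)
    fun φ hφ => ?_
  rw [parseval hf (hφ.memLp 2), parseval hg (hφ.memLp 2)]
  refine congrArg Complex.re (integral_congr_ae ?_)
  filter_upwards [h] with ξ e
  rw [e]

/-- A bounded multiplier that acts on test functions acts on real square integrable functions. -/
theorem exists_multiplier {m : R3 → ℂ} (hm : Measurable m) {C : ℝ} (hC : ∀ ξ, ‖m ξ‖ ≤ C)
    (hT : ∀ φ, IsTest φ → ∃ t : R3 → ℝ, MemLp t 2 volume ∧ L2F t =ᵐ[volume] fun ξ => m ξ * L2F φ ξ)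
    {s : R3 → ℝ} (hs : MemLp s 2 volume) :
    ∃ t : R3 → ℝ, MemLp t 2 volume ∧ L2F t =ᵐ[volume] fun ξ => m ξ * L2F s ξ := by
  have hmul : ∀ g : R3 → ℝ, MemLp g 2 volume →
      eLpNorm (fun ξ => m ξ * L2F g ξ) 2 volume ≤ ENNReal.ofReal C * eLpNorm g 2 volume := by
    intro g hg
    rw [← eLpNorm_L2F hg]
    refine eLpNorm_le_mul_eLpNorm_of_ae_le_mul (Eventually.of_forall fun ξ => ?_) 2
    rw [norm_mul]
    exact mul_le_mul_of_nonneg_right (hC ξ) (norm_nonneg _)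
  have hdiff : ∀ {f g f' g' : R3 → ℝ}, MemLp f 2 volume → MemLp g 2 volume → MemLp f' 2 volume →
      MemLp g' 2 volume → (L2F f' =ᵐ[volume] fun ξ => m ξ * L2F f ξ) →
      (L2F g' =ᵐ[volume] fun ξ => m ξ * L2F g ξ) →
      eLpNorm (fun x => f' x - g' x) 2 volume ≤
        ENNReal.ofReal C * eLpNorm (fun x => f x - g x) 2 volume := by
    intro f g f' g' hf hg hf' hg' h1 h2
    rw [← eLpNorm_L2F (f := fun x => f' x - g' x) (hf'.sub hg')]
    refine le_trans (le_of_eq (eLpNorm_congr_ae ?_)) (hmul _ (hf.sub hg))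
    filter_upwards [h1, h2, L2F_sub hf' hg', L2F_sub hf hg] with ξ a b c d
    rw [c, a, b, d]; ring
  -- Approximation keeps the result real: the hypothesis supplies real images of test functions, and
  -- their limit in L² is real. No symmetry of `m` has to be checked.
  obtain ⟨f, hf, hfs⟩ := exists_test_LpTendsto (p := 2) (by norm_num) (by norm_num) hs
  choose t ht htm using fun n => hT (f n) (hf n)
  have hlim0 : ∀ {α : Type} {l : Filter α} {a : α → ℝ≥0∞}, Tendsto a l (𝓝 0) →
      Tendsto (fun n => ENNReal.ofReal C * a n) l (𝓝 0) := fun h => by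
    simpa using ENNReal.Tendsto.const_mul (a := ENNReal.ofReal C) h (Or.inr ENNReal.ofReal_ne_top)
  obtain ⟨T, hTl⟩ := exists_LpTendsto_of_cauchy (p := 2) (by norm_num) ht
    (tendsto_of_tendsto_of_tendsto_of_le_of_le tendsto_const_nhds
      (hlim0 (hfs.cauchy (by norm_num))) (fun _ => zero_le) fun n =>
      hdiff (hfs.mem n.1) (hfs.mem n.2) (ht n.1) (ht n.2) (htm n.1) (htm n.2))
  refine ⟨T, hTl.lim, ?_⟩
  have hms : AEStronglyMeasurable (fun ξ => m ξ * L2F s ξ) volume :=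
    hm.aestronglyMeasurable.mul (memLp_L2F s).aestronglyMeasurable
  have hz : eLpNorm (fun ξ => L2F T ξ - m ξ * L2F s ξ) 2 volume = 0 := by
    have hle : ∀ n, eLpNorm (fun ξ => L2F T ξ - m ξ * L2F s ξ) 2 volume ≤
        eLpNorm (fun x => t n x - T x) 2 volume +
          ENNReal.ofReal C * eLpNorm (fun x => f n x - s x) 2 volume := by
      intro n
      have h1 : MemLp (fun x => t n x - T x) 2 volume := (ht n).sub hTl.lim
      have h2 : MemLp (fun x => f n x - s x) 2 volume := (hfs.mem n).sub hs
      have e : (fun ξ => L2F T ξ - m ξ * L2F s ξ) =ᵐ[volume]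
          (fun ξ => m ξ * L2F (fun x => f n x - s x) ξ) - L2F (fun x => t n x - T x) := by
        filter_upwards [htm n, L2F_sub (ht n) hTl.lim, L2F_sub (hfs.mem n) hs] with ξ a b c
        rw [Pi.sub_apply, b, c, a]; ring
      rw [eLpNorm_congr_ae e, add_comm]
      refine (eLpNorm_sub_le (hm.aestronglyMeasurable.mul (memLp_L2F _).aestronglyMeasurable)
        (memLp_L2F _).aestronglyMeasurable (by norm_num)).trans ?_
      rw [eLpNorm_L2F h1]
      exact add_le_add (hmul _ h2) le_rfl
    have := hTl.tendsto.add (hlim0 hfs.tendsto)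
    rw [add_zero] at this
    exact le_antisymm (ge_of_tendsto' this hle) zero_le
  have := (eLpNorm_eq_zero_iff ((memLp_L2F T).aestronglyMeasurable.sub hms) (by norm_num)).1 hz
  filter_upwards [this] with ξ h
  exact sub_eq_zero.1 h

/-! ### The velocity gradient of an `L²` strain -/

/-- In L² boundedness of the symbol suffices, and the Fourier transform of the gradient is available
for later use. -/
theorem exists_velocity_gradient_two {S : R3 → Mat3} (hS : MemLqMat 2 S) :
    ∃ U : Fin 3 → Fin 3 → R3 → ℝ, (∀ i j, MemLp (U i j) 2 volume) ∧
      (∀ i j, L2F (U i j) =ᵐ[volume] fun ξ => -2 * ∑ k, (qsym i k ξ : ℂ) * L2F (fun x => S x k j) ξ) ∧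
      (∀ i j φ, IsTest φ → ∫ x, U i j x * φ x = distDeriv i (velocity S j) φ) := by
  have hT : ∀ i k j, ∃ t : R3 → ℝ, MemLp t 2 volume ∧ L2F t =ᵐ[volume] fun ξ =>
      (qsym i k ξ : ℂ) * L2F (fun x => S x k j) ξ := fun i k j =>
    exists_multiplier (Complex.measurable_ofReal.comp (measurable_qsym i k)) (C := 1)
      (fun ξ => by rw [Function.comp_apply, Complex.norm_real]; exact abs_qsym_le i k ξ)
      (fun φ hφ => ⟨_, hφ.riesz_memLp i k, L2F_riesz hφ i k⟩) (hS k j)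
  choose t ht htm using hT
  have hU : ∀ i j, MemLp (fun x => (-2) * ∑ k, t i k j x) 2 volume := fun i j =>
    (memLp_finsetSum _ fun k _ => ht i k j).const_mul (-2)
  refine ⟨fun i j x => (-2) * ∑ k, t i k j x, hU, fun i j => ?_, fun i j φ hφ => ?_⟩
  · filter_upwards [L2F_const_mul (memLp_finsetSum Finset.univ fun k _ => ht i k j) (-2),
      L2F_sum Finset.univ fun k => ht i k j, ae_all_iff.2 fun k => htm i k j] with ξ a b c
    rw [a, b]
    push_cast
    simp only [c]
  · have h1 : ∀ k, Integrable fun x => t i k j x * φ x := fun k =>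
      (ht i k j).integrable_mul_two (hφ.memLp 2)
    have h2 : ∀ k, ∫ x, t i k j x * φ x = ∫ x, S x k j * riesz i k φ x := by
      intro k
      rw [parseval (ht i k j) (hφ.memLp 2), parseval (hS k j) (hφ.riesz_memLp i k)]
      refine congrArg Complex.re (integral_congr_ae ?_)
      filter_upwards [htm i k j, L2F_riesz hφ i k] with ξ a b
      rw [a, b, map_mul, Complex.conj_ofReal]; ring
    simp only [distDeriv, velocity, mul_assoc, Finset.sum_mul]
    rw [integral_const_mul, integral_finsetSum _ fun k _ => h1 k]
    simp only [h2, riesz]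
    ring

/-! ### Strains of the form `∇_sym (-Δ)^{-1/2} v` -/

theorem rieszKernel_nonneg (y : R3) : 0 ≤ rieszKernel y := by
  unfold rieszKernel; positivity

theorem measurable_rieszKernel : Measurable rieszKernel := by
  unfold rieszKernel; fun_prop

theorem IsTest.exists_test_dominating {ψ : R3 → ℝ} (hψ : IsTest ψ) :
    ∃ χ : R3 → ℝ, IsTest χ ∧ ∀ x, |ψ x| ≤ χ x := by
  obtain ⟨C, hC⟩ := hψ.continuous.bounded_above_of_compact_support hψ.2
  obtain ⟨r, hr⟩ := hψ.2.isCompact.isBounded.subset_closedBall (0 : R3)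
  have hC0 : 0 ≤ C := (norm_nonneg _).trans (hC 0)
  set b : ContDiffBump (0 : R3) := ⟨max r 1, max r 1 + 1, by positivity, by linarith⟩ with hb
  have ht : IsTest b := ⟨b.contDiff, b.hasCompactSupport⟩
  refine ⟨fun x => C * b x, ht.const_mul C, fun x => ?_⟩
  by_cases hx : x ∈ tsupport ψ
  · have : b x = 1 := b.one_of_mem_closedBall
      (Metric.closedBall_subset_closedBall (le_max_left r 1) (hr hx))
    simp only [this, mul_one]
    exact hC x
  · rw [image_eq_zero_of_notMem_tsupport hx, abs_zero]
    exact mul_nonneg hC0 b.nonneg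

theorem IsTest.integrable_rieszKernel_mul {ψ : R3 → ℝ} (hψ : IsTest ψ) (y : R3) :
    Integrable fun x => rieszKernel (x - y) * ψ x := by
  have := (integrable_pot locallyIntegrable_rieszKernel hψ y).comp_sub_left y
  refine this.congr (Eventually.of_forall fun x => ?_)
  simp only [sub_sub_cancel, rieszKernel, norm_sub_rev y x]

theorem integral_rieszKernel_mul (ψ : R3 → ℝ) (y : R3) :
    ∫ x, rieszKernel (x - y) * ψ x = pot rieszKernel ψ y := by
  rw [pot_eq_integral_kernel]
  congr 1
  funext x
  rw [mul_comm, rieszKernel, rieszKernel, norm_sub_rev]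

/-- Fubini. Absolute convergence comes from a test function χ ≥ |ψ|, whose Riesz potential is square
integrable. -/
theorem integral_invSqrtLaplacian_mul {v : R3 → R3} {j : Fin 3} (hv : MemLp (fun x => v x j) 2 volume)
    {ψ : R3 → ℝ} (hψ : IsTest ψ) :
    ∫ x, invSqrtLaplacian v x j * ψ x = ∫ y, v y j * rieszPot ψ y := by
  obtain ⟨χ, hχ, hle⟩ := hψ.exists_test_dominating
  have hm : AEStronglyMeasurable (fun p : R3 × R3 => v p.2 j * (rieszKernel (p.1 - p.2) * ψ p.1))
      (volume.prod volume) :=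
    hv.aestronglyMeasurable.comp_snd.mul
      ((measurable_rieszKernel.comp measurable_sub).aestronglyMeasurable.mul
        hψ.continuous.aestronglyMeasurable.comp_fst)
  have hn : ∀ y, ∫ x, ‖v y j * (rieszKernel (x - y) * ψ x)‖ ≤ ‖v y j * rieszPot χ y‖ := by
    intro y
    have hp : ∫ x, rieszKernel (x - y) * χ x = rieszPot χ y := integral_rieszKernel_mul χ y
    simp only [norm_mul, ← hp, Real.norm_eq_abs, abs_of_nonneg (rieszKernel_nonneg _)]
    rw [integral_const_mul]
    refine mul_le_mul_of_nonneg_left ((integral_mono ?_ (hχ.integrable_rieszKernel_mul y)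
      fun x => ?_).trans (le_abs_self _)) (abs_nonneg _)
    · refine (hψ.integrable_rieszKernel_mul y).norm.congr (Eventually.of_forall fun x => ?_)
      simp only [norm_mul, Real.norm_eq_abs, abs_of_nonneg (rieszKernel_nonneg _)]
    · exact mul_le_mul_of_nonneg_left (hle x) (rieszKernel_nonneg _)
  have hint : Integrable (fun p : R3 × R3 => v p.2 j * (rieszKernel (p.1 - p.2) * ψ p.1))
      (volume.prod volume) := by
    rw [integrable_prod_iff' hm]
    refine ⟨Eventually.of_forall fun y => (hψ.integrable_rieszKernel_mul y).const_mul (v y j), ?_⟩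
    refine (hv.integrable_mul_two (rieszPot_spec hχ).1).norm.mono'
      hm.norm.prod_swap.integral_prod_right' (Eventually.of_forall fun y => ?_)
    rw [Real.norm_of_nonneg (integral_nonneg fun x => norm_nonneg _)]
    exact hn y
  have hl : ∀ x, invSqrtLaplacian v x j * ψ x = ∫ y, v y j * (rieszKernel (x - y) * ψ x) := by
    intro x
    simp only [invSqrtLaplacian, ← integral_mul_const]
    congr 1
    funext y
    rw [rieszKernel]; ring
  simp only [hl]
  rw [integral_integral_swap hint]
  congr 1
  funext y
  rw [integral_const_mul, integral_rieszKernel_mul, rieszPot]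

theorem conj_sym (k : Fin 3) (ξ : R3) : conj (sym k ξ) = -sym k ξ := by
  simp [sym, Complex.conj_ofNat]

theorem norm_rsym_mul_sym_le (k : Fin 3) (ξ : R3) : ‖(rsym ξ : ℂ) * sym k ξ‖ ≤ 1 := by
  rw [norm_mul]
  refine (mul_le_mul (norm_rsym_le ξ) (norm_sym_le k ξ) (norm_nonneg _) (by positivity)).trans ?_
  have := Real.pi_pos
  by_cases h : ‖ξ‖ = 0
  · simp [h]
  · field_simp; norm_num

/-- `r i` represents `∂_i (-Δ)^{-1/2} v_j`. -/
theorem exists_gradient_invSqrtLaplacian {v : R3 → R3} {j : Fin 3}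
    (hv : MemLp (fun x => v x j) 2 volume) (i : Fin 3) :
    ∃ r : R3 → ℝ, MemLp r 2 volume ∧
      (L2F r =ᵐ[volume] fun ξ => (rsym ξ : ℂ) * sym i ξ * L2F (fun x => v x j) ξ) ∧
      ∀ φ, IsTest φ → ∫ x, r x * φ x = distDeriv i (regular (invSqrtLaplacian v) j) φ := by
  obtain ⟨r, hr, hrm⟩ := exists_multiplier (m := fun ξ => (rsym ξ : ℂ) * sym i ξ)
    ((Complex.measurable_ofReal.comp measurable_rsym).mul (measurable_sym i)) (C := 1)
    (norm_rsym_mul_sym_le i) (fun φ hφ => ⟨_, (rieszPot_spec (hφ.pd i)).1, by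
      filter_upwards [(rieszPot_spec (hφ.pd i)).2, L2F_pd hφ i] with ξ a b
      rw [a, b, mul_assoc]⟩) hv
  refine ⟨r, hr, hrm, fun φ hφ => ?_⟩
  rw [distDeriv, regular, integral_invSqrtLaplacian_mul hv (hφ.pd i),
    parseval hv (rieszPot_spec (hφ.pd i)).1, parseval hr (hφ.memLp 2), ← Complex.neg_re, ← integral_neg]
  refine congrArg Complex.re (integral_congr_ae ?_)
  filter_upwards [hrm, (rieszPot_spec (hφ.pd i)).2, L2F_pd hφ i] with ξ a b c
  rw [a, b, c, map_mul, map_mul, Complex.conj_ofReal, conj_sym]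
  ring

/-- In Fourier variables: the velocity gradient computed from the symmetric gradient of a divergence
free field is the full gradient of that field. The two ingredients are ∑ ξ_k² = |ξ|² and ξ · V = 0.
-/
theorem sum_qsym_eq {ξ : R3} (hξ : ξ ≠ 0) {V : Fin 3 → ℂ} (hV : ∑ k, sym k ξ * V k = 0)
    (ρ : ℂ) (i j : Fin 3) :
    (-2 * ∑ k, (qsym i k ξ : ℂ) * (ρ * (sym k ξ * V j + sym j ξ * V k) / 2)) =
      ρ * (sym i ξ * V j) := by
  have hpi : (Real.pi : ℂ) ≠ 0 := by exact_mod_cast Real.pi_pos.ne'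
  have hn : (‖ξ‖ : ℂ) ≠ 0 := by exact_mod_cast norm_ne_zero_iff.2 hξ
  have hsq : (ξ 0 : ℂ) ^ 2 + (ξ 1 : ℂ) ^ 2 + (ξ 2 : ℂ) ^ 2 = (‖ξ‖ : ℂ) ^ 2 := by
    have := EuclideanSpace.norm_sq_eq ξ
    simp only [Fin.sum_univ_three, Real.norm_eq_abs, sq_abs] at this
    exact_mod_cast this.symm
  have hV' : (ξ 0 : ℂ) * V 0 + ξ 1 * V 1 + ξ 2 * V 2 = 0 := by
    simp only [sym, Fin.sum_univ_three] at hV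
    have h2 : (2 * Real.pi * Complex.I) * ((ξ 0 : ℂ) * V 0 + ξ 1 * V 1 + ξ 2 * V 2) = 0 := by
      rw [← hV]; ring
    exact (mul_eq_zero.1 h2).resolve_left (by simp [hpi])
  simp only [Fin.sum_univ_three, qsym, sym]
  push_cast
  field_simp
  linear_combination (ρ * ξ i * V j) * hsq + (ρ * ξ i * ξ j) * hV'

theorem represents_of_ae_eq {f g : R3 → ℝ} {T : Functional3} (hf : Represents f T)
    (h : f =ᵐ[volume] g) : Represents g T :=
  ⟨hf.1.congr h, fun φ hφ => (integral_congr_ae (h.mono fun x hx => by simp only [hx])).symm.trans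
    (hf.2 φ hφ)⟩

/-- On the Fourier side the trace is a multiple of ξ · v̂ = 0, and `sum_qsym_eq` identifies the
velocity gradient of S with the gradient of (-Δ)^{-1/2} v, whose symmetric part is S. -/
theorem MemH1St.memLqSt_two {S : R3 → Mat3} (hS : MemH1St S) : MemLqSt 2 S := by
  obtain ⟨hS1, v, ⟨hv1, hvdiv⟩, hsg⟩ := hS
  have hS2 : MemLqMat 2 S := fun i j => (hS1 i j).1
  have hv2 : ∀ j, MemLp (fun x => v x j) 2 volume := fun j => (hv1 j).1
  choose r hr hrm hrd using fun i j => exists_gradient_invSqrtLaplacian (hv2 j) i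
  have hdiv : (fun _ : R3 => (0 : ℂ)) =ᵐ[volume] fun ξ => ∑ k, sym k ξ * L2F (fun x => v x k) ξ := by
    have h0 := L2F_of_weak_identity (f₀ := fun _ => 0) (f := fun k x => v x k) MemLp.zero hv2
      (fun φ hφ => by
        have := hvdiv φ hφ
        simp only [distDiv, distDeriv, regular, Finset.sum_neg_distrib, neg_eq_zero] at this
        simpa using this)
    have h1 := L2F_const_mul (f := fun _ => (0 : ℝ)) MemLp.zero 0
    filter_upwards [h0, h1] with ξ a b
    rw [← a]
    simpa using b.symm
  have hrep : ∀ i j, (fun x => S x i j) =ᵐ[volume] fun x => 2⁻¹ * (r i j x + r j i x) := by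
    intro i j
    refine ae_eq_of_forall_test (hsg i j).1 (locallyIntegrable_of_memLp_two
      (((hr i j).add (hr j i)).const_mul 2⁻¹)) fun φ hφ => ?_
    rw [(hsg i j).2 φ hφ]
    simp only [mul_assoc, add_mul, integral_const_mul]
    rw [integral_add ((hr i j).integrable_mul_two (hφ.memLp 2))
      ((hr j i).integrable_mul_two (hφ.memLp 2)), hrd i j φ hφ, hrd j i φ hφ, distSymGrad]
    ring
  have hF : ∀ i j, L2F (fun x => S x i j) =ᵐ[volume] fun ξ => (rsym ξ : ℂ) *
      (sym i ξ * L2F (fun x => v x j) ξ + sym j ξ * L2F (fun x => v x i) ξ) / 2 := by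
    intro i j
    rw [L2F_congr (hS2 i j) (hrep i j)]
    filter_upwards [L2F_const_mul ((hr i j).add (hr j i)) 2⁻¹, L2F_add (hr i j) (hr j i),
      hrm i j, hrm j i] with ξ a b c d
    refine a.trans ?_
    have b' : L2F (r i j + r j i) ξ = L2F (r i j) ξ + L2F (r j i) ξ := b
    rw [b', c, d]
    push_cast
    ring
  have hsymm : ∀ i j, (fun x => S x i j) =ᵐ[volume] fun x => S x j i := by
    intro i j
    filter_upwards [hrep i j, hrep j i] with x a b
    rw [a, b, add_comm]
  have htr : (fun x => ∑ i, S x i i) =ᵐ[volume] fun _ => (0 : ℝ) := by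
    refine ae_eq_of_L2F_eq (memLp_finsetSum _ fun i _ => hS2 i i) MemLp.zero ?_
    filter_upwards [L2F_sum Finset.univ fun i => hS2 i i, ae_all_iff.2 fun i => hF i i, hdiv,
      L2F_const_mul (f := fun _ => (0 : ℝ)) MemLp.zero 0] with ξ a b c d
    have d' : L2F (fun _ => (0 : ℝ)) ξ = 0 := by simpa using d
    rw [a, d']
    simp only [b]
    rw [← mul_zero (rsym ξ : ℂ), c, Finset.mul_sum]
    refine Finset.sum_congr rfl fun k _ => ?_
    ring
  obtain ⟨U, hU2, hUF, hUr⟩ := exists_velocity_gradient_two hS2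
  have hUrr : ∀ i j, U i j =ᵐ[volume] r i j := by
    intro i j
    refine ae_eq_of_L2F_eq (hU2 i j) (hr i j) ?_
    filter_upwards [hUF i j, ae_all_iff.2 fun k => hF k j, hrm i j, hdiv,
      Measure.ae_ne volume (0 : R3)] with ξ a b c d hξ
    rw [a, c]
    simp only [b]
    rw [sum_qsym_eq hξ d.symm, mul_assoc]
  refine ⟨hS2, ?_, ?_, fun i j => ?_⟩
  · filter_upwards [ae_all_iff.2 fun i => ae_all_iff.2 (hsymm i)] with x hx
    exact Matrix.IsSymm.ext fun i j => hx j i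
  · filter_upwards [htr] with x hx
    exact hx
  · refine represents_of_ae_eq (represents_distSymGrad
      (fun i j => locallyIntegrable_of_memLp_two (hU2 i j)) hUr i j) ?_
    filter_upwards [hrep i j, hUrr i j, hUrr j i] with x a b c
    rw [a, b, c]; ring

/-! ### Weak derivatives on the Fourier side -/

theorem L2F_weak_derivative {f g : R3 → ℝ} (hf : MemLp f 2 volume) (hg : MemLp g 2 volume)
    {k : Fin 3} (h : ∀ φ, IsTest φ → ∫ x, g x * φ x = -∫ x, f x * pd k φ x) :
    L2F g =ᵐ[volume] fun ξ => sym k ξ * L2F f ξ := by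
  have h1 := L2F_of_weak_identity (f₀ := g) (f := fun l x => if l = k then f x else 0) hg
    (fun l => by by_cases hl : l = k <;> simp [hl, hf])
    (fun φ hφ => by
      rw [h φ hφ]
      have : ∀ l, ∫ x, (if l = k then f x else 0) * pd l φ x =
          if l = k then ∫ x, f x * pd k φ x else 0 := fun l => by
        by_cases hl : l = k <;> simp [hl]
      simp only [this]
      simp)
  have h0 := L2F_const_mul (f := fun _ => (0 : ℝ)) MemLp.zero 0
  filter_upwards [h1, h0] with ξ a b
  have b' : L2F (fun _ => (0 : ℝ)) ξ = 0 := by simpa using b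
  rw [a]
  have : ∀ l, sym l ξ * L2F (fun x => if l = k then f x else 0) ξ =
      if l = k then sym k ξ * L2F f ξ else 0 := fun l => by
    by_cases hl : l = k
    · subst hl; simp
    · simp [hl, b']
  simp [this]

theorem weak_derivative_of_L2F {f g : R3 → ℝ} (hf : MemLp f 2 volume) (hg : MemLp g 2 volume)
    {k : Fin 3} (h : L2F g =ᵐ[volume] fun ξ => sym k ξ * L2F f ξ) {φ : R3 → ℝ} (hφ : IsTest φ) :
    ∫ x, g x * φ x = -∫ x, f x * pd k φ x := by
  rw [parseval hg (hφ.memLp 2), parseval hf ((hφ.pd k).memLp 2), ← Complex.neg_re, ← integral_neg]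
  refine congrArg Complex.re (integral_congr_ae ?_)
  filter_upwards [h, L2F_pd hφ k] with ξ a b
  rw [a, b, map_mul, conj_sym]
  ring

/-! ### Boundedness of the velocity -/

/-- The square is integrable at the origin like |ξ|⁻² and at infinity like |ξ|⁻⁴; the explicit
majorant comes from (1+r)² ≤ 2(1+r²). -/
theorem memLp_two_weight :
    MemLp (fun ξ : R3 => ‖ξ‖⁻¹ * (1 + ‖ξ‖)⁻¹) 2 volume := by
  have hm : Measurable fun ξ : R3 => ‖ξ‖⁻¹ * (1 + ‖ξ‖)⁻¹ := by fun_prop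
  rw [memLp_two_iff_integrable_sq hm.aestronglyMeasurable]
  have h1 : Integrable fun ξ : R3 => (1 + ‖ξ‖) ^ (-4 : ℝ) :=
    integrable_one_add_norm (by simp; norm_num)
  have h2 := integrable_mul_norm_rpow (a := 2) (C := 1) (by norm_num) (by norm_num) h1 (fun ξ => by
    rw [Real.norm_of_nonneg (by positivity)]
    exact Real.rpow_le_one_of_one_le_of_nonpos (by linarith [norm_nonneg ξ]) (by norm_num))
  refine ((h1.add h2).const_mul 2).mono' (hm.pow_const 2).aestronglyMeasurable ?_
  filter_upwards [Measure.ae_ne volume (0 : R3)] with ξ hξ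
  have hr : 0 < ‖ξ‖ := norm_pos_iff.2 hξ
  rw [Real.norm_of_nonneg (by positivity)]
  simp only [Pi.add_apply, smul_eq_mul]
  rw [Real.rpow_neg (by positivity), Real.rpow_neg hr.le]
  rw [show (4 : ℝ) = ((4 : ℕ) : ℝ) by norm_num, Real.rpow_natCast,
    show ‖ξ‖ ^ (2 : ℝ) = ‖ξ‖ ^ 2 by exact_mod_cast Real.rpow_natCast ‖ξ‖ 2]
  set r := ‖ξ‖
  rw [← mul_inv, inv_pow, inv_eq_one_div, div_le_iff₀ (by positivity)]
  have e : 2 * (((1 + r) ^ 4)⁻¹ + (r ^ 2)⁻¹ * ((1 + r) ^ 4)⁻¹) * (r * (1 + r)) ^ 2 =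
      2 * (r ^ 2 + 1) / (1 + r) ^ 2 := by
    field_simp
  rw [e, le_div_iff₀ (by positivity)]
  nlinarith [sq_nonneg (r - 1)]

theorem conj_nsym (k : Fin 3) (ξ : R3) : conj (nsym k ξ) = -nsym k ξ := by
  simp only [nsym, map_mul, conj_sym, Complex.conj_ofReal]
  ring

/-- Cauchy–Schwarz: |ξ|⁻¹|F| is the weight of `memLp_two_weight` times (1+|ξ|)|F|, which the
hypotheses on `F` and its products with the symbols place in L². -/
theorem integrable_nsym_mul {F : R3 → ℂ} (hF : MemLp F 2 volume)
    (hd : ∀ k, MemLp (fun ξ => sym k ξ * F ξ) 2 volume) (i : Fin 3) :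
    Integrable fun ξ => nsym i ξ * F ξ := by
  have hG : MemLp (fun ξ => ‖F ξ‖ + ∑ k, ‖sym k ξ * F ξ‖) 2 volume :=
    hF.norm.add (memLp_finsetSum _ fun k _ => (hd k).norm)
  refine (memLp_two_weight.integrable_mul_two hG).mono'
    ((measurable_nsym i).aestronglyMeasurable.mul hF.aestronglyMeasurable) ?_
  filter_upwards [Measure.ae_ne volume (0 : R3)] with ξ hξ
  have hr : 0 < ‖ξ‖ := norm_pos_iff.2 hξ
  have hpi := Real.pi_gt_three
  have h1 : (1 + ‖ξ‖) * ‖F ξ‖ ≤ ‖F ξ‖ + ∑ k, ‖sym k ξ * F ξ‖ := by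
    have h2 : ∑ k, ‖sym k ξ * F ξ‖ = 2 * Real.pi * (|ξ 0| + |ξ 1| + |ξ 2|) * ‖F ξ‖ := by
      simp only [sym, Fin.sum_univ_three, norm_mul, Complex.norm_I, Complex.norm_real,
        Real.norm_eq_abs, abs_of_pos Real.pi_pos, Complex.norm_ofNat]
      ring
    have h3 : ‖ξ‖ ≤ |ξ 0| + |ξ 1| + |ξ 2| := by
      rw [EuclideanSpace.norm_eq]
      refine Real.sqrt_le_iff.2 ⟨by positivity, ?_⟩
      simp only [Fin.sum_univ_three, Real.norm_eq_abs]
      nlinarith [mul_nonneg (abs_nonneg (ξ 0)) (abs_nonneg (ξ 1)),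
        mul_nonneg (abs_nonneg (ξ 0)) (abs_nonneg (ξ 2)),
        mul_nonneg (abs_nonneg (ξ 1)) (abs_nonneg (ξ 2))]
    rw [h2, add_mul, one_mul]
    gcongr
    nlinarith
  rw [norm_mul]
  calc ‖nsym i ξ‖ * ‖F ξ‖ ≤ ‖ξ‖⁻¹ * ‖F ξ‖ := by
        gcongr
        refine (norm_nsym_le i ξ).trans (mul_le_of_le_one_left (by positivity) ?_)
        rw [div_le_one (by positivity)]; linarith
    _ = ‖ξ‖⁻¹ * (1 + ‖ξ‖)⁻¹ * ((1 + ‖ξ‖) * ‖F ξ‖) := by field_simp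
    _ ≤ _ := by gcongr

theorem fourierInv_ofReal (φ : R3 → ℝ) (x : R3) :
    𝓕⁻ (fun y => (φ y : ℂ)) x = conj (𝓕 (fun y => (φ y : ℂ)) x) := by
  rw [Real.fourierInv_eq, Real.fourier_eq, ← integral_conj]
  congr 1
  funext y
  simp only [Circle.smul_def, smul_eq_mul, map_mul, Complex.conj_ofReal]
  rw [← Circle.coe_inv_eq_conj, ← AddChar.map_neg_eq_inv, neg_neg]

theorem exists_bounded_velocity {S : R3 → Mat3} (hS : MemLqMat 2 S)
    {DS : Fin 3 → R3 → Mat3} (hDS : ∀ k, MemLqMat 2 (DS k)) (hw : IsWeakGradient S DS) :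
    ∃ u : R3 → R3, IsVelocity S u ∧ (∀ j, Continuous fun x => u x j) ∧ ∃ C, ∀ x j, |u x j| ≤ C := by
  have hd : ∀ i j k, MemLp (fun ξ => sym k ξ * L2F (fun x => S x i j) ξ) 2 volume := fun i j k =>
    (memLp_L2F _).ae_eq (L2F_weak_derivative (hS i j) (hDS k i j) fun φ hφ =>
      (hw k i j).2 φ hφ)
  have hI : ∀ i j, Integrable fun ξ => nsym i ξ * L2F (fun x => S x i j) ξ := fun i j =>
    integrable_nsym_mul (memLp_L2F _) (hd i j) i
  set h : Fin 3 → R3 → ℂ := fun j ξ => -2 * ∑ i, nsym i ξ * L2F (fun x => S x i j) ξ with hh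
  have hh1 : ∀ j, Integrable (h j) := fun j => (integrable_finsetSum _ fun i _ => hI i j).const_mul _
  have hcont : ∀ j, Continuous fun x => (𝓕⁻ (h j) x).re := fun j =>
    Complex.continuous_re.comp (continuous_fourierInv (hh1 j))
  -- Taking real parts avoids proving that the inverse transform is real: only pairings with real
  -- test functions are compared.
  refine ⟨fun x => WithLp.toLp 2 fun j => (𝓕⁻ (h j) x).re, fun j => ⟨(hcont j).locallyIntegrable,
    fun φ hφ => ?_⟩, hcont, ∑ j, ∫ ξ, ‖h j ξ‖, fun x j => ?_⟩
  · have h1 : ∀ i, ∫ x, S x i j * invLaplacian (pd i φ) x =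
        (∫ ξ, conj (-nsym i ξ * L2F (fun x => S x i j) ξ * conj (ftest φ ξ))).re := by
      intro i
      rw [parseval (hS i j) (invLaplacian_pd_spec hφ i).1]
      refine congrArg Complex.re (integral_congr_ae ?_)
      filter_upwards [(invLaplacian_pd_spec hφ i).2.1, L2F_test hφ] with ξ a b
      rw [a, b, map_mul, map_mul, map_neg, conj_nsym, Complex.conj_conj, ftest]
      ring
    have hbd : ∃ C, ∀ ξ, ‖conj (ftest φ ξ)‖ ≤ C := by
      obtain ⟨C, hC⟩ := (⟨_, fun ξ => (𝓕 hφ.toSchwartz).toBoundedContinuousFunction.norm_coe_le_norm ξ⟩ :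
        ∃ C, ∀ ξ, ‖𝓕 hφ.toSchwartz ξ‖ ≤ C)
      exact ⟨C, fun ξ => by rw [RCLike.norm_conj]; exact hC ξ⟩
    obtain ⟨C, hC⟩ := hbd
    have hfm : AEStronglyMeasurable (fun ξ => conj (ftest φ ξ)) volume :=
      Complex.continuous_conj.comp_aestronglyMeasurable hφ.ftest_memLp.aestronglyMeasurable
    have h2 : ∀ i, Integrable fun ξ => -nsym i ξ * L2F (fun x => S x i j) ξ * conj (ftest φ ξ) := by
      intro i
      have : Integrable fun ξ => -nsym i ξ * L2F (fun x => S x i j) ξ := by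
        refine (hI i j).neg.congr (Eventually.of_forall fun ξ => ?_)
        simp only [Pi.neg_apply, neg_mul]
      exact this.mul_bdd hfm (Eventually.of_forall hC)
    have h3 : ∀ i, ∫ x, S x i j * invLaplacian (pd i φ) x =
        (∫ ξ, -nsym i ξ * L2F (fun x => S x i j) ξ * conj (ftest φ ξ)).re := fun i => by
      rw [h1, integral_conj, Complex.conj_re]
    have h4 : ∫ x, (𝓕⁻ (h j) x).re * φ x = (∫ x, 𝓕⁻ (h j) x * (φ x : ℂ)).re := by
      have hb : Integrable fun x => 𝓕⁻ (h j) x * (φ x : ℂ) :=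
        hφ.integrable.ofReal.bdd_mul (continuous_fourierInv (hh1 j)).aestronglyMeasurable
          (Eventually.of_forall (norm_fourierInv_le (h j)))
      rw [← RCLike.re_eq_complex_re, ← integral_re hb]
      congr 1
      funext x
      simp
    change ∫ x, (𝓕⁻ (h j) x).re * φ x = _
    have hφc : Integrable fun x => (φ x : ℂ) := hφ.integrable.ofReal
    rw [h4, integral_fourierInv_mul (hh1 j) hφc, velocity]
    simp only [h3]
    rw [← Complex.re_sum, ← integral_finsetSum _ fun i _ => h2 i, ← Complex.re_ofReal_mul,
      ← integral_const_mul]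
    congr 2
    funext ξ
    rw [fourierInv_ofReal, hh, ← Finset.sum_mul]
    change _ * conj (ftest φ ξ) = _
    simp only [neg_mul, Finset.sum_neg_distrib]
    push_cast
    ring
  · refine (Complex.abs_re_le_norm _).trans ((norm_fourierInv_le (h j) x).trans ?_)
    exact Finset.single_le_sum (f := fun j => ∫ ξ, ‖h j ξ‖)
      (fun j _ => integral_nonneg fun ξ => norm_nonneg _) (Finset.mem_univ j)

/-! ### Orthogonality in finite products of `L²` -/

section products

variable {ι : Type} [Fintype ι]

/-- Finite families of real square integrable functions. -/
abbrev L2Family (ι : Type) [Fintype ι] : Type :=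
  PiLp 2 fun _ : ι => Lp ℝ 2 (volume : Measure R3)

/-- The element of the Hilbert space given by a family of functions. -/
def toFamily (F : ι → R3 → ℝ) (hF : ∀ i, MemLp (F i) 2 volume) : L2Family ι :=
  WithLp.toLp 2 fun i => (hF i).toLp (F i)

theorem inner_toFamily {F G : ι → R3 → ℝ} (hF : ∀ i, MemLp (F i) 2 volume)
    (hG : ∀ i, MemLp (G i) 2 volume) :
    inner ℝ (toFamily F hF) (toFamily G hG) = ∑ i, ∫ x, F i x * G i x := by
  rw [PiLp.inner_apply]
  refine Finset.sum_congr rfl fun i _ => ?_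
  rw [L2.inner_def]
  refine integral_congr_ae ?_
  simp only [toFamily]
  filter_upwards [(hF i).coeFn_toLp, (hG i).coeFn_toLp] with x a b
  rw [a, b, real_inner_eq_re_inner ℝ, RCLike.inner_apply]
  simp [mul_comm]

theorem exists_toFamily (x : L2Family ι) :
    ∃ (F : ι → R3 → ℝ) (hF : ∀ i, MemLp (F i) 2 volume), x = toFamily F hF := by
  refine ⟨fun i => (x i : R3 → ℝ), fun i => Lp.memLp (x i), ?_⟩
  ext1 i
  exact (Lp.toLp_coeFn (x i) (Lp.memLp (x i))).symm

theorem toFamily_sub {F G : ι → R3 → ℝ} (hF : ∀ i, MemLp (F i) 2 volume)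
    (hG : ∀ i, MemLp (G i) 2 volume) :
    toFamily F hF - toFamily G hG =
      toFamily (fun i x => F i x - G i x) (fun i => (hF i).sub (hG i)) := by
  ext1 i
  exact ((hF i).toLp_sub (hG i)).symm

/-- Orthogonal projection onto the orthogonal complement of a set of families. -/
theorem exists_orthogonal_decomposition (D : Set (ι → R3 → ℝ))
    (hD : ∀ d ∈ D, ∀ i, MemLp (d i) 2 volume) {F : ι → R3 → ℝ} (hF : ∀ i, MemLp (F i) 2 volume) :
    ∃ P : ι → R3 → ℝ, (∀ i, MemLp (P i) 2 volume) ∧ (∀ d ∈ D, ∑ i, ∫ x, P i x * d i x = 0) ∧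
      ∀ M : ι → R3 → ℝ, (∀ i, MemLp (M i) 2 volume) → (∀ d ∈ D, ∑ i, ∫ x, M i x * d i x = 0) →
        ∑ i, ∫ x, (F i x - P i x) * M i x = 0 := by
  set K : Submodule ℝ (L2Family ι) :=
    (Submodule.span ℝ {y | ∃ (d : ι → R3 → ℝ) (h : d ∈ D), y = toFamily d (hD d h)})ᗮ with hK
  have hmem : ∀ (M : ι → R3 → ℝ) (hM : ∀ i, MemLp (M i) 2 volume),
      toFamily M hM ∈ K ↔ ∀ d ∈ D, ∑ i, ∫ x, M i x * d i x = 0 := by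
    intro M hM
    rw [hK, Submodule.mem_orthogonal']
    constructor
    · intro h d hd
      rw [← inner_toFamily hM (hD d hd)]
      exact h _ (Submodule.subset_span ⟨d, hd, rfl⟩)
    · intro h y hy
      induction hy using Submodule.span_induction with
      | mem y hy =>
        obtain ⟨d, hd, rfl⟩ := hy
        rw [inner_toFamily]; exact h d hd
      | zero => simp
      | add a b _ _ ha hb => rw [inner_add_right, ha, hb, add_zero]
      | smul c a _ ha => rw [inner_smul_right, ha, mul_zero]
  have : CompleteSpace K := (Submodule.isClosed_orthogonal _).completeSpace_coe
  have : K.HasOrthogonalProjection := Submodule.HasOrthogonalProjection.ofCompleteSpace K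
  obtain ⟨y, hy, z, hz, hyz⟩ := K.exists_add_mem_mem_orthogonal (toFamily F hF)
  obtain ⟨P, hP, rfl⟩ := exists_toFamily y
  refine ⟨P, hP, (hmem P hP).1 hy, fun M hM h => ?_⟩
  rw [← inner_toFamily (F := fun i x => F i x - P i x) (fun i => (hF i).sub (hP i)) hM,
    ← toFamily_sub hF hP, hyz, add_sub_cancel_left]
  exact (Submodule.mem_orthogonal' _ _).1 hz _ ((hmem M hM).2 h)

/-- In a Hilbert space the double orthogonal complement of a subspace is its closure, so density can
be proved by a duality test. -/
theorem exists_seq_of_orthogonal (D : Set (ι → R3 → ℝ)) (hD0 : (fun _ _ => 0) ∈ D)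
    (hDadd : ∀ d ∈ D, ∀ e ∈ D, (fun i x => d i x + e i x) ∈ D)
    (hDsmul : ∀ c : ℝ, ∀ d ∈ D, (fun i x => c * d i x) ∈ D)
    (hD : ∀ d ∈ D, ∀ i, MemLp (d i) 2 volume) {F : ι → R3 → ℝ} (hF : ∀ i, MemLp (F i) 2 volume)
    (horth : ∀ M : ι → R3 → ℝ, (∀ i, MemLp (M i) 2 volume) →
      (∀ d ∈ D, ∑ i, ∫ x, M i x * d i x = 0) → ∑ i, ∫ x, F i x * M i x = 0) :
    ∃ d : ℕ → ι → R3 → ℝ, (∀ n, d n ∈ D) ∧ ∀ i, LpTendsto 2 (fun n => d n i) (F i) := by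
  let K : Submodule ℝ (L2Family ι) :=
    { carrier := {y | ∃ (d : ι → R3 → ℝ) (h : d ∈ D), y = toFamily d (hD d h)}
      zero_mem' := ⟨_, hD0, by ext1 i; exact (MemLp.toLp_zero (hD _ hD0 i)).symm⟩
      add_mem' := by
        rintro _ _ ⟨d, hd, rfl⟩ ⟨e, he, rfl⟩
        exact ⟨_, hDadd d hd e he, by ext1 i; exact (MemLp.toLp_add (hD d hd i) (hD e he i)).symm⟩
      smul_mem' := by
        rintro c _ ⟨d, hd, rfl⟩
        exact ⟨_, hDsmul c d hd, by ext1 i; exact (MemLp.toLp_const_smul c (hD d hd i)).symm⟩ }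
  have hFK : toFamily F hF ∈ K.topologicalClosure := by
    rw [← Submodule.orthogonal_orthogonal_eq_closure, Submodule.mem_orthogonal']
    intro y hy
    obtain ⟨M, hM, rfl⟩ := exists_toFamily y
    rw [inner_toFamily]
    refine horth M hM fun d hd => ?_
    rw [← inner_toFamily hM (hD d hd)]
    exact (Submodule.mem_orthogonal' _ _).1 hy _ ⟨d, hd, rfl⟩
  obtain ⟨y, hy, hlim⟩ := mem_closure_iff_seq_limit.1 hFK
  choose d hd hdy using hy
  refine ⟨d, hd, fun i => ⟨fun n => hD _ (hd n) i, hF i, ?_⟩⟩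
  have h1 : Tendsto (fun n => (y n) i) atTop (𝓝 ((toFamily F hF) i)) :=
    ((PiLp.continuous_apply 2 (fun _ : ι => Lp ℝ 2 (volume : Measure R3)) i).tendsto _).comp hlim
  have h2 : (fun n => (y n) i) = fun n => (hD _ (hd n) i).toLp (d n i) := by
    funext n
    rw [hdy n]; rfl
  rw [h2] at h1
  exact (Lp.tendsto_Lp_iff_tendsto_eLpNorm'' (fun n => d n i) (fun n => hD _ (hd n) i) (F i)
    (hF i)).1 h1

end products

/-! ### Density of test functions in `H¹` and the Sobolev embedding -/

/-- A family (M_0, M_k) orthogonal to all jets (φ, ∂_k φ) satisfies M̂_0 = ∑ 2πi ξ_k M̂_k. By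
Parseval it is then orthogonal to (f, ∇f) too, so the jets are dense. -/
theorem exists_test_tendsto_sobolev {f : R3 → ℝ} {g : Fin 3 → R3 → ℝ} (hf : MemLp f 2 volume)
    (hg : ∀ k, MemLp (g k) 2 volume)
    (h : ∀ k φ, IsTest φ → ∫ x, g k x * φ x = -∫ x, f x * pd k φ x) :
    ∃ φ : ℕ → R3 → ℝ, (∀ n, IsTest (φ n)) ∧ LpTendsto 2 φ f ∧
      ∀ k, LpTendsto 2 (fun n => pd k (φ n)) (g k) := by
  let jet : (R3 → ℝ) → Option (Fin 3) → R3 → ℝ := fun φ o => o.elim φ fun k => pd k φ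
  obtain ⟨d, hd, hlim⟩ := exists_seq_of_orthogonal (ι := Option (Fin 3))
    {d | ∃ φ, IsTest φ ∧ d = jet φ}
    ⟨fun _ => 0, IsTest.zero, by
      funext o x
      cases o with
      | none => rfl
      | some k => simp [jet, pd]⟩
    (by
      rintro _ ⟨φ, hφ, rfl⟩ _ ⟨ψ, hψ, rfl⟩
      refine ⟨_, hφ.add hψ, ?_⟩
      funext o
      cases o with
      | none => rfl
      | some k => exact (pd_add hφ.differentiable hψ.differentiable k).symm)
    (by
      rintro c _ ⟨φ, hφ, rfl⟩
      refine ⟨_, hφ.const_mul c, ?_⟩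
      funext o
      cases o with
      | none => rfl
      | some k => exact (pd_const_mul hφ.differentiable c k).symm)
    (by
      rintro _ ⟨φ, hφ, rfl⟩ o
      cases o with
      | none => exact hφ.memLp 2
      | some k => exact (hφ.pd k).memLp 2)
    (F := fun o => o.elim f g)
    (fun o => by
      cases o with
      | none => exact hf
      | some k => exact hg k)
    (fun M hM hMD => by
      have hW := L2F_of_weak_identity (hM none) (fun k => hM (some k)) (fun φ hφ => by
        have := hMD _ ⟨φ, hφ, rfl⟩
        rwa [Fintype.sum_option] at this)
      have hgF := fun k => L2F_weak_derivative hf (hg k) (h k)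
      rw [Fintype.sum_option]
      simp only [Option.elim]
      rw [parseval hf (hM none)]
      have e : ∀ k, ∫ x, g k x * M (some k) x =
          (∫ ξ, conj (L2F (g k) ξ) * L2F (M (some k)) ξ).re := fun k => parseval (hg k) (hM (some k))
      simp only [e]
      have hI : ∀ k, Integrable fun ξ => conj (L2F (g k) ξ) * L2F (M (some k)) ξ := fun k =>
        (memLp_L2F (g k)).star.integrable_mul (memLp_L2F (M (some k)))
      have hI0 : Integrable fun ξ => conj (L2F f ξ) * L2F (M none) ξ :=
        (memLp_L2F f).star.integrable_mul (memLp_L2F (M none))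
      rw [← Complex.re_sum, ← integral_finsetSum _ fun k _ => hI k, ← Complex.add_re,
        ← integral_add hI0 (integrable_finsetSum _ fun k _ => hI k)]
      rw [← Complex.zero_re]
      refine congrArg Complex.re (integral_eq_zero_of_ae ?_)
      filter_upwards [hW, ae_all_iff.2 hgF] with ξ a b
      simp only [a, b, map_mul, conj_sym, Pi.zero_apply, Finset.mul_sum]
      rw [← Finset.sum_add_distrib]
      refine Finset.sum_eq_zero fun k _ => ?_
      ring)
  choose φ hφ hdφ using hd
  refine ⟨φ, hφ, (hlim none).congr fun n => ?_, fun k => (hlim (some k)).congr fun n => ?_⟩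
  · rw [hdφ n]; rfl
  · rw [hdφ n]; rfl

theorem norm_fderiv_le_sum_pd (φ : R3 → ℝ) (x : R3) : ‖fderiv ℝ φ x‖ ≤ ∑ k, ‖pd k φ x‖ := by
  refine ContinuousLinearMap.opNorm_le_bound _ (by positivity) fun v => ?_
  have hv : v = ∑ k, v k • EuclideanSpace.single k (1 : ℝ) := by
    ext l
    simp [Fin.sum_univ_three]
    fin_cases l <;> simp
  have e : fderiv ℝ φ x v = ∑ k, v k * pd k φ x := by
    conv_lhs => rw [hv]
    simp [pd]
  rw [e, Finset.sum_mul]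
  refine (norm_sum_le _ _).trans (Finset.sum_le_sum fun k _ => ?_)
  rw [norm_mul, mul_comm]
  exact mul_le_mul_of_nonneg_left (PiLp.norm_apply_le v k) (norm_nonneg _)

/-- The Gagliardo–Nirenberg–Sobolev inequality bounds the test function approximants in L⁶; Fatou
along an almost everywhere convergent subsequence passes the bound to `f`. -/
theorem memLp_six_of_weak_gradient {f : R3 → ℝ} {g : Fin 3 → R3 → ℝ} (hf : MemLp f 2 volume)
    (hg : ∀ k, MemLp (g k) 2 volume)
    (h : ∀ k φ, IsTest φ → ∫ x, g k x * φ x = -∫ x, f x * pd k φ x) : MemLp f 6 volume := by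
  obtain ⟨φ, hφ, hφf, hφg⟩ := exists_test_tendsto_sobolev hf hg h
  obtain ⟨ns, hns, hae⟩ := (tendstoInMeasure_of_tendsto_eLpNorm (p := 2) (by norm_num)
    (fun n => (hφf.mem n).aestronglyMeasurable) hf.aestronglyMeasurable
    hφf.tendsto).exists_seq_tendsto_ae
  set C := SNormLESNormFDerivOfEqConst ℝ (volume : Measure R3) 2 with hC
  have hbd : ∀ k, ∀ᶠ n in atTop, eLpNorm (pd k (φ n)) 2 volume ≤ 1 + eLpNorm (g k) 2 volume := by
    intro k
    filter_upwards [(hφg k).tendsto.eventually_le_const (show (0 : ℝ≥0∞) < 1 by norm_num)] with n hn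
    have e : pd k (φ n) = (fun x => pd k (φ n) x - g k x) + g k := by
      funext x; simp
    rw [e]
    exact (eLpNorm_add_le (((hφg k).mem n).sub (hg k)).aestronglyMeasurable
      (hg k).aestronglyMeasurable (by norm_num)).trans (add_le_add hn le_rfl)
  have hmain : ∀ᶠ n in atTop, eLpNorm (φ n) 6 volume ≤
      C * ∑ k, (1 + eLpNorm (g k) 2 volume) := by
    filter_upwards [eventually_all.2 hbd] with n hn
    have h1 := eLpNorm_le_eLpNorm_fderiv_of_eq (volume : Measure R3) (u := φ n) (p := 2) (p' := 6)
      ((hφ n).1.of_le (by exact_mod_cast le_top)) (hφ n).2 (by norm_num) (by simp)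
      (by simp; norm_num)
    refine le_trans h1 (mul_le_mul' (le_of_eq rfl) ?_)
    have h2 : eLpNorm (fderiv ℝ (φ n)) 2 volume ≤
        eLpNorm (∑ k, fun x => ‖pd k (φ n) x‖) 2 volume := by
      refine eLpNorm_mono_real fun x => ?_
      simpa using norm_fderiv_le_sum_pd (φ n) x
    refine h2.trans ((eLpNorm_sum_le (fun k _ => ((hφg k).mem n).norm.aestronglyMeasurable)
      (by norm_num)).trans (Finset.sum_le_sum fun k _ => ?_))
    rw [eLpNorm_norm]
    exact hn k
  refine ⟨hf.aestronglyMeasurable, lt_of_le_of_lt (Lp.eLpNorm_le_of_ae_tendsto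
    (hns.tendsto_atTop.eventually hmain) (fun n => (hφf.mem (ns n)).aestronglyMeasurable) hae) ?_⟩
  refine ENNReal.mul_lt_top ENNReal.coe_lt_top (ENNReal.sum_lt_top.2 fun k _ => ?_)
  exact ENNReal.add_lt_top.2 ⟨by norm_num, (hg k).eLpNorm_lt_top⟩

theorem memLp_iff_integrable_pow {f : R3 → ℝ} (hf : AEStronglyMeasurable f volume) (n : ℕ)
    [n.AtLeastTwo] : MemLp f (OfNat.ofNat n) volume ↔ Integrable fun x => |f x| ^ n := by
  have h0 : (OfNat.ofNat n : ℝ≥0∞) ≠ 0 := NeZero.ne _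
  rw [← integrable_norm_rpow_iff hf h0 (by simp)]
  simp only [ENNReal.toReal_ofNat, Real.norm_eq_abs, Real.rpow_ofNat]
  rfl

theorem MeasureTheory.MemLp.of_two_six {f : R3 → ℝ} (h2 : MemLp f 2 volume) (h6 : MemLp f 6 volume)
    (n : ℕ) [n.AtLeastTwo] (hn : n ≤ 6) : MemLp f (OfNat.ofNat n) volume := by
  have hm := h2.aestronglyMeasurable
  have h2' := (memLp_iff_integrable_pow hm 2).1 h2
  have h6' := (memLp_iff_integrable_pow hm 6).1 h6
  rw [memLp_iff_integrable_pow hm n]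
  refine (h2'.add h6').mono' ((continuous_abs.comp_aestronglyMeasurable hm).pow n)
    (Eventually.of_forall fun x => ?_)
  rw [Real.norm_of_nonneg (by positivity)]
  simp only [Pi.add_apply]
  have hn2 : 2 ≤ n := Nat.AtLeastTwo.prop
  rcases le_total |f x| 1 with h | h
  · have := pow_le_pow_of_le_one (abs_nonneg (f x)) h hn2
    have : 0 ≤ |f x| ^ 6 := by positivity
    linarith
  · have := pow_le_pow_right₀ h hn
    have : 0 ≤ |f x| ^ 2 := by positivity
    linarith

/-! ### The orthogonal projection onto `L²_st` -/

theorem integral_frob {A B : R3 → Mat3} (hA : MemLqMat 2 A) (hB : MemLqMat 2 B) :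
    Integrable (fun x => frob (A x) (B x)) ∧
      ∫ x, frob (A x) (B x) = ∑ p : Fin 3 × Fin 3, ∫ x, A x p.1 p.2 * B x p.1 p.2 := by
  have h : ∀ i j, Integrable fun x => A x i j * B x i j := fun i j =>
    (hA i j).integrable_mul_two (hB i j)
  have h' : ∀ i, Integrable fun x => ∑ j, A x i j * B x i j := fun i =>
    integrable_finsetSum _ fun j _ => h i j
  refine ⟨integrable_finsetSum _ fun i _ => h' i, ?_⟩
  simp only [frob]
  rw [integral_finsetSum _ fun i _ => h' i, Fintype.sum_prod_type]
  exact Finset.sum_congr rfl fun i _ => integral_finsetSum _ fun j _ => h i j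

/-- The family with the single entry `φ` at `p`. -/
def entryFamily (p : Fin 3 × Fin 3) (φ : R3 → ℝ) (q : Fin 3 × Fin 3) : R3 → ℝ :=
  if q = p then φ else 0

/-- The family with `∂_i ∂_k (-Δ)⁻¹ φ` at the entries `(k, j)`. -/
def rieszFamily (i j : Fin 3) (φ : R3 → ℝ) (q : Fin 3 × Fin 3) : R3 → ℝ :=
  if q.2 = j then riesz i q.1 φ else 0

theorem memLp_entryFamily {φ : R3 → ℝ} (hφ : IsTest φ) (p q : Fin 3 × Fin 3) :
    MemLp (entryFamily p φ q) 2 volume := by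
  unfold entryFamily
  split_ifs
  · exact hφ.memLp 2
  · exact MemLp.zero

theorem memLp_rieszFamily {φ : R3 → ℝ} (hφ : IsTest φ) (i j : Fin 3) (q : Fin 3 × Fin 3) :
    MemLp (rieszFamily i j φ q) 2 volume := by
  unfold rieszFamily
  split_ifs
  · exact hφ.riesz_memLp _ _
  · exact MemLp.zero

theorem sum_integral_entryFamily (M : R3 → Mat3) (p : Fin 3 × Fin 3) (φ : R3 → ℝ) :
    ∑ q : Fin 3 × Fin 3, ∫ x, M x q.1 q.2 * entryFamily p φ q x = ∫ x, M x p.1 p.2 * φ x := by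
  rw [Finset.sum_eq_single p]
  · simp [entryFamily]
  · intro q _ hq
    simp [entryFamily, hq]
  · simp

theorem sum_integral_rieszFamily (M : R3 → Mat3) (i j : Fin 3) (φ : R3 → ℝ) :
    ∑ q : Fin 3 × Fin 3, ∫ x, M x q.1 q.2 * rieszFamily i j φ q x =
      ∑ k, ∫ x, M x k j * riesz i k φ x := by
  rw [Fintype.sum_prod_type]
  refine Finset.sum_congr rfl fun k _ => ?_
  rw [Finset.sum_eq_single j]
  · simp [rieszFamily]
  · intro q _ hq
    simp [rieszFamily, hq]
  · simp

theorem sum_integral_mul_add {ι : Type} [Fintype ι] {M d e : ι → R3 → ℝ}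
    (hM : ∀ i, MemLp (M i) 2 volume) (hd : ∀ i, MemLp (d i) 2 volume)
    (he : ∀ i, MemLp (e i) 2 volume) :
    ∑ i, ∫ x, M i x * (d i x + e i x) = (∑ i, ∫ x, M i x * d i x) + ∑ i, ∫ x, M i x * e i x := by
  rw [← Finset.sum_add_distrib]
  refine Finset.sum_congr rfl fun i _ => ?_
  simp only [mul_add]
  exact integral_add ((hM i).integrable_mul_two (hd i)) ((hM i).integrable_mul_two (he i))

/-- The families orthogonal to `L²_st` that define it. -/
def strainConstraints : Set (Fin 3 × Fin 3 → R3 → ℝ) :=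
  {d | ∃ φ, IsTest φ ∧ ((∃ i j, d = fun q x => entryFamily (i, j) φ q x +
      entryFamily (j, i) (fun x => -1 * φ x) q x) ∨
    (d = fun q x => entryFamily (0, 0) φ q x + (entryFamily (1, 1) φ q x + entryFamily (2, 2) φ q x)) ∨
    ∃ i j, d = fun q x => entryFamily (i, j) φ q x +
      (rieszFamily i j φ q x + rieszFamily j i φ q x))}

theorem memLp_of_mem_strainConstraints {d : Fin 3 × Fin 3 → R3 → ℝ} (hd : d ∈ strainConstraints)
    (q : Fin 3 × Fin 3) : MemLp (d q) 2 volume := by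
  obtain ⟨φ, hφ, ⟨i, j, rfl⟩ | rfl | ⟨i, j, rfl⟩⟩ := hd
  · exact (memLp_entryFamily hφ _ q).add (memLp_entryFamily (hφ.const_mul _) _ q)
  · exact (memLp_entryFamily hφ _ q).add ((memLp_entryFamily hφ _ q).add (memLp_entryFamily hφ _ q))
  · exact (memLp_entryFamily hφ _ q).add ((memLp_rieszFamily hφ _ _ q).add (memLp_rieszFamily hφ _ _ q))

/-- Each defining condition is a family of linear equations against test functions. In the last one
the operator is moved onto the test function, whose Riesz transforms lie in L²; this makes L²_st an
orthogonal complement. -/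
theorem memLqSt_two_iff {M : R3 → Mat3} (hM : MemLqMat 2 M) :
    MemLqSt 2 M ↔ ∀ d ∈ strainConstraints,
      ∑ q : Fin 3 × Fin 3, ∫ x, M x q.1 q.2 * d q x = 0 := by
  have hM' : ∀ q : Fin 3 × Fin 3, MemLp (fun x => M x q.1 q.2) 2 volume := fun q => hM q.1 q.2
  have e1 : ∀ i j φ, IsTest φ → ∑ q : Fin 3 × Fin 3, ∫ x, M x q.1 q.2 *
      (entryFamily (i, j) φ q x + entryFamily (j, i) (fun x => -1 * φ x) q x) =
      (∫ x, M x i j * φ x) - ∫ x, M x j i * φ x := by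
    intro i j φ hφ
    rw [sum_integral_mul_add hM' (memLp_entryFamily hφ _) (memLp_entryFamily (hφ.const_mul _) _),
      sum_integral_entryFamily, sum_integral_entryFamily]
    simp only [mul_left_comm _ (-1 : ℝ), integral_const_mul]
    ring
  have e2 : ∀ φ, IsTest φ → ∑ q : Fin 3 × Fin 3, ∫ x, M x q.1 q.2 *
      (entryFamily (0, 0) φ q x + (entryFamily (1, 1) φ q x + entryFamily (2, 2) φ q x)) =
      ∫ x, (M x).trace * φ x := by
    intro φ hφ
    rw [sum_integral_mul_add hM' (memLp_entryFamily hφ _)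
        (e := fun q x => entryFamily (1, 1) φ q x + entryFamily (2, 2) φ q x)
        (fun q => (memLp_entryFamily hφ _ q).add (memLp_entryFamily hφ _ q)),
      sum_integral_mul_add hM' (memLp_entryFamily hφ _) (memLp_entryFamily hφ _),
      sum_integral_entryFamily, sum_integral_entryFamily, sum_integral_entryFamily]
    have hi : ∀ i, Integrable fun x => M x i i * φ x := fun i =>
      (hM i i).integrable_mul_two (hφ.memLp 2)
    simp only [Matrix.trace, Matrix.diag, Finset.sum_mul]
    rw [integral_finsetSum _ fun i _ => hi i, Fin.sum_univ_three, add_assoc]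
  have e3 : ∀ i j φ, IsTest φ → ∑ q : Fin 3 × Fin 3, ∫ x, M x q.1 q.2 *
      (entryFamily (i, j) φ q x + (rieszFamily i j φ q x + rieszFamily j i φ q x)) =
      (∫ x, M x i j * φ x) - distSymGrad (velocity M) i j φ := by
    intro i j φ hφ
    rw [sum_integral_mul_add hM' (memLp_entryFamily hφ _)
        (e := fun q x => rieszFamily i j φ q x + rieszFamily j i φ q x)
        (fun q => (memLp_rieszFamily hφ _ _ q).add (memLp_rieszFamily hφ _ _ q)),
      sum_integral_mul_add hM' (memLp_rieszFamily hφ _ _) (memLp_rieszFamily hφ _ _),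
      sum_integral_entryFamily, sum_integral_rieszFamily, sum_integral_rieszFamily]
    simp only [distSymGrad, distDeriv, velocity, riesz]
    ring
  have hl : ∀ i j, LocallyIntegrable fun x => M x i j := fun i j =>
    locallyIntegrable_of_memLp_two (hM i j)
  constructor
  · rintro ⟨-, hs, ht, hr⟩ d ⟨φ, hφ, ⟨i, j, rfl⟩ | rfl | ⟨i, j, rfl⟩⟩
    · rw [e1 i j φ hφ, sub_eq_zero]
      refine integral_congr_ae ?_
      filter_upwards [hs] with x hx
      rw [hx.apply i j]
    · rw [e2 φ hφ]
      refine integral_eq_zero_of_ae ?_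
      filter_upwards [ht] with x hx
      rw [hx, zero_mul]; rfl
    · rw [e3 i j φ hφ, (hr i j).2 φ hφ, sub_self]
  · intro h
    refine ⟨hM, ?_, ?_, fun i j => ⟨hl i j, fun φ hφ => ?_⟩⟩
    · have : ∀ i j, (fun x => M x j i) =ᵐ[volume] fun x => M x i j := fun i j =>
        ae_eq_of_forall_test (hl j i) (hl i j) fun φ hφ => by
          have := h _ ⟨φ, hφ, Or.inl ⟨j, i, rfl⟩⟩
          rw [e1 j i φ hφ] at this
          exact sub_eq_zero.1 this
      filter_upwards [ae_all_iff.2 fun i => ae_all_iff.2 (this i)] with x hx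
      exact Matrix.IsSymm.ext hx
    · have : (fun x => (M x).trace) =ᵐ[volume] fun _ => 0 :=
        ae_eq_of_forall_test (locallyIntegrable_of_memLp_two
          (memLp_finsetSum Finset.univ fun i _ => hM i i)) (locallyIntegrable_const 0) fun φ hφ => by
          have := h _ ⟨φ, hφ, Or.inr (Or.inl rfl)⟩
          rw [e2 φ hφ] at this
          simpa using this
      exact this
    · have := h _ ⟨φ, hφ, Or.inr (Or.inr ⟨i, j, rfl⟩)⟩
      rw [e3 i j φ hφ] at this
      exact sub_eq_zero.1 this

theorem exists_isStrainProjection {F : R3 → Mat3} (hF : MemLqMat 2 F) :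
    ∃ P, IsStrainProjection F P := by
  obtain ⟨P, hP, hPD, hPM⟩ := exists_orthogonal_decomposition strainConstraints
    (fun d hd q => memLp_of_mem_strainConstraints hd q)
    (F := fun q x => F x q.1 q.2) (fun q => hF q.1 q.2)
  have hP2 : MemLqMat 2 fun x => Matrix.of fun i j => P (i, j) x := fun i j => hP (i, j)
  refine ⟨fun x => Matrix.of fun i j => P (i, j) x, (memLqSt_two_iff hP2).2 hPD, fun M hM => ?_⟩
  have hD2 : MemLqMat 2 fun x => F x - Matrix.of fun i j => P (i, j) x := fun i j =>
    (hF i j).sub (hP2 i j)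
  rw [(integral_frob hD2 hM.1).2]
  exact hPM (fun q x => M x q.1 q.2) (fun q => hM.1 q.1 q.2) ((memLqSt_two_iff hM.1).1 hM)

/-! ### The transport term and the dropped term -/

instance holderTriple_four_four : ENNReal.HolderTriple 4 4 2 where
  inv_add_inv_eq_inv := by
    rw [← two_mul, show (4 : ℝ≥0∞) = 2 * 2 by norm_num,
      ENNReal.mul_inv (Or.inl (by norm_num)) (Or.inl (by norm_num)), ← mul_assoc,
      ENNReal.mul_inv_cancel (by norm_num) (by norm_num), one_mul]

theorem LpTendsto.bdd_mul {p : ℝ≥0∞} {f : ℕ → R3 → ℝ} {s u : R3 → ℝ} (hf : LpTendsto p f s)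
    (hu : Continuous u) {C : ℝ} (hC : ∀ x, |u x| ≤ C) :
    LpTendsto p (fun n x => u x * f n x) (fun x => u x * s x) := by
  have hle : ∀ g : R3 → ℝ, eLpNorm (fun x => u x * g x) p volume ≤
      ENNReal.ofReal C * eLpNorm g p volume := fun g =>
    eLpNorm_le_mul_eLpNorm_of_ae_le_mul (Eventually.of_forall fun x => by
      rw [norm_mul]
      exact mul_le_mul_of_nonneg_right (hC x) (norm_nonneg _)) p
  have hm : ∀ {g : R3 → ℝ}, MemLp g p volume → MemLp (fun x => u x * g x) p volume := fun hg =>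
    ⟨hu.aestronglyMeasurable.mul hg.aestronglyMeasurable,
      (hle _).trans_lt (ENNReal.mul_lt_top ENNReal.ofReal_lt_top hg.eLpNorm_lt_top)⟩
  refine ⟨fun n => hm (hf.mem n), hm hf.lim, ?_⟩
  refine tendsto_of_tendsto_of_tendsto_of_le_of_le tendsto_const_nhds (by
    simpa using ENNReal.Tendsto.const_mul (a := ENNReal.ofReal C) hf.tendsto
      (Or.inr ENNReal.ofReal_ne_top)) (fun _ => zero_le) fun n => ?_
  refine le_trans (le_of_eq ?_) (hle _)
  congr 1
  funext x
  ring

/-- Transport by a bounded divergence free field is skew in `H¹`. -/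
theorem sum_integral_transport_eq_zero {u : Fin 3 → R3 → ℝ} (hu : ∀ k, Continuous (u k)) {C : ℝ}
    (hC : ∀ k x, |u k x| ≤ C) (hdiv : ∀ φ, IsTest φ → ∑ k, ∫ x, u k x * pd k φ x = 0)
    {f : R3 → ℝ} {g : Fin 3 → R3 → ℝ} (hf : MemLp f 2 volume) (hg : ∀ k, MemLp (g k) 2 volume)
    (h : ∀ k φ, IsTest φ → ∫ x, g k x * φ x = -∫ x, f x * pd k φ x) :
    ∑ k, ∫ x, u k x * g k x * f x = 0 := by
  obtain ⟨φ, hφ, hφf, hφg⟩ := exists_test_tendsto_sobolev hf hg h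
  have hlim : Tendsto (fun n => ∑ k, ∫ x, u k x * pd k (φ n) x * φ n x) atTop
      (𝓝 (∑ k, ∫ x, u k x * g k x * f x)) :=
    tendsto_finsetSum _ fun k _ =>
      (LpTendsto.mul (r := 1) le_rfl ((hφg k).bdd_mul (hu k) (hC k)) hφf).integral
  refine tendsto_nhds_unique hlim (tendsto_const_nhds.congr fun n => ?_)
  -- Testing the divergence condition with φ², whose gradient is 2φ∇φ.
  have hsq := hdiv _ ((hφ n).mul_smooth (hφ n).1)
  simp only [pd_mul (hφ n).differentiable (hφ n).differentiable] at hsq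
  have e : ∀ k, ∫ x, u k x * (φ n x * pd k (φ n) x + φ n x * pd k (φ n) x) =
      2 * ∫ x, u k x * pd k (φ n) x * φ n x := by
    intro k
    rw [← integral_const_mul]
    congr 1
    funext x
    ring
  simp only [e, ← Finset.mul_sum] at hsq
  linarith

/-! ### Integrability of the fields of an H¹ strain -/

theorem MemH1St.memLqMat_weakGradient {S : R3 → Mat3} (hS : MemH1St S)
    {DS : Fin 3 → R3 → Mat3} (hw : IsWeakGradient S DS) (k : Fin 3) : MemLqMat 2 (DS k) := by
  intro i j
  obtain ⟨g, hg, hgr⟩ := (hS.1 i j).2 k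
  exact hg.ae_eq (hgr.ae_eq (hw k i j))

theorem MemH1St.memLqMat {S : R3 → Mat3} (hS : MemH1St S) {DS : Fin 3 → R3 → Mat3}
    (hw : IsWeakGradient S DS) (n : ℕ) [n.AtLeastTwo] (hn : n ≤ 6) :
    MemLqMat (OfNat.ofNat n) S := fun i j =>
  (hS.1 i j).1.of_two_six (memLp_six_of_weak_gradient (hS.1 i j).1
    (fun k => hS.memLqMat_weakGradient hw k i j) fun k φ hφ => (hw k i j).2 φ hφ) n hn

/-- Apart from integrability, the conditions defining L^q_st do not involve q. -/
theorem MemH1St.memLqSt_three {S : R3 → Mat3} (hS : MemH1St S) {DS : Fin 3 → R3 → Mat3}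
    (hw : IsWeakGradient S DS) : MemLqSt 3 S :=
  ⟨hS.memLqMat hw 3 (by norm_num), hS.memLqSt_two.2⟩

/-- The velocity gradient of an `H¹` strain belongs to `L⁴`. -/
theorem memLp_four_velocity_gradient {S : R3 → Mat3} (hS : MemLqMat 2 S)
    {DS : Fin 3 → R3 → Mat3} (hDS : ∀ k, MemLqMat 2 (DS k)) (hw : IsWeakGradient S DS)
    {U : Fin 3 → Fin 3 → R3 → ℝ} (hU : ∀ i j, MemLp (U i j) 2 volume)
    (hUF : ∀ i j, L2F (U i j) =ᵐ[volume]
      fun ξ => -2 * ∑ k, (qsym i k ξ : ℂ) * L2F (fun x => S x k j) ξ) (i j : Fin 3) :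
    MemLp (U i j) 4 volume := by
  -- Multipliers commute with derivatives: ∂_l of the velocity gradient of S is the velocity
  -- gradient of ∂_l S, hence in L².
  choose V hV hVF _ using fun l => exists_velocity_gradient_two (hDS l)
  refine (hU i j).of_two_six (memLp_six_of_weak_gradient (hU i j) (g := fun l => V l i j)
    (fun l => hV l i j) fun l φ hφ => weak_derivative_of_L2F (hU i j) (hV l i j) ?_ hφ) 4
    (by norm_num)
  filter_upwards [hVF l i j, hUF i j, ae_all_iff.2 fun k => L2F_weak_derivative (hS k j)
    (hDS l k j) (k := l) fun φ hφ => (hw l k j).2 φ hφ] with ξ a b c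
  rw [a, b]
  simp only [c, Finset.mul_sum]
  refine Finset.sum_congr rfl fun k _ => ?_
  ring

theorem IsVelocity.isSymGrad {S : R3 → Mat3} (hS : MemLqSt 2 S) {u : R3 → R3}
    (hu : IsVelocity S u) : IsSymGrad u S := by
  intro i j
  refine ⟨(hS.2.2.2 i j).1, fun φ hφ => ?_⟩
  rw [(hS.2.2.2 i j).2 φ hφ, distSymGrad, distSymGrad, distDeriv, distDeriv, distDeriv, distDeriv,
    regular, regular, (hu j).2 _ (hφ.pd i), (hu i).2 _ (hφ.pd j)]

theorem IsSymGrad.sum_integral_pd_eq_zero {u : R3 → R3} {S : R3 → Mat3} (h : IsSymGrad u S)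
    (hS : MemLqMat 2 S) (htr : ∀ᵐ x, (S x).trace = 0) {φ : R3 → ℝ} (hφ : IsTest φ) :
    ∑ k, ∫ x, u x k * pd k φ x = 0 := by
  have h1 : ∑ k, ∫ x, S x k k * φ x = 0 := by
    rw [← integral_finsetSum _ fun k _ => (hS k k).integrable_mul_two (hφ.memLp 2)]
    refine integral_eq_zero_of_ae ?_
    filter_upwards [htr] with x hx
    rw [← Finset.sum_mul]
    change (S x).trace * φ x = 0
    rw [hx, zero_mul]
  have h2 : ∀ k, ∫ x, S x k k * φ x = -∫ x, u x k * pd k φ x := by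
    intro k
    rw [(h k k).2 φ hφ, distSymGrad, distDeriv, regular]
    ring
  simpa [h2] using h1

theorem droppedTerm_apply (u w : R3 → R3) (S : R3 → Mat3) (DS : Fin 3 → R3 → Mat3) (x : R3)
    (i j : Fin 3) : droppedTerm u w S DS x i j =
      (∑ k, u x k * DS k x i j) + 1 / 3 * (∑ k, S x i k * S x k j) + 1 / 4 * (w x i * w x j) := by
  simp [droppedTerm, Matrix.add_apply, Matrix.sum_apply, Matrix.mul_apply, tensorSq]

theorem frob_droppedTerm (u w : R3 → R3) (S : R3 → Mat3) (DS : Fin 3 → R3 → Mat3) (x : R3) :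
    frob (droppedTerm u w S DS x) (S x) =
      (∑ p : Fin 3 × Fin 3, ∑ k, u x k * DS k x p.1 p.2 * S x p.1 p.2) +
        frob (S x) ((1 / 3 : ℝ) • (S x * S x) + (1 / 4 : ℝ) • tensorSq (w x)) := by
  simp only [frob, droppedTerm_apply, Fintype.sum_prod_type, ← Finset.sum_add_distrib]
  refine Finset.sum_congr rfl fun i _ => Finset.sum_congr rfl fun j _ => ?_
  simp only [Matrix.add_apply, Matrix.smul_apply, Matrix.mul_apply, tensorSq, Matrix.of_apply,
    smul_eq_mul, ← Finset.sum_mul]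
  ring

theorem MemH1St.exists_fields {S : R3 → Mat3} (hS : MemH1St S) :
    ∃ u w : R3 → R3, ∃ DS : Fin 3 → R3 → Mat3,
      IsVelocity S u ∧ IsVorticity S w ∧ IsWeakGradient S DS := by
  choose g hg hgr using fun k i j => (hS.1 i j).2 k
  have hw : IsWeakGradient S fun k x => Matrix.of fun i j => g k i j x := hgr
  have hS2 : MemLqMat 2 S := hS.memLqSt_two.1
  obtain ⟨u, hu, -⟩ := exists_bounded_velocity hS2 (hS.memLqMat_weakGradient hw) hw
  obtain ⟨U, hU, -, hUr⟩ := exists_velocity_gradient_two hS2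
  obtain ⟨w, hvort⟩ := exists_isVorticity (fun i j => locallyIntegrable_of_memLp_two (hU i j)) hUr
  exact ⟨u, w, _, hu, hvort, hw⟩

section fields

variable {S : R3 → Mat3} {u w : R3 → R3} {DS : Fin 3 → R3 → Mat3}

/-- An arbitrary representative of the velocity may be exchanged for the bounded continuous one
under integrals. -/
theorem MemH1St.exists_velocity_eq (hS : MemH1St S) (hu : IsVelocity S u)
    (hw : IsWeakGradient S DS) : ∃ v : R3 → R3, IsVelocity S v ∧ (∀ j, Continuous fun x => v x j) ∧
      (∃ C, ∀ x j, |v x j| ≤ C) ∧ ∀ᵐ x, ∀ j, u x j = v x j := by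
  obtain ⟨v, hv, hc, hb⟩ := exists_bounded_velocity hS.memLqSt_two.1
    (hS.memLqMat_weakGradient hw) hw
  exact ⟨v, hv, hc, hb, ae_all_iff.2 fun j => (hu j).ae_eq (hv j)⟩

/-- The transport term is bounded times L², and the two quadratic terms are products of L⁴
functions. -/
theorem MemH1St.memLqMat_droppedTerm (hS : MemH1St S) (hu : IsVelocity S u)
    (hvort : IsVorticity S w) (hw : IsWeakGradient S DS) :
    MemLqMat 2 (droppedTerm u w S DS) := by
  intro i j
  have hDS := hS.memLqMat_weakGradient hw
  have hS2 := hS.memLqSt_two.1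
  have hS4 : MemLqMat 4 S := hS.memLqMat hw 4 (by norm_num)
  obtain ⟨v, hv, hc, ⟨C, hC⟩, huv⟩ := hS.exists_velocity_eq hu hw
  obtain ⟨U, hU, hUF, hUr⟩ := exists_velocity_gradient_two hS2
  have hU4 := memLp_four_velocity_gradient hS2 hDS hw hU hUF
  have hw4 : ∀ k, MemLp (fun x => w x k) 4 volume := fun k =>
    ((hU4 _ _).sub (hU4 _ _)).ae_eq ((represents_distCurl
      (fun i j => locallyIntegrable_of_memLp_two (hU i j)) hUr k).ae_eq (hvort k))
  have h1 : MemLp (fun x => ∑ k, v x k * DS k x i j) 2 volume :=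
    memLp_finsetSum _ fun k _ => (hDS k i j).mul_bdd_two (hc k) fun x => hC x k
  have h2 : MemLp (fun x => ∑ k, S x i k * S x k j) 2 volume :=
    memLp_finsetSum _ fun k _ => (hS4 k j).mul' (hS4 i k)
  have h3 : MemLp (fun x => w x i * w x j) 2 volume := (hw4 j).mul' (hw4 i)
  refine ((h1.add (h2.const_mul (1 / 3))).add (h3.const_mul (1 / 4))).ae_eq ?_
  filter_upwards [huv] with x hx
  simp only [droppedTerm_apply, Pi.add_apply, hx]

/-- The transport part vanishes entry by entry, by skewness; the quadratic part vanishes by the L³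
identity. -/
theorem MemH1St.integral_frob_droppedTerm (hS : MemH1St S) (hu : IsVelocity S u)
    (hvort : IsVorticity S w) (hw : IsWeakGradient S DS) :
    ∫ x, frob (droppedTerm u w S DS x) (S x) = 0 := by
  have hDS := hS.memLqMat_weakGradient hw
  have hS2 := hS.memLqSt_two.1
  obtain ⟨v, hv, hc, ⟨C, hC⟩, huv⟩ := hS.exists_velocity_eq hu hw
  have hdiv : ∀ φ, IsTest φ → ∑ k, ∫ x, v x k * pd k φ x = 0 := fun φ hφ =>
    (hv.isSymGrad hS.memLqSt_two).sum_integral_pd_eq_zero hS2 hS.memLqSt_two.2.2.1 hφ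
  have htrans : ∀ i j, ∑ k, ∫ x, v x k * DS k x i j * S x i j = 0 := fun i j =>
    sum_integral_transport_eq_zero (u := fun k x => v x k) hc (fun k x => hC x k) hdiv (hS2 i j)
      (fun k => hDS k i j) fun k φ hφ => (hw k i j).2 φ hφ
  obtain ⟨-, -, -, -, hint, hzero⟩ := (strain_determinant_identity (hS.memLqSt_three hw)).2 w hvort
  have hI : ∀ (p : Fin 3 × Fin 3) (k : Fin 3),
      Integrable fun x => v x k * DS k x p.1 p.2 * S x p.1 p.2 := fun p k =>
    ((hDS k p.1 p.2).mul_bdd_two (hc k) fun x => hC x k).integrable_mul_two (hS2 p.1 p.2)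
  have hI' : ∀ p : Fin 3 × Fin 3,
      Integrable fun x => ∑ k, v x k * DS k x p.1 p.2 * S x p.1 p.2 := fun p =>
    integrable_finsetSum _ fun k _ => hI p k
  have e : (fun x => frob (droppedTerm u w S DS x) (S x)) =ᵐ[volume] fun x =>
      (∑ p : Fin 3 × Fin 3, ∑ k, v x k * DS k x p.1 p.2 * S x p.1 p.2) +
        frob (S x) ((1 / 3 : ℝ) • (S x * S x) + (1 / 4 : ℝ) • tensorSq (w x)) := by
    filter_upwards [huv] with x hx
    simp only [frob_droppedTerm, hx]
  rw [integral_congr_ae e, integral_add (integrable_finsetSum _ fun p _ => hI' p) hint, hzero,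
    add_zero, integral_finsetSum _ fun p _ => hI' p]
  refine Finset.sum_eq_zero fun p _ => ?_
  rw [integral_finsetSum _ fun k _ => hI p k]
  exact htrans p.1 p.2

theorem IsStrainProjection.integral_frob_eq {F P M : R3 → Mat3} (hP : IsStrainProjection F P)
    (hF : MemLqMat 2 F) (hM : MemLqSt 2 M) :
    ∫ x, frob (P x) (M x) = ∫ x, frob (F x) (M x) := by
  have h := hP.2 M hM
  have e : ∀ x, frob (F x - P x) (M x) = frob (F x) (M x) - frob (P x) (M x) := fun x => by
    simp only [frob, Matrix.sub_apply, sub_mul, Finset.sum_sub_distrib]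
  simp only [e] at h
  rw [integral_sub (integral_frob hF hM.1).1 (integral_frob hP.1.1 hM.1).1] at h
  linarith

end fields

end

theorem mainTheorem7 :
    (∀ S : R3 → Mat3, MemLqSt 3 S →
      (∃ ω : R3 → R3, IsVorticity S ω) ∧
      ∀ ω : R3 → R3, IsVorticity S ω →
        MemLqVec 3 ω ∧
        Integrable (fun x => (S x).det) ∧
        Integrable (fun x => frob (S x) (tensorSq (ω x))) ∧
        -4 * ∫ x, (S x).det = ∫ x, frob (S x) (tensorSq (ω x)) ∧
        Integrable (fun x =>
          frob (S x) ((1 / 3 : ℝ) • (S x * S x) + (1 / 4 : ℝ) • tensorSq (ω x))) ∧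
        ∫ x, frob (S x) ((1 / 3 : ℝ) • (S x * S x) + (1 / 4 : ℝ) • tensorSq (ω x)) = 0) ∧
    (∀ S : R3 → Mat3, MemH1St S →
      (∃ u ω : R3 → R3, ∃ DS : Fin 3 → R3 → Mat3,
        IsVelocity S u ∧ IsVorticity S ω ∧ IsWeakGradient S DS) ∧
      ∀ (u ω : R3 → R3) (DS : Fin 3 → R3 → Mat3),
        IsVelocity S u → IsVorticity S ω → IsWeakGradient S DS →
          IsSymGrad u S ∧
          MemLqMat 2 (droppedTerm u ω S DS) ∧
          (∃ P : R3 → Mat3, IsStrainProjection (droppedTerm u ω S DS) P) ∧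
          ∀ P : R3 → Mat3, IsStrainProjection (droppedTerm u ω S DS) P →
            ∫ x, frob (P x) (S x) = 0) := by
  refine ⟨fun S hS => strain_determinant_identity hS, fun S hS => ⟨hS.exists_fields, ?_⟩⟩
  intro u ω DS hu hω hDS
  have hF := hS.memLqMat_droppedTerm hu hω hDS
  refine ⟨hu.isSymGrad hS.memLqSt_two, hF, exists_isStrainProjection hF, fun P hP => ?_⟩
  -- The strain lies in L²_st itself, so pairing with it does not see the projection.
  rw [hP.integral_frob_eq hF hS.memLqSt_two, hS.integral_frob_droppedTerm hu hω hDS]
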